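/- Let $1<c<2$ and $t>4$. Let $\mathrm{PS}_c=\{\lfloor m^c\rfloor : m=1,2,3,\dots\}$ and $\phi(x)=x^{1/c}$. For a positive integer $N$, write $[N]=\{1,\dots,N\}$ and define $\nu=\nu_{c,N}:\mathbb Z\to[0,\infty)$ by $\nu(n)=\phi'(n)^{-1}$ if $n\in \mathrm{PS}_c$ and $n\le N$, and $\nu(n)=0$ otherwise. For finitely supported $f:\mathbb Z\to\mathbb C$, put $\hat f(\alpha)=\sum_{n\in\mathbb Z}f(n)e^{2\pi i n\alpha}$. Suppose that for some $\chi\in(0,1)$ there is a constant $C$, independent of $N$, such that $$\sup_{\alpha\in[0,1]}|\hat\nu(\alpha)-\hat 1_{[N]}(\alpha)|\le C N^{1-\chi}\qquad\text{for all integers } N\ge 1 .$$ Then there is a constant $K$, depending only on $c,\chi,t$, such that for every integer $N\ge1$ and every $\psi:\mathbb Z\to\mathbb C$ with $|\psi(n)|\le\nu(n)$ for all $n\in\mathbb Z$, $$\int_0^1|\hat\psi(\alpha)|^t\,d\alpha\le K N^{t-1}.$$ -/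

import Mathlib

namespace PiatetskiShapiro

/-- The Piatetski-Shapiro numbers `⌊m ^ c⌋`, where `m` runs over the positive integers. -/
def PS (c : ℝ) : Set ℤ := {n | ∃ m : ℕ, 1 ≤ m ∧ n = ⌊(m : ℝ) ^ c⌋}

/-- The Piatetski-Shapiro numbers that are at most `N`. -/
def PSle (c : ℝ) (N : ℕ) : Set ℤ := {n | n ∈ PS c ∧ n ≤ (N : ℤ)}

/-- The function `φ(x) = x ^ (1 / c)`. -/
noncomputable def phi (c : ℝ) (x : ℝ) : ℝ := x ^ (1 / c)

/-- The weight function `ν(n) = φ'(n)⁻¹ 1_{PS_c(N)}(n)`. -/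
noncomputable def nu (c : ℝ) (N : ℕ) : ℤ → ℝ :=
  (PSle c N).indicator (fun n => (deriv (phi c) (n : ℝ))⁻¹)

/-- The indicator function of `[N] = {1, …, N}`. -/
noncomputable def oneN (N : ℕ) : ℤ → ℂ := (Set.Icc 1 (N : ℤ)).indicator (fun _ => 1)

/-- The Fourier transform `α ↦ ∑ f(n) e(nα)` of a summable function on the integers,
where `e(x) = exp(2πix)`. -/
noncomputable def fourierZ (f : ℤ → ℂ) (α : ℝ) : ℂ :=
  ∑' n : ℤ, f n * Complex.exp (2 * Real.pi * Complex.I * ((n : ℂ) * (α : ℂ)))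

/-- The Fourier decay estimate: the supremum norm of `ν̂ - 1̂_[N]` is at most a constant times
`N ^ (1 - χ)`, where the constant does not depend on `N`. -/
def FourierDecay (c χ : ℝ) : Prop :=
  ∃ C : ℝ, ∀ N : ℕ, 1 ≤ N → ∀ α ∈ Set.Icc (0 : ℝ) 1,
    ‖fourierZ (fun n => (nu c N n : ℂ)) α - fourierZ (oneN N) α‖ ≤ C * (N : ℝ) ^ (1 - χ)

end PiatetskiShapiro

namespace PiatetskiShapiro

open MeasureTheory

/-! The integral is split according to the size of `f = ψ̂`, at the height `λ ≍ N^(1 - χ/2)`. Where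
`|f| > λ`, a Tomas–Stein type argument (`setIntegral_large_sq_le`) uses the decay of `ν̂ - 1̂` to
bound the mean square of `f` by `O(N)`, the bound that the full interval would give for coefficients
of size `1`. As `|f| ≪ N` everywhere, this part contributes `N^(t-2) * N`. Where `|f| ≤ λ`, one has
`|f|^t ≤ λ^(t-4) |f|^4`, and the power saved in `λ` pays for the `ε`-loss in the fourth moment bound
`N^(3+ε)` of `exists_fourth_moment_le`.

The fourth moment reduces, on dyadic blocks, to counting integers of size `M` with `|a^c + b^c - z^c
- w^c| ≤ 2`. Equality of two sums of floors implies this inequality, and a Cauchy–Schwarz argument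
on shifts reduces it to the thinner neighbourhood of width `M^(c-2)`, whose points lie at distance
`O(1/M)` from the cone `a^c + b^c = z^c + w^c`. `EnergyBound c β` says that there are `O(M^(2+β))`
such points; it is needed for every `β > 0`.

That count is self-improving. The cone is cut into `O(MJ)` angular blocks of width `h =
(MJ)^(-1/2)`. Over each block it lies in a plank of dimensions `M`, `√(M/J)`, `√(M/J)`, `1/J`, which
is majorized by a Gaussian. Poisson summation (`tsum_nestedGauss_dual`) replaces the plank by the
dual one, of length `J` in the normal direction and thin in the other three. The zero frequency
gives the volume `M²/J²` per block, so `M³/J` altogether. The other frequencies are lattice points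
near the dual cone, of the same shape with exponent `q = c/(c-1)`. By injectivity of the Gauss map,
a dual point of height `K` is seen by only `O(J²/K²)` blocks, up to the truncation parameter `T`.
The bound for `q` with exponent `β` makes the sum of `K^(-2)` over the dual points `O(J^β)`, again
up to `T`. Hence the count is `M³/J + M² J^β`, up to small losses (`exists_energy_recursion`).
Optimizing `J` sends `β` to `β - β²/4` for all `c > 1` at once, and starting from the trivial `β =
1` the infimum of admissible exponents is `0`. -/

/-! ### Gaussian sums and Poisson summation on `ℤ⁴`. -/

open Complex in
theorem twisted_gaussian_poisson {a : ℝ} (ha : 0 < a) (s θ : ℝ) :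
    ∑' m : ℤ, cexp (-Real.pi * a * (m - s) ^ 2) * cexp (2 * Real.pi * I * (m * θ)) =
      ((√a)⁻¹ : ℝ) * ∑' k : ℤ, cexp (-Real.pi / a * (k + θ) ^ 2) *
        cexp (2 * Real.pi * I * (s * (k + θ))) := by
  have hac : (a : ℂ) ≠ 0 := by exact_mod_cast ha.ne'
  have h := Complex.tsum_exp_neg_quadratic (a := (a : ℂ)) (by simpa using ha) (a * s + I * θ)
  have h1 : ∀ m : ℤ, cexp (-Real.pi * a * (m - s) ^ 2) * cexp (2 * Real.pi * I * (m * θ)) =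
      cexp (-Real.pi * a * s ^ 2) *
        cexp (-Real.pi * a * m ^ 2 + 2 * Real.pi * (a * s + I * θ) * m) := fun m ↦ by
    rw [← Complex.exp_add, ← Complex.exp_add]; congr 1; ring
  have h2 : ∀ k : ℤ, cexp (-Real.pi * a * s ^ 2) *
      cexp (-Real.pi / a * (((-k : ℤ) : ℂ) + I * (a * s + I * θ)) ^ 2) =
      cexp (-Real.pi / a * (k + θ) ^ 2) * cexp (2 * Real.pi * I * (s * (k + θ))) := fun k ↦ by
    rw [← Complex.exp_add, ← Complex.exp_add]; congr 1
    push_cast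
    field_simp
    ring_nf
    simp only [I_sq, I_pow_four, show I ^ 3 = -I by rw [pow_succ, I_sq]; ring]
    ring
  simp_rw [h1, tsum_mul_left, h]
  rw [← (Equiv.neg ℤ).tsum_eq]
  simp only [Equiv.neg_apply, ← h2, tsum_mul_left]
  rw [Real.sqrt_eq_rpow, ← one_div, mul_left_comm]
  congr 2
  push_cast [Complex.ofReal_cpow ha.le]
  rfl

open Complex in
theorem summable_gaussian_shift {a : ℝ} (ha : 0 < a) (s : ℝ) :
    Summable fun m : ℤ ↦ Real.exp (-Real.pi * a * (m - s) ^ 2) := by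
  have h := summable_jacobiTheta₂_term_iff (-I * (a * s : ℝ)) (I * a) |>.2 (by simpa using ha)
  have h2 := (h.norm.mul_left (Real.exp (-Real.pi * a * s ^ 2)))
  refine h2.congr fun m ↦ ?_
  rw [jacobiTheta₂_term, Complex.norm_exp, ← Real.exp_add]
  congr 1
  have : ((m : ℂ) ^ 2).re = (m : ℝ) ^ 2 := by
    rw [← Complex.ofReal_intCast, ← Complex.ofReal_pow, Complex.ofReal_re]
  simp [this]
  ring

/-- After Poisson summation the translation by `s` survives only as a unimodular phase, which the
triangle inequality removes. The bound is therefore uniform in `s`. -/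
theorem tsum_gaussian_shift_le {a : ℝ} (ha : 0 < a) (s : ℝ) :
    ∑' m : ℤ, Real.exp (-Real.pi * a * (m - s) ^ 2) ≤
      (√a)⁻¹ * ∑' k : ℤ, Real.exp (-Real.pi * a⁻¹ * (k - (0 : ℝ)) ^ 2) := by
  have h := twisted_gaussian_poisson ha s 0
  have e : ((∑' m : ℤ, Real.exp (-Real.pi * a * (m - s) ^ 2) : ℝ) : ℂ) =
      ∑' m : ℤ, Complex.exp (-Real.pi * a * (m - s) ^ 2) *
        Complex.exp (2 * Real.pi * Complex.I * (m * (0 : ℝ))) := by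
    push_cast; simp
  have hn : ∀ k : ℤ, ‖Complex.exp (-Real.pi / a * (k + (0 : ℝ)) ^ 2) *
      Complex.exp (2 * Real.pi * Complex.I * (s * (k + (0 : ℝ))))‖ =
      Real.exp (-Real.pi * a⁻¹ * (k - (0 : ℝ)) ^ 2) := fun k ↦ by
    rw [norm_mul, Complex.norm_exp, Complex.norm_exp, ← Real.exp_add]
    congr 1
    have : (-(Real.pi : ℂ) / a * (k + (0 : ℝ)) ^ 2) = ((-Real.pi / a * k ^ 2 : ℝ) : ℂ) := by
      push_cast; ring
    rw [this, Complex.ofReal_re]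
    have : (2 * (Real.pi : ℂ) * Complex.I * (s * (k + (0 : ℝ)))) =
      ((2 * Real.pi * s * k : ℝ) : ℂ) * Complex.I := by push_cast; ring
    rw [this, Complex.re_ofReal_mul, Complex.I_re]
    ring
  have hs := summable_gaussian_shift (inv_pos.2 ha) 0
  calc _ = ‖((∑' m : ℤ, Real.exp (-Real.pi * a * (m - s) ^ 2) : ℝ) : ℂ)‖ := by
        rw [Complex.norm_real, Real.norm_of_nonneg (tsum_nonneg fun _ ↦ (Real.exp_pos _).le)]
    _ = _ := by rw [e, h]
    _ ≤ _ := by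
        rw [norm_mul, Complex.norm_real, Real.norm_of_nonneg (by positivity)]
        gcongr
        refine (norm_tsum_le_tsum_norm (by simpa only [hn] using hs)).trans (le_of_eq ?_)
        simp only [hn]

/-- A uniform bound for the sums over the integers of the translates of a Gaussian. -/
noncomputable def gaussBound (a : ℝ) : ℝ :=
  (√a)⁻¹ * ∑' k : ℤ, Real.exp (-Real.pi * a⁻¹ * (k - (0 : ℝ)) ^ 2)

/-- The inductive step for triangular Gaussians: the centre of the new variable may depend
arbitrarily on the earlier ones, since the bound for one variable is uniform in the centre. -/
theorem summable_mul_gaussian {ι : Type*} {F : ι → ℝ} (hF : Summable F) (h0 : ∀ i, 0 ≤ F i)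
    {a : ℝ} (ha : 0 < a) (s : ι → ℝ) :
    Summable (fun x : ι × ℤ ↦ F x.1 * Real.exp (-Real.pi * a * (x.2 - s x.1) ^ 2)) ∧
    ∑' x : ι × ℤ, F x.1 * Real.exp (-Real.pi * a * (x.2 - s x.1) ^ 2) ≤
      gaussBound a * ∑' i, F i := by
  have hfib : ∀ i, Summable fun m : ℤ ↦ F i * Real.exp (-Real.pi * a * (m - s i) ^ 2) :=
    fun i ↦ (summable_gaussian_shift ha (s i)).mul_left _
  have hle : ∀ i, ∑' m : ℤ, F i * Real.exp (-Real.pi * a * (m - s i) ^ 2) ≤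
      gaussBound a * F i := fun i ↦ by
    rw [tsum_mul_left, mul_comm]
    exact mul_le_mul_of_nonneg_right (tsum_gaussian_shift_le ha _) (h0 i)
  have hs2 : Summable fun i ↦ ∑' m : ℤ, F i * Real.exp (-Real.pi * a * (m - s i) ^ 2) :=
    Summable.of_nonneg_of_le
      (fun i ↦ tsum_nonneg fun m ↦ mul_nonneg (h0 i) (Real.exp_pos _).le) hle (hF.mul_left _)
  have hs : Summable (fun x : ι × ℤ ↦ F x.1 * Real.exp (-Real.pi * a * (x.2 - s x.1) ^ 2)) :=
    (summable_prod_of_nonneg fun x ↦ mul_nonneg (h0 _) (Real.exp_pos _).le).2 ⟨hfib, hs2⟩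
  refine ⟨hs, ?_⟩
  rw [hs.tsum_prod, ← tsum_mul_left]
  exact hs2.tsum_le_tsum hle (hF.mul_left _)

/-- The additive character `x ↦ exp(2πix)`. -/
noncomputable def addChar (x : ℝ) : ℂ := Complex.exp (2 * Real.pi * Complex.I * x)

/-- The Gaussian `x ↦ exp(-πax²)`. -/
noncomputable def gauss (a x : ℝ) : ℝ := Real.exp (-Real.pi * a * x ^ 2)

theorem gauss_nonneg (a x : ℝ) : 0 ≤ gauss a x := (Real.exp_pos _).le

theorem addChar_add (x y : ℝ) : addChar (x + y) = addChar x * addChar y := by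
  rw [addChar, addChar, addChar, ← Complex.exp_add]; push_cast; ring_nf

theorem norm_addChar (x : ℝ) : ‖addChar x‖ = 1 := by
  rw [addChar, Complex.norm_exp]
  have : 2 * (Real.pi : ℂ) * Complex.I * x = ((2 * Real.pi * x : ℝ) : ℂ) * Complex.I := by
    push_cast; ring
  rw [this, Complex.re_ofReal_mul, Complex.I_re, mul_zero, Real.exp_zero]

theorem addChar_zero : addChar 0 = 1 := by simp [addChar]

theorem gauss_poisson {a : ℝ} (ha : 0 < a) (s θ : ℝ) :
    ∑' m : ℤ, (gauss a (m - s) : ℂ) * addChar (m * θ) =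
      ((√a)⁻¹ : ℝ) * ∑' k : ℤ, (gauss a⁻¹ (k + θ) : ℂ) * addChar (s * (k + θ)) := by
  have h := twisted_gaussian_poisson ha s θ
  simp only [gauss, addChar]
  push_cast
  rw [← div_eq_mul_inv] at *
  simpa [div_eq_mul_inv] using h

theorem gauss_poisson_shift {a : ℝ} (ha : 0 < a) (s θ : ℝ) :
    ∑' m : ℤ, (gauss a (m - s) : ℂ) * addChar (θ * (m - s)) =
      ((√a)⁻¹ : ℝ) * ∑' k : ℤ, (gauss a⁻¹ (k + θ) : ℂ) * addChar (s * k) := by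
  have h := gauss_poisson ha s θ
  have e1 : ∀ m : ℤ, (gauss a (m - s) : ℂ) * addChar (θ * (m - s)) =
      addChar (-(s * θ)) * ((gauss a (m - s) : ℂ) * addChar (m * θ)) := fun m ↦ by
    rw [mul_left_comm, ← addChar_add]; ring_nf
  have e2 : ∀ k : ℤ, (gauss a⁻¹ (k + θ) : ℂ) * addChar (s * k) =
      addChar (-(s * θ)) * ((gauss a⁻¹ (k + θ) : ℂ) * addChar (s * (k + θ))) := fun m ↦ by
    rw [mul_left_comm, ← addChar_add]; ring_nf
  simp_rw [e1, e2, tsum_mul_left, h]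
  ring

/-- A Gaussian in four integer variables whose exponent is a sum of four squares, in triangular
form. -/
noncomputable def nestedGauss (a₀ a₁ a₂ a₃ : ℝ) (s₁ : ℤ → ℝ) (s₂ : ℤ × ℤ → ℝ)
    (s₃ : (ℤ × ℤ) × ℤ → ℝ) (x : ((ℤ × ℤ) × ℤ) × ℤ) : ℝ :=
  gauss a₀ (x.1.1.1 - 0) * gauss a₁ (x.1.1.2 - s₁ x.1.1.1) * gauss a₂ (x.1.2 - s₂ x.1.1) *
    gauss a₃ (x.2 - s₃ x.1)

theorem nestedGauss_nonneg (a₀ a₁ a₂ a₃ : ℝ) (s₁ : ℤ → ℝ) (s₂ : ℤ × ℤ → ℝ)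
    (s₃ : (ℤ × ℤ) × ℤ → ℝ) (x : ((ℤ × ℤ) × ℤ) × ℤ) :
    0 ≤ nestedGauss a₀ a₁ a₂ a₃ s₁ s₂ s₃ x := by
  unfold nestedGauss gauss; positivity

theorem gaussBound_nonneg (a : ℝ) : 0 ≤ gaussBound a := by
  unfold gaussBound
  exact mul_nonneg (by positivity) (tsum_nonneg fun _ ↦ (Real.exp_pos _).le)

theorem summable_nestedGauss {a₀ a₁ a₂ a₃ : ℝ} (h₀ : 0 < a₀) (h₁ : 0 < a₁) (h₂ : 0 < a₂)
    (h₃ : 0 < a₃) (s₁ : ℤ → ℝ) (s₂ : ℤ × ℤ → ℝ) (s₃ : (ℤ × ℤ) × ℤ → ℝ) :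
    Summable (nestedGauss a₀ a₁ a₂ a₃ s₁ s₂ s₃) ∧
    ∑' x, nestedGauss a₀ a₁ a₂ a₃ s₁ s₂ s₃ x ≤
      gaussBound a₃ * (gaussBound a₂ * (gaussBound a₁ * gaussBound a₀)) := by
  have t0 := summable_gaussian_shift h₀ 0
  have b0 := tsum_gaussian_shift_le h₀ 0
  have t1 := summable_mul_gaussian t0 (fun _ ↦ (Real.exp_pos _).le) h₁ s₁
  have t2 := summable_mul_gaussian t1.1
    (fun _ ↦ mul_nonneg (Real.exp_pos _).le (Real.exp_pos _).le) h₂ s₂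
  have t3 := summable_mul_gaussian t2.1
    (fun _ ↦ mul_nonneg (mul_nonneg (Real.exp_pos _).le (Real.exp_pos _).le)
      (Real.exp_pos _).le) h₃ s₃
  refine ⟨t3.1, t3.2.trans ?_⟩
  have g := gaussBound_nonneg
  refine mul_le_mul_of_nonneg_left (t2.2.trans ?_) (g _)
  refine mul_le_mul_of_nonneg_left (t1.2.trans ?_) (g _)
  exact mul_le_mul_of_nonneg_left b0 (g _)

theorem tsum_iterate_four {f : ((ℤ × ℤ) × ℤ) × ℤ → ℂ} (hf : Summable f) :
    ∑' x, f x = ∑' (p : ℤ) (q : ℤ) (r : ℤ) (s : ℤ), f (((p, q), r), s) := by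
  rw [hf.tsum_prod, hf.prod.tsum_prod, hf.prod.prod.tsum_prod]

/-- The cyclic rotation of the coordinates of a quadruple. -/
def rotateEquiv : ((ℤ × ℤ) × ℤ) × ℤ ≃ ((ℤ × ℤ) × ℤ) × ℤ where
  toFun x := (((x.1.1.2, x.1.2), x.2), x.1.1.1)
  invFun x := (((x.2, x.1.1.1), x.1.1.2), x.1.2)
  left_inv _ := rfl
  right_inv _ := rfl

/-- Moves the last coordinate of a quadruple to the second place. -/
def lastToSecondEquiv : ((ℤ × ℤ) × ℤ) × ℤ ≃ ((ℤ × ℤ) × ℤ) × ℤ where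
  toFun x := (((x.1.1.1, x.2), x.1.1.2), x.1.2)
  invFun x := (((x.1.1.1, x.1.2), x.2), x.1.1.2)
  left_inv _ := rfl
  right_inv _ := rfl

/-- Poisson summation for a Gaussian on `ℤ⁴` adapted to a ray and a hyperplane containing it. -/
theorem tsum_nestedGauss_dual {α ρ σ : ℝ} (hα : 0 < α) (hρ : 0 < ρ) (hσ : 0 < σ)
    (u₁ u₂ u₃ n₁ n₂ : ℝ) :
    ∑' x, nestedGauss α ρ ρ σ (fun z ↦ u₁ * z) (fun y ↦ u₂ * y.1)
        (fun y ↦ u₃ * y.1.1 + n₁ * (y.1.2 - u₁ * y.1.1) + n₂ * (y.2 - u₂ * y.1.1)) x =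
      (√α)⁻¹ * ρ⁻¹ * (√σ)⁻¹ *
      ∑' k, nestedGauss σ⁻¹ ρ⁻¹ ρ⁻¹ α⁻¹ (fun z ↦ -(n₁ * z)) (fun y ↦ -(n₂ * y.1))
        (fun y ↦ -(u₃ * y.1.1 + u₁ * y.1.2 + u₂ * y.2)) k := by
  have hσ' := inv_pos.2 hσ
  have hρ' := inv_pos.2 hρ
  have hα' := inv_pos.2 hα
  set s₃ : (ℤ × ℤ) × ℤ → ℝ :=
    fun y ↦ u₃ * y.1.1 + n₁ * (y.1.2 - u₁ * y.1.1) + n₂ * (y.2 - u₂ * y.1.1) with hs₃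
  set s₃' : (ℤ × ℤ) × ℤ → ℝ := fun y ↦ -(u₃ * y.1.1 + u₁ * y.1.2 + u₂ * y.2) with hs₃'
  have sL := (summable_nestedGauss hα hρ hρ hσ (fun z ↦ u₁ * z) (fun y ↦ u₂ * y.1) s₃).1
  have sR := (summable_nestedGauss hσ' hρ' hρ' hα' (fun z ↦ -(n₁ * z)) (fun y ↦ -(n₂ * y.1)) s₃').1
  -- the sums after one application of Poisson summation on either side
  let H : ((ℤ × ℤ) × ℤ) × ℤ → ℂ := fun x ↦
    (nestedGauss α ρ ρ σ⁻¹ (fun z ↦ u₁ * z) (fun y ↦ u₂ * y.1) (fun _ ↦ 0) x : ℂ) *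
      addChar (s₃ x.1 * x.2)
  have sH : Summable H := by
    refine Summable.of_norm ?_
    refine (summable_nestedGauss hα hρ hρ hσ' (fun z ↦ u₁ * z) (fun y ↦ u₂ * y.1)
      (fun _ ↦ 0)).1.congr fun x ↦ ?_
    rw [norm_mul, norm_addChar, mul_one, Complex.norm_real,
      Real.norm_of_nonneg (nestedGauss_nonneg ..)]
  let K : ((ℤ × ℤ) × ℤ) × ℤ → ℂ := fun x ↦
    (nestedGauss σ⁻¹ ρ⁻¹ ρ⁻¹ α (fun z ↦ -(n₁ * z)) (fun y ↦ -(n₂ * y.1)) (fun _ ↦ 0) x : ℂ) *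
      addChar (-s₃' x.1 * x.2)
  have sK : Summable K := by
    refine Summable.of_norm ?_
    refine (summable_nestedGauss hσ' hρ' hρ' hα (fun z ↦ -(n₁ * z)) (fun y ↦ -(n₂ * y.1))
      (fun _ ↦ 0)).1.congr fun x ↦ ?_
    rw [norm_mul, norm_addChar, mul_one, Complex.norm_real,
      Real.norm_of_nonneg (nestedGauss_nonneg ..)]
  have eL : ((∑' x, nestedGauss α ρ ρ σ (fun z ↦ u₁ * z) (fun y ↦ u₂ * y.1) s₃ x : ℝ) : ℂ) =
      ((√σ)⁻¹ : ℝ) * ∑' x, H x := by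
    rw [sL.tsum_prod, sH.tsum_prod, ← tsum_mul_left, Complex.ofReal_tsum]
    refine tsum_congr fun y ↦ ?_
    have h := gauss_poisson hσ (s₃ y) 0
    simp only [mul_zero, addChar_zero, mul_one, add_zero] at h
    rw [Complex.ofReal_tsum]
    simp only [H, nestedGauss, Complex.ofReal_mul, sub_zero, mul_assoc, tsum_mul_left]
    rw [h]
    ring
  have eR : ∑' x, K x = ((√α)⁻¹ : ℝ) * ((∑' k, nestedGauss σ⁻¹ ρ⁻¹ ρ⁻¹ α⁻¹ (fun z ↦ -(n₁ * z))
      (fun y ↦ -(n₂ * y.1)) s₃' k : ℝ) : ℂ) := by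
    rw [sR.tsum_prod, sK.tsum_prod, Complex.ofReal_tsum, ← tsum_mul_left]
    refine tsum_congr fun y ↦ ?_
    have h := gauss_poisson hα 0 (-s₃' y)
    simp only [zero_mul, addChar_zero, mul_one, sub_zero] at h
    rw [Complex.ofReal_tsum]
    simp only [K, nestedGauss, Complex.ofReal_mul, sub_zero, mul_assoc, tsum_mul_left]
    simp only [mul_comm (-s₃' y), h, sub_eq_add_neg]
    ring
  have eH : ∑' x, H x = ∑' (z' : ℤ) (z : ℤ) (a : ℤ) (b : ℤ), H (((z, a), b), z') :=
    (rotateEquiv.tsum_eq H).symm.trans (tsum_iterate_four (rotateEquiv.summable_iff.2 sH))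
  have eK : ∑' x, K x = ∑' (z' : ℤ) (z : ℤ) (a : ℤ) (b : ℤ), K (((z', a), b), z) :=
    (lastToSecondEquiv.symm.tsum_eq K).symm.trans
      (tsum_iterate_four (lastToSecondEquiv.symm.summable_iff.2 sK))
  -- Both sums retain the pair of `z` and the variable `z'` dual to `w`. For fixed `z, z'`, Poisson
  -- summation in `a` and in `b` exchanges them; each contributes a factor `(√ρ)⁻¹`.
  have hHK : ∑' x, H x = (ρ⁻¹ : ℝ) * ∑' x, K x := by
    rw [eH, eK, ← tsum_mul_left]
    refine tsum_congr fun z' ↦ ?_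
    rw [← tsum_mul_left]
    refine tsum_congr fun z ↦ ?_
    have h1 := gauss_poisson_shift hρ (u₁ * z) (n₁ * z')
    have h2 := gauss_poisson_shift hρ (u₂ * z) (n₂ * z')
    have lhs : ∀ a b : ℤ, H (((z, a), b), z') =
        (gauss α z * gauss σ⁻¹ z' * addChar (u₃ * z * z')) *
        ((gauss ρ (a - u₁ * z) * addChar (n₁ * z' * (a - u₁ * z))) *
        (gauss ρ (b - u₂ * z) * addChar (n₂ * z' * (b - u₂ * z)))) := fun a b ↦ by
      have : s₃ ((z, a), b) * z' = u₃ * z * z' + n₁ * z' * (a - u₁ * z) +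
        n₂ * z' * (b - u₂ * z) := by simp only [hs₃]; ring
      simp only [H, nestedGauss, this, addChar_add, sub_zero]
      push_cast
      ring
    have rhs : ∀ a b : ℤ, K (((z', a), b), z) =
        (gauss α z * gauss σ⁻¹ z' * addChar (u₃ * z * z')) *
        ((gauss ρ⁻¹ (a + n₁ * z') * addChar (u₁ * z * a)) *
        (gauss ρ⁻¹ (b + n₂ * z') * addChar (u₂ * z * b))) := fun a b ↦ by
      have : -s₃' ((z', a), b) * z = u₃ * z * z' + u₁ * z * a + u₂ * z * b := by
        simp only [hs₃']; ring
      simp only [K, nestedGauss, this, addChar_add, sub_zero, sub_neg_eq_add]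
      push_cast
      ring
    simp only [lhs, rhs, tsum_mul_left, tsum_mul_right, h1, h2]
    have hr : ((ρ⁻¹ : ℝ) : ℂ) = ((√ρ)⁻¹ : ℝ) * ((√ρ)⁻¹ : ℝ) := by
      rw [← Complex.ofReal_mul, ← mul_inv, Real.mul_self_sqrt hρ.le]
    rw [hr]
    ring
  have := eL.trans (by rw [hHK, eR])
  rw [← Complex.ofReal_inj, this]
  push_cast
  ring

/-! ### Geometry of the surface `u₁^c + u₂^c = 1 + u₃^c`, its tangent planes and its dual. -/

theorem rpow_le_of_mem_Icc {B x : ℝ} (hB : 1 ≤ B) (hx : x ∈ Set.Icc B⁻¹ B) (r : ℝ) :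
    x ^ r ≤ B ^ |r| := by
  have hB0 : 0 < B := by linarith
  have hx0 : 0 < x := (inv_pos.2 hB0).trans_le hx.1
  rcases le_total 0 r with h | h
  · rw [abs_of_nonneg h]; exact Real.rpow_le_rpow hx0.le hx.2 h
  · rw [abs_of_nonpos h, Real.rpow_neg hB0.le, ← Real.inv_rpow hB0.le]
    exact Real.rpow_le_rpow_of_nonpos (inv_pos.2 hB0) hx.1 h

theorem rpow_mem_Icc {B x : ℝ} (hB : 1 ≤ B) (hx : x ∈ Set.Icc B⁻¹ B) (r : ℝ) :
    x ^ r ∈ Set.Icc (B ^ |r|)⁻¹ (B ^ |r|) := by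
  have hB0 : 0 < B := by linarith
  have hx0 : 0 < x := (inv_pos.2 hB0).trans_le hx.1
  refine ⟨?_, rpow_le_of_mem_Icc hB hx r⟩
  rw [inv_le_comm₀ (by positivity) (by positivity), ← Real.rpow_neg hx0.le]
  simpa using rpow_le_of_mem_Icc hB hx (-r)

/-- On a compact interval of positive reals, powers are Lipschitz and satisfy a second order
Taylor estimate. -/
theorem exists_rpow_lipschitz (s : ℝ) {B : ℝ} (hB : 1 ≤ B) :
    ∃ L : ℝ, 0 < L ∧ ∀ x ∈ Set.Icc B⁻¹ B, ∀ y ∈ Set.Icc B⁻¹ B, |x ^ s - y ^ s| ≤ L * |x - y| := by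
  have hB0 : 0 < B := by linarith
  refine ⟨|s| * B ^ |s - 1| + 1, by positivity, fun x hx y hy ↦ ?_⟩
  have h := Convex.norm_image_sub_le_of_norm_hasDerivWithin_le (f := fun x : ℝ ↦ x ^ s)
    (f' := fun x ↦ s * x ^ (s - 1)) (s := Set.Icc B⁻¹ B) (C := |s| * B ^ |s - 1|)
    (fun x hx ↦ ?_) (fun x hx ↦ ?_) (convex_Icc _ _) hy hx
  · simp only [Real.norm_eq_abs] at h
    exact h.trans (mul_le_mul_of_nonneg_right (by linarith) (abs_nonneg _))
  · exact (Real.hasDerivAt_rpow_const (Or.inl ((inv_pos.2 hB0).trans_le hx.1).ne')).hasDerivWithinAt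
  · have hx0 : 0 < x := (inv_pos.2 hB0).trans_le hx.1
    rw [norm_mul, Real.norm_eq_abs, Real.norm_of_nonneg (by positivity)]
    exact mul_le_mul_of_nonneg_left (rpow_le_of_mem_Icc hB hx _) (abs_nonneg _)

theorem exists_rpow_taylor (s : ℝ) {B : ℝ} (hB : 1 ≤ B) :
    ∃ L : ℝ, 0 < L ∧ ∀ x ∈ Set.Icc B⁻¹ B, ∀ y ∈ Set.Icc B⁻¹ B,
      |x ^ s - y ^ s - s * y ^ (s - 1) * (x - y)| ≤ L * (x - y) ^ 2 := by
  have hB0 : 0 < B := by linarith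
  obtain ⟨L, hL, hl⟩ := exists_rpow_lipschitz (s - 1) hB
  refine ⟨|s| * L + 1, by positivity, fun x hx y hy ↦ ?_⟩
  have hsub : Set.uIcc x y ⊆ Set.Icc B⁻¹ B := Set.OrdConnected.uIcc_subset Set.ordConnected_Icc hx hy
  have h := Convex.norm_image_sub_le_of_norm_hasDerivWithin_le
    (f := fun z : ℝ ↦ z ^ s - s * y ^ (s - 1) * z)
    (f' := fun z ↦ s * z ^ (s - 1) - s * y ^ (s - 1)) (s := Set.uIcc x y) (C := |s| * L * |x - y|)
    (fun z hz ↦ ?_) (fun z hz ↦ ?_) (convex_uIcc _ _) Set.right_mem_uIcc Set.left_mem_uIcc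
  · simp only [Real.norm_eq_abs] at h
    rw [mul_assoc _ |x - y| |x - y|, abs_mul_abs_self] at h
    calc _ = |x ^ s - s * y ^ (s - 1) * x - (y ^ s - s * y ^ (s - 1) * y)| := by ring_nf
      _ ≤ _ := h
      _ ≤ _ := by nlinarith [sq_nonneg (x - y)]
  · have h1 := (Real.hasDerivAt_rpow_const (x := z) (p := s)
      (Or.inl ((inv_pos.2 hB0).trans_le (hsub hz).1).ne'))
    have h2 := (hasDerivAt_id z).const_mul (s * y ^ (s - 1))
    simpa using (h1.fun_sub h2).hasDerivWithinAt
  · rw [← mul_sub, norm_mul, Real.norm_eq_abs, Real.norm_eq_abs, mul_assoc]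
    refine mul_le_mul_of_nonneg_left ((hl z (hsub hz) y hy).trans ?_) (abs_nonneg _)
    refine mul_le_mul_of_nonneg_left ?_ hL.le
    rw [abs_sub_comm z y, abs_sub_comm x y]
    exact Set.abs_sub_right_of_mem_uIcc hz

/-- The triple `(u₁, u₂, u₃)` is a point of the surface `u₁ᶜ + u₂ᶜ = 1 + u₃ᶜ` in a compact part of
the positive octant. -/
structure OnSurface (c B u₁ u₂ u₃ : ℝ) : Prop where
  mem₁ : u₁ ∈ Set.Icc B⁻¹ B
  mem₂ : u₂ ∈ Set.Icc B⁻¹ B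
  mem₃ : u₃ ∈ Set.Icc B⁻¹ B
  eq : u₁ ^ c + u₂ ^ c = 1 + u₃ ^ c

/-- The third coordinate of the point of the surface over `(u₁, u₂)`. -/
noncomputable def surfaceHeight (c u₁ u₂ : ℝ) : ℝ := (u₁ ^ c + u₂ ^ c - 1) ^ c⁻¹

theorem mem_Icc_inv_of_le {A B x : ℝ} (hA : 1 ≤ A) (hAB : A ≤ B) (hx : x ∈ Set.Icc A⁻¹ A) :
    x ∈ Set.Icc B⁻¹ B :=
  ⟨(inv_anti₀ (by linarith) hAB).trans hx.1, hx.2.trans hAB⟩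

/-- Points close to the surface are close to its tangent planes at neighbouring points. -/
theorem exists_tangent_approx {c A D : ℝ} (hc : 1 < c) (hA : 1 ≤ A) (hD : 0 ≤ D) :
    ∃ B C h₀ : ℝ, 1 ≤ B ∧ 0 < C ∧ 0 < h₀ ∧ ∀ h, 0 < h → h ≤ h₀ → ∀ v₁ ∈ Set.Icc A⁻¹ A,
      ∀ v₂ ∈ Set.Icc A⁻¹ A, ∀ v₃ ∈ Set.Icc A⁻¹ A,
      |v₁ ^ c + v₂ ^ c - 1 - v₃ ^ c| ≤ D * h ^ 2 →
      ∀ u₁ u₂ : ℝ, 0 ≤ v₁ - u₁ → v₁ - u₁ ≤ h → 0 ≤ v₂ - u₂ → v₂ - u₂ ≤ h →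
      OnSurface c B u₁ u₂ (surfaceHeight c u₁ u₂) ∧
      |v₃ - surfaceHeight c u₁ u₂ - (u₁ / surfaceHeight c u₁ u₂) ^ (c - 1) * (v₁ - u₁) -
        (u₂ / surfaceHeight c u₁ u₂) ^ (c - 1) * (v₂ - u₂)| ≤ C * h ^ 2 := by
  have hA0 : 0 < A := by linarith
  have hc0 : 0 < c := by linarith
  have h2A : 1 ≤ 2 * A := by linarith
  set E := 2 * A ^ c with hE
  have hAc : 1 ≤ A ^ c := Real.one_le_rpow hA hc0.le
  have hE1 : 1 ≤ E := by linarith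
  set B := max (2 * A) (E ^ |c⁻¹|) with hBdef
  have hB : 1 ≤ B := h2A.trans (le_max_left _ _)
  have hB0 : 0 < B := by linarith
  obtain ⟨L₁, hL₁, l₁⟩ := exists_rpow_lipschitz c hB
  obtain ⟨L₂, hL₂, l₂⟩ := exists_rpow_lipschitz c⁻¹ hE1
  obtain ⟨L₃, hL₃, l₃⟩ := exists_rpow_taylor c hB
  set G := 2 * L₁ + D with hG
  -- The second entry keeps `u₁, u₂` above half of `A⁻¹`; the third keeps `u₁^c + u₂^c - 1` within
  -- `(2A^c)⁻¹` of `v₃^c`, so that its `c`-th root stays in a compact range.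
  set h₀ := min 1 (min ((2 * A)⁻¹) ((2 * A ^ c)⁻¹ / G)) with hh₀
  have hG0 : 0 < G := by positivity
  set P := B ^ |c - 1| with hP
  have hP0 : 0 < P := by positivity
  -- The quadratic Taylor errors in the three coordinates, with `|v₃ - u₃| ≤ L₂Gh`, plus the defect
  -- `D`. The divisions by `c` and by `u₃^(c-1) ≥ P⁻¹` solve the linearized equation for `v₃`.
  refine ⟨B, (2 * L₃ + L₃ * (L₂ * G) ^ 2 + D) / c * P, h₀, hB, by positivity, by positivity, ?_⟩
  intro h hh hle v₁ hv₁ v₂ hv₂ v₃ hv₃ hv u₁ u₂ a₁ b₁ a₂ b₂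
  have hle1 : h ≤ 1 := hle.trans (min_le_left _ _)
  have hle2 : h ≤ (2 * A)⁻¹ := hle.trans ((min_le_right _ _).trans (min_le_left _ _))
  have hle3 : G * h ≤ (2 * A ^ c)⁻¹ := by
    have := hle.trans ((min_le_right _ _).trans (min_le_right _ _))
    rwa [le_div_iff₀ hG0, mul_comm] at this
  have half : A⁻¹ - (2 * A)⁻¹ = (2 * A)⁻¹ := by field_simp; norm_num
  have mu : ∀ u v : ℝ, v ∈ Set.Icc A⁻¹ A → 0 ≤ v - u → v - u ≤ h → u ∈ Set.Icc B⁻¹ B := by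
    intro u v hv h1 h2
    refine mem_Icc_inv_of_le h2A (le_max_left _ _) ⟨?_, ?_⟩
    · have := hv.1; linarith
    · have := hv.2; linarith
  have mu₁ := mu u₁ v₁ hv₁ a₁ b₁
  have mu₂ := mu u₂ v₂ hv₂ a₂ b₂
  have hAB : A ≤ B := by have := le_max_left (2 * A) (E ^ |c⁻¹|); linarith
  have mv : ∀ v ∈ Set.Icc A⁻¹ A, v ∈ Set.Icc B⁻¹ B := fun v hv ↦ mem_Icc_inv_of_le hA hAB hv
  have d₁ := l₁ v₁ (mv v₁ hv₁) u₁ mu₁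
  have d₂ := l₁ v₂ (mv v₂ hv₂) u₂ mu₂
  rw [abs_of_nonneg a₁] at d₁
  rw [abs_of_nonneg a₂] at d₂
  set X := u₁ ^ c + u₂ ^ c - 1 with hX
  have hhsq : h ^ 2 ≤ h := by nlinarith
  have hdiff : |v₃ ^ c - X| ≤ G * h := by
    have : v₃ ^ c - X = -(v₁ ^ c + v₂ ^ c - 1 - v₃ ^ c) + ((v₁ ^ c - u₁ ^ c) + (v₂ ^ c - u₂ ^ c)) := by
      rw [hX]; ring
    rw [this]
    refine (abs_add_le _ _).trans ?_
    rw [abs_neg]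
    have h1 := abs_add_le (v₁ ^ c - u₁ ^ c) (v₂ ^ c - u₂ ^ c)
    have h2 : L₁ * (v₁ - u₁) ≤ L₁ * h := by gcongr
    have h3 : L₁ * (v₂ - u₂) ≤ L₁ * h := by gcongr
    have h4 : D * h ^ 2 ≤ D * h := by gcongr
    have : G * h = 2 * (L₁ * h) + D * h := by rw [hG]; ring
    linarith
  have hv₃c := rpow_mem_Icc hA hv₃ c
  rw [abs_of_pos hc0] at hv₃c
  have hinvle : (2 * A ^ c)⁻¹ ≤ 1 := inv_le_one_of_one_le₀ (by linarith)
  have halfc : (A ^ c)⁻¹ - (2 * A ^ c)⁻¹ = (2 * A ^ c)⁻¹ := by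
    have : 0 < A ^ c := by positivity
    field_simp; norm_num
  have hXmem : X ∈ Set.Icc E⁻¹ E := by
    have := abs_le.1 hdiff
    constructor
    · have := hv₃c.1; linarith
    · have := hv₃c.2; linarith
  have hX0 : 0 < X := (inv_pos.2 (by linarith)).trans_le hXmem.1
  set u₃ := surfaceHeight c u₁ u₂ with hu₃
  have hu₃X : u₃ = X ^ c⁻¹ := rfl
  have mu₃ : u₃ ∈ Set.Icc B⁻¹ B :=
    mem_Icc_inv_of_le (Real.one_le_rpow hE1 (abs_nonneg _)) (le_max_right _ _)
      (rpow_mem_Icc hE1 hXmem c⁻¹)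
  have hu₃c : u₃ ^ c = X := by rw [hu₃X, Real.rpow_inv_rpow hX0.le hc0.ne']
  have hu₃0 : 0 < u₃ := (inv_pos.2 hB0).trans_le mu₃.1
  have hv₃0 : 0 < v₃ := (inv_pos.2 hA0).trans_le hv₃.1
  have hu₁0 : 0 < u₁ := (inv_pos.2 hB0).trans_le mu₁.1
  have hu₂0 : 0 < u₂ := (inv_pos.2 hB0).trans_le mu₂.1
  refine ⟨⟨mu₁, mu₂, mu₃, by rw [hu₃c, hX]; ring⟩, ?_⟩
  have hE' : v₃ ^ c ∈ Set.Icc E⁻¹ E :=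
    mem_Icc_inv_of_le hAc (by linarith) hv₃c
  have d₃ : |v₃ - u₃| ≤ L₂ * G * h := by
    have := l₂ _ hE' X hXmem
    rw [Real.rpow_rpow_inv hv₃0.le hc0.ne', ← hu₃X] at this
    refine this.trans ?_
    rw [mul_assoc]; gcongr
  have t₁ := l₃ v₁ (mv _ hv₁) u₁ mu₁
  have t₂ := l₃ v₂ (mv _ hv₂) u₂ mu₂
  have t₃ := l₃ v₃ (mv _ hv₃) u₃ mu₃
  have s₁ : L₃ * (v₁ - u₁) ^ 2 ≤ L₃ * h ^ 2 := by gcongr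
  have s₂ : L₃ * (v₂ - u₂) ^ 2 ≤ L₃ * h ^ 2 := by gcongr
  have s₃ : L₃ * (v₃ - u₃) ^ 2 ≤ L₃ * (L₂ * G) ^ 2 * h ^ 2 := by
    rw [mul_assoc, ← mul_pow, ← sq_abs (v₃ - u₃)]; gcongr
  have hn : ∀ u, 0 < u → (u / u₃) ^ (c - 1) = u ^ (c - 1) / u₃ ^ (c - 1) := fun u hu ↦
    Real.div_rpow hu.le hu₃0.le _
  rw [hn _ hu₁0, hn _ hu₂0]
  have hp0 : 0 < u₃ ^ (c - 1) := by positivity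
  have key : |c * (u₃ ^ (c - 1) * (v₃ - u₃) - u₁ ^ (c - 1) * (v₁ - u₁) -
      u₂ ^ (c - 1) * (v₂ - u₂))| ≤ (2 * L₃ + L₃ * (L₂ * G) ^ 2 + D) * h ^ 2 := by
    have e : c * (u₃ ^ (c - 1) * (v₃ - u₃) - u₁ ^ (c - 1) * (v₁ - u₁) -
      u₂ ^ (c - 1) * (v₂ - u₂)) = -(v₃ ^ c - u₃ ^ c - c * u₃ ^ (c - 1) * (v₃ - u₃)) +
        (v₁ ^ c - u₁ ^ c - c * u₁ ^ (c - 1) * (v₁ - u₁)) +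
        (v₂ ^ c - u₂ ^ c - c * u₂ ^ (c - 1) * (v₂ - u₂)) -
        (v₁ ^ c + v₂ ^ c - 1 - v₃ ^ c) := by rw [hu₃c, hX]; ring
    have e2 : (2 * L₃ + L₃ * (L₂ * G) ^ 2 + D) * h ^ 2 =
        L₃ * h ^ 2 + L₃ * h ^ 2 + L₃ * (L₂ * G) ^ 2 * h ^ 2 + D * h ^ 2 := by ring
    rw [e, e2]
    have r₁ := abs_le.1 (t₁.trans s₁)
    have r₂ := abs_le.1 (t₂.trans s₂)
    have r₃ := abs_le.1 (t₃.trans s₃)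
    have r₄ := abs_le.1 hv
    exact abs_le.2 ⟨by linarith [r₁.1, r₂.1, r₃.2, r₄.2], by linarith [r₁.2, r₂.2, r₃.1, r₄.1]⟩
  rw [abs_mul, abs_of_pos hc0] at key
  have e : v₃ - u₃ - u₁ ^ (c - 1) / u₃ ^ (c - 1) * (v₁ - u₁) -
      u₂ ^ (c - 1) / u₃ ^ (c - 1) * (v₂ - u₂) = (u₃ ^ (c - 1) * (v₃ - u₃) -
        u₁ ^ (c - 1) * (v₁ - u₁) - u₂ ^ (c - 1) * (v₂ - u₂)) * (u₃ ^ (c - 1))⁻¹ := by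
    field_simp
  rw [e, abs_mul, abs_of_pos (inv_pos.2 hp0)]
  have hinv : (u₃ ^ (c - 1))⁻¹ ≤ P := by
    rw [← Real.rpow_neg hu₃0.le, hP, ← abs_neg]
    exact rpow_le_of_mem_Icc hB mu₃ _
  calc _ ≤ ((2 * L₃ + L₃ * (L₂ * G) ^ 2 + D) * h ^ 2 / c) * P := by
        gcongr
        rw [le_div_iff₀ hc0, mul_comm]; exact key
    _ = _ := by ring

/-- The inverse of the Gauss map of the surface is Lipschitz. -/
theorem exists_gauss_map_inverse_lipschitz {c B : ℝ} (hc : 1 < c) (hB : 1 ≤ B) :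
    ∃ C : ℝ, 0 < C ∧ ∀ u₁ u₂ u₃ w₁ w₂ w₃ ε : ℝ, OnSurface c B u₁ u₂ u₃ → OnSurface c B w₁ w₂ w₃ →
      |(u₁ / u₃) ^ (c - 1) - (w₁ / w₃) ^ (c - 1)| ≤ ε →
      |(u₂ / u₃) ^ (c - 1) - (w₂ / w₃) ^ (c - 1)| ≤ ε →
      |u₁ - w₁| ≤ C * ε ∧ |u₂ - w₂| ≤ C * ε := by
  have hB0 : 0 < B := by linarith
  have hc0 : 0 < c := by linarith
  have hB2 : 1 ≤ B ^ 2 := one_le_pow₀ hB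
  have hF : 1 ≤ (B ^ 2) ^ |c - 1| := Real.one_le_rpow hB2 (abs_nonneg _)
  have hH : 1 ≤ B ^ |(-c)| := Real.one_le_rpow hB (abs_nonneg _)
  obtain ⟨L₁, hL₁, l₁⟩ := exists_rpow_lipschitz (c - 1)⁻¹ hF
  obtain ⟨L₂, hL₂, l₂⟩ := exists_rpow_lipschitz c hB2
  obtain ⟨L₃, hL₃, l₃⟩ := exists_rpow_lipschitz (-c)⁻¹ hH
  refine ⟨L₁ * B + B ^ 2 * (L₃ * (2 * (L₂ * L₁))), by positivity, ?_⟩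
  intro u₁ u₂ u₃ w₁ w₂ w₃ ε hu hw h₁ h₂
  have pos : ∀ x ∈ Set.Icc B⁻¹ B, 0 < x := fun x hx ↦ (inv_pos.2 hB0).trans_le hx.1
  have hdiv : ∀ x ∈ Set.Icc B⁻¹ B, ∀ y ∈ Set.Icc B⁻¹ B, x / y ∈ Set.Icc (B ^ 2)⁻¹ (B ^ 2) := by
    intro x hx y hy
    have := pos x hx
    have := pos y hy
    have h1 : y⁻¹ ≤ B := by rw [inv_le_comm₀ (by positivity) hB0]; exact hy.1
    have h2 : B⁻¹ ≤ y⁻¹ := inv_anti₀ (by positivity) hy.2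
    rw [div_eq_mul_inv, sq, mul_inv]
    exact ⟨by gcongr; exact hx.1, by gcongr; exact hx.2⟩
  have hroot : ∀ x y, x ∈ Set.Icc (B ^ 2)⁻¹ (B ^ 2) → y ∈ Set.Icc (B ^ 2)⁻¹ (B ^ 2) →
      |x ^ (c - 1) - y ^ (c - 1)| ≤ ε → |x - y| ≤ L₁ * ε := by
    intro x y hx hy h
    have := l₁ _ (rpow_mem_Icc hB2 hx _) _ (rpow_mem_Icc hB2 hy _)
    have px : 0 < x := (inv_pos.2 (by positivity)).trans_le hx.1
    have py : 0 < y := (inv_pos.2 (by positivity)).trans_le hy.1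
    rw [Real.rpow_rpow_inv px.le (by linarith), Real.rpow_rpow_inv py.le (by linarith)] at this
    exact this.trans (by gcongr)
  have r₁ := hroot _ _ (hdiv _ hu.mem₁ _ hu.mem₃) (hdiv _ hw.mem₁ _ hw.mem₃) h₁
  have r₂ := hroot _ _ (hdiv _ hu.mem₂ _ hu.mem₃) (hdiv _ hw.mem₂ _ hw.mem₃) h₂
  -- The normal direction determines the ratios to the third coordinate; the equation of the surface
  -- divided by `z^c` then recovers that coordinate.
  have hneg : ∀ x y z, OnSurface c B x y z → z ^ (-c) = (x / z) ^ c + (y / z) ^ c - 1 := by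
    intro x y z h
    have := pos _ h.mem₁
    have := pos _ h.mem₂
    have := pos _ h.mem₃
    rw [Real.div_rpow (by positivity) (by positivity), Real.div_rpow (by positivity) (by positivity),
      Real.rpow_neg (by positivity), ← add_div, h.eq]
    field_simp
    ring
  have c₁ := (l₂ _ (hdiv _ hu.mem₁ _ hu.mem₃) _ (hdiv _ hw.mem₁ _ hw.mem₃)).trans
    (mul_le_mul_of_nonneg_left r₁ hL₂.le)
  have c₂ := (l₂ _ (hdiv _ hu.mem₂ _ hu.mem₃) _ (hdiv _ hw.mem₂ _ hw.mem₃)).trans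
    (mul_le_mul_of_nonneg_left r₂ hL₂.le)
  have hdneg : |u₃ ^ (-c) - w₃ ^ (-c)| ≤ 2 * (L₂ * L₁) * ε := by
    rw [hneg _ _ _ hu, hneg _ _ _ hw]
    have r₁ := abs_le.1 c₁
    have r₂ := abs_le.1 c₂
    exact abs_le.2 ⟨by linarith [r₁.1, r₂.1], by linarith [r₁.2, r₂.2]⟩
  have pu := pos _ hu.mem₃
  have pw := pos _ hw.mem₃
  have r₃ : |u₃ - w₃| ≤ L₃ * (2 * (L₂ * L₁)) * ε := by
    have := l₃ _ (rpow_mem_Icc hB hu.mem₃ _) _ (rpow_mem_Icc hB hw.mem₃ _)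
    rw [Real.rpow_rpow_inv pu.le (by linarith), Real.rpow_rpow_inv pw.le (by linarith)] at this
    refine this.trans ?_
    rw [mul_assoc]
    gcongr
  have fin : ∀ x y, x ∈ Set.Icc B⁻¹ B → y ∈ Set.Icc B⁻¹ B → |x / u₃ - y / w₃| ≤ L₁ * ε →
      |x - y| ≤ (L₁ * B + B ^ 2 * (L₃ * (2 * (L₂ * L₁)))) * ε := by
    intro x y hx hy h
    have e : x - y = (x / u₃ - y / w₃) * u₃ + y / w₃ * (u₃ - w₃) := by field_simp; ring
    rw [e]
    refine (abs_add_le _ _).trans ?_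
    rw [abs_mul, abs_mul, abs_of_pos pu, abs_of_pos (div_pos (pos _ hy) pw)]
    have e1 : |x / u₃ - y / w₃| * u₃ ≤ L₁ * ε * B := by
      have := (abs_nonneg _).trans h
      gcongr; exact hu.mem₃.2
    have e2 : y / w₃ * |u₃ - w₃| ≤ B ^ 2 * (L₃ * (2 * (L₂ * L₁)) * ε) := by
      gcongr; exact (hdiv _ hy _ hw.mem₃).2
    linarith
  exact ⟨fin _ _ hu.mem₁ hw.mem₁ r₁, fin _ _ hu.mem₂ hw.mem₂ r₂⟩

/-- Vectors close to a normal direction of the surface are close to the cone over the dual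
surface. -/
theorem exists_dual_approx {c B : ℝ} (hc : 1 < c) (hB : 1 ≤ B) :
    ∃ B' D' ε₀ : ℝ, 1 ≤ B' ∧ 0 ≤ D' ∧ 0 < ε₀ ∧ ∀ u₁ u₂ u₃ K x y w : ℝ, OnSurface c B u₁ u₂ u₃ →
      1 ≤ K → |x - K * (u₁ / u₃) ^ (c - 1)| ≤ ε₀ → |y - K * (u₂ / u₃) ^ (c - 1)| ≤ ε₀ →
      |w + u₃ * K - u₁ * x - u₂ * y| ≤ ε₀ / K →
      x ∈ Set.Icc (K / B') (B' * K) ∧ y ∈ Set.Icc (K / B') (B' * K) ∧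
      w ∈ Set.Icc (K / B') (B' * K) ∧
      |x ^ (c / (c - 1)) + y ^ (c / (c - 1)) - K ^ (c / (c - 1)) - w ^ (c / (c - 1))| ≤
        D' * K ^ (c / (c - 1) - 2) := by
  have hB0 : 0 < B := by linarith
  have hc0 : 0 < c := by linarith
  have hp : 0 < c - 1 := by linarith
  set q := c / (c - 1) with hq
  have hq1 : q - 1 = (c - 1)⁻¹ := by rw [hq]; field_simp; ring
  have hq0 : 0 < q := by positivity
  have hB2 : 1 ≤ B ^ 2 := one_le_pow₀ hB
  set P := (B ^ 2) ^ |c - 1| with hPdef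
  have hP : 1 ≤ P := Real.one_le_rpow hB2 (abs_nonneg _)
  have hP0 : 0 < P := by linarith
  have h2P : 1 ≤ 2 * P := by linarith
  obtain ⟨L, hL, l⟩ := exists_rpow_taylor q h2P
  set ε₀ := (2 * P)⁻¹ / (1 + 2 * B) with hε
  have hε0 : 0 < ε₀ := by positivity
  have hεB : ε₀ * (1 + 2 * B) = (2 * P)⁻¹ := by rw [hε]; field_simp
  have hεle : ε₀ ≤ (2 * P)⁻¹ := by rw [← hεB]; nlinarith
  have hi1 : (2 * P)⁻¹ ≤ 1 := inv_le_one_of_one_le₀ h2P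
  refine ⟨2 * P, 3 * L + q * B, ε₀, h2P, by positivity, hε0, ?_⟩
  intro u₁ u₂ u₃ K x y w hu hK hx hy hw
  have pos : ∀ x ∈ Set.Icc B⁻¹ B, 0 < x := fun x hx ↦ (inv_pos.2 hB0).trans_le hx.1
  have p₁ := pos _ hu.mem₁
  have p₂ := pos _ hu.mem₂
  have p₃ := pos _ hu.mem₃
  have hK0 : 0 < K := by linarith
  have hinv3 : u₃⁻¹ ∈ Set.Icc B⁻¹ B :=
    ⟨inv_anti₀ p₃ hu.mem₃.2, by rw [inv_le_comm₀ p₃ hB0]; exact hu.mem₃.1⟩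
  have hdiv : ∀ x ∈ Set.Icc B⁻¹ B, x / u₃ ∈ Set.Icc (B ^ 2)⁻¹ (B ^ 2) := by
    intro x hx
    have := pos x hx
    rw [div_eq_mul_inv, sq, mul_inv]
    exact ⟨mul_le_mul hx.1 hinv3.1 (by positivity) (by positivity),
      mul_le_mul hx.2 hinv3.2 (by positivity) (by positivity)⟩
  have m₁ := rpow_mem_Icc hB2 (hdiv _ hu.mem₁) (c - 1)
  have m₂ := rpow_mem_Icc hB2 (hdiv _ hu.mem₂) (c - 1)
  have m₄ : u₃⁻¹ ^ (c - 1) ∈ Set.Icc P⁻¹ P :=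
    rpow_mem_Icc hB2 (mem_Icc_inv_of_le hB (by nlinarith) hinv3) (c - 1)
  rw [← hPdef] at m₁ m₂
  set n₁ := (u₁ / u₃) ^ (c - 1) with hn₁
  set n₂ := (u₂ / u₃) ^ (c - 1) with hn₂
  set n₄ := u₃⁻¹ ^ (c - 1) with hn₄
  have hun : ∀ u, 0 < u → u * (u / u₃) ^ (c - 1) = u ^ c / u₃ ^ (c - 1) := by
    intro u h
    rw [Real.div_rpow h.le p₃.le, ← mul_div_assoc]
    congr 1
    nth_rw 1 [← Real.rpow_one u]
    rw [← Real.rpow_add h]; ring_nf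
  -- Euler's identity for the homogeneous cone: the normal is orthogonal to the ray. It identifies
  -- `K * n₄` as the expected value of `w`.
  have hrel : u₁ * n₁ + u₂ * n₂ = u₃ + n₄ := by
    rw [hn₁, hn₂, hun _ p₁, hun _ p₂, ← add_div, hu.eq, hn₄, Real.inv_rpow p₃.le, add_div,
      add_comm, inv_eq_one_div]
    congr 1
    rw [div_eq_iff (by positivity)]
    nth_rw 2 [← Real.rpow_one u₃]
    rw [← Real.rpow_add p₃]; ring_nf
  set X := x / K with hX
  set Y := y / K with hY
  set W := w / K with hW
  have hsc : ∀ z n : ℝ, |z - K * n| ≤ ε₀ → |z / K - n| ≤ ε₀ / K := by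
    intro z n h
    have : z / K - n = (z - K * n) / K := by field_simp
    rw [this, abs_div, abs_of_pos hK0]; gcongr
  have dX := hsc _ _ hx
  have dY := hsc _ _ hy
  have hwK : |W + u₃ - u₁ * X - u₂ * Y| ≤ ε₀ / K ^ 2 := by
    have : W + u₃ - u₁ * X - u₂ * Y = (w + u₃ * K - u₁ * x - u₂ * y) / K := by
      rw [hW, hX, hY]; field_simp
    rw [this, abs_div, abs_of_pos hK0, sq, ← div_div]; gcongr
  have hKK : ε₀ / K ^ 2 ≤ ε₀ / K := by gcongr; nlinarith
  have dW : |W - n₄| ≤ (2 * P)⁻¹ / K := by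
    have e : W - n₄ = (W + u₃ - u₁ * X - u₂ * Y) + u₁ * (X - n₁) + u₂ * (Y - n₂) := by
      linear_combination hrel
    have b₁ : |u₁ * (X - n₁)| ≤ B * (ε₀ / K) := by
      rw [abs_mul, abs_of_pos p₁]; gcongr; exact hu.mem₁.2
    have b₂ : |u₂ * (Y - n₂)| ≤ B * (ε₀ / K) := by
      rw [abs_mul, abs_of_pos p₂]; gcongr; exact hu.mem₂.2
    have e2 : (2 * P)⁻¹ / K = ε₀ / K + B * (ε₀ / K) + B * (ε₀ / K) := by
      rw [← hεB]; ring
    rw [e, e2]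
    exact (abs_add_le _ _).trans (add_le_add ((abs_add_le _ _).trans
      (add_le_add (hwK.trans hKK) b₁)) b₂)
  have hεK : ε₀ / K ≤ (2 * P)⁻¹ / K := by gcongr
  have hK1 : (2 * P)⁻¹ / K ≤ (2 * P)⁻¹ := div_le_self (by positivity) hK
  have hhalf : P⁻¹ - (2 * P)⁻¹ = (2 * P)⁻¹ := by field_simp; norm_num
  have memI : ∀ z n : ℝ, n ∈ Set.Icc P⁻¹ P → |z - n| ≤ (2 * P)⁻¹ / K →
      z ∈ Set.Icc (2 * P)⁻¹ (2 * P) := by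
    intro z n hn h
    have := abs_le.1 h
    have h1 := hn.1
    have h2 := hn.2
    constructor <;> linarith
  have iX := memI _ _ m₁ (dX.trans hεK)
  have iY := memI _ _ m₂ (dY.trans hεK)
  have iW := memI _ _ m₄ dW
  have memK : ∀ z : ℝ, z / K ∈ Set.Icc (2 * P)⁻¹ (2 * P) → z ∈ Set.Icc (K / (2 * P)) (2 * P * K) := by
    intro z hz
    constructor
    · have := hz.1; rw [le_div_iff₀ hK0] at this; rw [div_eq_inv_mul]; exact this
    · have := hz.2; rwa [div_le_iff₀ hK0] at this
  refine ⟨memK _ iX, memK _ iY, memK _ iW, ?_⟩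
  have i2 : ∀ n ∈ Set.Icc P⁻¹ P, n ∈ Set.Icc (2 * P)⁻¹ (2 * P) := fun n hn ↦
    mem_Icc_inv_of_le hP (by linarith) hn
  have t₁ := l _ iX _ (i2 _ m₁)
  have t₂ := l _ iY _ (i2 _ m₂)
  have t₄ := l _ iW _ (i2 _ m₄)
  have hpw : ∀ v : ℝ, 0 < v → (v ^ (c - 1)) ^ (q - 1) = v := fun v hv ↦ by
    rw [hq1, Real.rpow_rpow_inv hv.le hp.ne']
  have hpq : ∀ v : ℝ, 0 < v → (v ^ (c - 1)) ^ q = v ^ c := fun v hv ↦ by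
    rw [← Real.rpow_mul hv.le, hq]; congr 1; field_simp
  have hnq : n₁ ^ q + n₂ ^ q = 1 + n₄ ^ q := by
    rw [hn₁, hn₂, hn₄, hpq _ (by positivity), hpq _ (by positivity), hpq _ (by positivity),
      Real.div_rpow p₁.le p₃.le, Real.div_rpow p₂.le p₃.le, ← add_div, hu.eq, Real.inv_rpow p₃.le]
    field_simp
    ring
  rw [hn₁, hpw _ (by positivity), ← hn₁] at t₁
  rw [hn₂, hpw _ (by positivity), ← hn₂] at t₂
  rw [hn₄, hpw _ (by positivity), ← hn₄] at t₄
  have sq1 : ∀ z n : ℝ, |z - n| ≤ (2 * P)⁻¹ / K → L * (z - n) ^ 2 ≤ L * (K ^ 2)⁻¹ := by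
    intro z n h
    rw [← sq_abs, ← inv_pow]
    gcongr
    refine h.trans ?_
    rw [div_eq_mul_inv]
    exact mul_le_of_le_one_left (by positivity) hi1
  have s₁ := sq1 _ _ (dX.trans hεK)
  have s₂ := sq1 _ _ (dY.trans hεK)
  have s₄ := sq1 _ _ dW
  -- The main cancellation. The individual deviations are only `O(1/K)`, but the gradient of the
  -- dual equation at the normal is proportional to the original ray, so the linear term is the
  -- component along the ray, which is `O(1/K²)` like the quadratic errors.
  have lin : |q * (u₁ / u₃) * (X - n₁) + q * (u₂ / u₃) * (Y - n₂) - q * u₃⁻¹ * (W - n₄)| ≤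
      q * B * (K ^ 2)⁻¹ := by
    have e : q * (u₁ / u₃) * (X - n₁) + q * (u₂ / u₃) * (Y - n₂) - q * u₃⁻¹ * (W - n₄) =
        -(q * u₃⁻¹ * (W + u₃ - u₁ * X - u₂ * Y)) := by
      have : n₄ = u₁ * n₁ + u₂ * n₂ - u₃ := by linarith
      rw [this]; ring
    rw [e, abs_neg, abs_mul, abs_of_pos (by positivity : 0 < q * u₃⁻¹)]
    gcongr
    · exact hinv3.2
    · refine hwK.trans ?_
      rw [div_eq_mul_inv]
      exact mul_le_of_le_one_left (by positivity) (hεle.trans hi1)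
  have main : |X ^ q + Y ^ q - 1 - W ^ q| ≤ (3 * L + q * B) * (K ^ 2)⁻¹ := by
    have e : X ^ q + Y ^ q - 1 - W ^ q = (X ^ q - n₁ ^ q - q * (u₁ / u₃) * (X - n₁)) +
        (Y ^ q - n₂ ^ q - q * (u₂ / u₃) * (Y - n₂)) - (W ^ q - n₄ ^ q - q * u₃⁻¹ * (W - n₄)) +
        (q * (u₁ / u₃) * (X - n₁) + q * (u₂ / u₃) * (Y - n₂) - q * u₃⁻¹ * (W - n₄)) := by
      linear_combination hnq
    have e2 : (3 * L + q * B) * (K ^ 2)⁻¹ = L * (K ^ 2)⁻¹ + L * (K ^ 2)⁻¹ + L * (K ^ 2)⁻¹ +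
        q * B * (K ^ 2)⁻¹ := by ring
    rw [e, e2]
    have r₁ := abs_le.1 (t₁.trans s₁)
    have r₂ := abs_le.1 (t₂.trans s₂)
    have r₄ := abs_le.1 (t₄.trans s₄)
    have r := abs_le.1 lin
    exact abs_le.2 ⟨by linarith [r₁.1, r₂.1, r₄.2, r.1], by linarith [r₁.2, r₂.2, r₄.1, r.2]⟩
  have px : 0 ≤ X := (by positivity : (0 : ℝ) ≤ (2 * P)⁻¹).trans iX.1
  have py : 0 ≤ Y := (by positivity : (0 : ℝ) ≤ (2 * P)⁻¹).trans iY.1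
  have pw : 0 ≤ W := (by positivity : (0 : ℝ) ≤ (2 * P)⁻¹).trans iW.1
  have e : x ^ q + y ^ q - K ^ q - w ^ q = K ^ q * (X ^ q + Y ^ q - 1 - W ^ q) := by
    have hz : ∀ z : ℝ, 0 ≤ z / K → z ^ q = K ^ q * (z / K) ^ q := fun z h ↦ by
      rw [← Real.mul_rpow hK0.le h, mul_div_cancel₀ _ hK0.ne']
    rw [hz x px, hz y py, hz w pw]; ring
  rw [e, abs_mul, abs_of_pos (by positivity : 0 < K ^ q)]
  have e2 : K ^ (q - 2) = K ^ q * (K ^ 2)⁻¹ := by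
    rw [Real.rpow_sub hK0, div_eq_mul_inv]; norm_num
  rw [e2]
  calc _ ≤ K ^ q * ((3 * L + q * B) * (K ^ 2)⁻¹) := by gcongr
    _ = _ := by ring

/-! ### Lattice points near the cone and the trivial count. -/

/-- Integer quadruples, in the order `(((z, a), b), w)`. -/
abbrev Quad : Type := ((ℤ × ℤ) × ℤ) × ℤ

/-- All coordinates of the quadruple are comparable to `M`, and it is within bounded distance
`≍ M⁻¹` of the cone `aᶜ + bᶜ = zᶜ + wᶜ`. -/
structure NearCone (c A D M : ℝ) (x : Quad) : Prop where
  z_mem : (x.1.1.1 : ℝ) ∈ Set.Icc M (A * M)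
  a_mem : (x.1.1.2 : ℝ) ∈ Set.Icc M (A * M)
  b_mem : (x.1.2 : ℝ) ∈ Set.Icc M (A * M)
  w_mem : (x.2 : ℝ) ∈ Set.Icc M (A * M)
  near : |(x.1.1.2 : ℝ) ^ c + (x.1.2 : ℝ) ^ c - (x.1.1.1 : ℝ) ^ c - (x.2 : ℝ) ^ c| ≤ D * M ^ (c - 2)

/-- The number of integer points of size `M` near the cone is `O(M ^ (2 + β))`. -/
def EnergyBound (c β : ℝ) : Prop :=
  ∀ A D : ℝ, 1 ≤ A → 0 ≤ D → ∃ C : ℝ, 0 ≤ C ∧ ∀ M : ℝ, 1 ≤ M → ∀ s : Finset Quad,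
    (∀ x ∈ s, NearCone c A D M x) → (s.card : ℝ) ≤ C * M ^ (2 + β)

theorem EnergyBound.mono {c β β' : ℝ} (h : EnergyBound c β) (hβ : β ≤ β') : EnergyBound c β' := by
  intro A D hA hD
  obtain ⟨C, hC, H⟩ := h A D hA hD
  refine ⟨C, hC, fun M hM s hs ↦ (H M hM s hs).trans ?_⟩
  gcongr

theorem card_le_of_pairwise_close {s : Finset ℤ} {d : ℝ} (hd : 0 ≤ d)
    (h : ∀ x ∈ s, ∀ y ∈ s, |(x : ℝ) - y| ≤ d) : (s.card : ℝ) ≤ d + 1 := by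
  rcases s.eq_empty_or_nonempty with rfl | hs
  · simp; linarith
  have hsub : s ⊆ Finset.Icc (s.min' hs) (s.min' hs + ⌊d⌋) := fun x hx ↦ by
    rw [Finset.mem_Icc]
    refine ⟨s.min'_le x hx, ?_⟩
    have := (le_abs_self _).trans (h x hx _ (s.min'_mem hs))
    have : x - s.min' hs ≤ ⌊d⌋ := Int.le_floor.2 (by push_cast; exact this)
    linarith
  have h1 := Finset.card_le_card hsub
  rw [Int.card_Icc] at h1
  have h0 : 0 ≤ ⌊d⌋ := Int.floor_nonneg.2 hd
  have h2 : (s.card : ℤ) ≤ ⌊d⌋ + 1 := by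
    have : (s.card : ℤ) ≤ ((s.min' hs + ⌊d⌋ + 1 - s.min' hs).toNat : ℤ) := by exact_mod_cast h1
    rw [Int.toNat_of_nonneg (by linarith)] at this
    linarith
  have h3 : (s.card : ℝ) ≤ ⌊d⌋ + 1 := by exact_mod_cast h2
  linarith [Int.floor_le d]

theorem card_pair_le_of_pairwise_close {s : Finset (ℤ × ℤ)} {d : ℝ} (hd : 0 ≤ d)
    (h : ∀ x ∈ s, ∀ y ∈ s, |(x.1 : ℝ) - y.1| ≤ d ∧ |(x.2 : ℝ) - y.2| ≤ d) :
    (s.card : ℝ) ≤ (d + 1) ^ 2 := by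
  have hsub : s ⊆ s.image Prod.fst ×ˢ s.image Prod.snd := fun x hx ↦
    Finset.mem_product.2 ⟨Finset.mem_image_of_mem _ hx, Finset.mem_image_of_mem _ hx⟩
  have h1 : (s.card : ℝ) ≤ (s.image Prod.fst).card * (s.image Prod.snd).card := by
    exact_mod_cast (Finset.card_le_card hsub).trans (Finset.card_product _ _).le
  have h2 : ((s.image Prod.fst).card : ℝ) ≤ d + 1 := card_le_of_pairwise_close hd fun x hx y hy ↦ by
    obtain ⟨x', hx', rfl⟩ := Finset.mem_image.1 hx
    obtain ⟨y', hy', rfl⟩ := Finset.mem_image.1 hy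
    exact (h x' hx' y' hy').1
  have h3 : ((s.image Prod.snd).card : ℝ) ≤ d + 1 := card_le_of_pairwise_close hd fun x hx y hy ↦ by
    obtain ⟨x', hx', rfl⟩ := Finset.mem_image.1 hx
    obtain ⟨y', hy', rfl⟩ := Finset.mem_image.1 hy
    exact (h x' hx' y' hy').2
  rw [sq]
  exact h1.trans (by gcongr)

theorem mul_abs_sub_le_abs_rpow_sub {c M x y : ℝ} (hc : 1 ≤ c) (hM : 0 < M) (hx : M ≤ x)
    (hy : M ≤ y) : M ^ (c - 1) * |x - y| ≤ |x ^ c - y ^ c| := by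
  wlog h : y ≤ x generalizing x y
  · rw [abs_sub_comm x, abs_sub_comm (x ^ c)]
    exact this hy hx (le_of_not_ge h)
  have hx0 : 0 < x := hM.trans_le hx
  have hy0 : 0 < y := hM.trans_le hy
  have hp : 0 ≤ c - 1 := by linarith
  have e : ∀ z : ℝ, 0 < z → z ^ c = z ^ (c - 1) * z := fun z hz ↦ by
    rw [← Real.rpow_add_one hz.ne']; ring_nf
  have h1 : y ^ (c - 1) ≤ x ^ (c - 1) := Real.rpow_le_rpow hy0.le h hp
  have h2 : M ^ (c - 1) ≤ y ^ (c - 1) := Real.rpow_le_rpow hM.le hy hp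
  rw [abs_of_nonneg (by linarith)]
  refine le_trans ?_ (le_abs_self _)
  rw [e x hx0, e y hy0]
  nlinarith [mul_le_mul_of_nonneg_right h1 hx0.le, mul_le_mul_of_nonneg_right h2 (sub_nonneg.2 h)]

/-- There are `O(M³)` choices of `z, a, b`. They leave `O(1)` values of `w`, because `w^c` grows at
rate at least `M^(c-1)`, which exceeds the scale `M^(c-2)` of the tolerance. -/
theorem energyBound_one {c : ℝ} (hc : 1 < c) : EnergyBound c 1 := by
  intro A D hA hD
  refine ⟨(2 * D + 1) * A ^ 3, by positivity, fun M hM s hs ↦ ?_⟩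
  have hM0 : 0 < M := by linarith
  have hAM : 0 ≤ A * M := by positivity
  set I : Finset ℤ := Finset.Icc 1 ⌊A * M⌋ with hI
  have hIcard : (I.card : ℝ) ≤ A * M := by
    have : (I.card : ℤ) = ⌊A * M⌋ := by
      rw [hI, Int.card_Icc, Int.toNat_of_nonneg] <;>
        linarith [Int.floor_nonneg.2 hAM]
    calc (I.card : ℝ) = (⌊A * M⌋ : ℝ) := by exact_mod_cast this
      _ ≤ _ := Int.floor_le _
  have memI : ∀ n : ℤ, (n : ℝ) ∈ Set.Icc M (A * M) → n ∈ I := fun n hn ↦ by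
    rw [hI, Finset.mem_Icc]
    refine ⟨?_, Int.le_floor.2 hn.2⟩
    have : (1 : ℝ) ≤ n := hM.trans hn.1
    exact_mod_cast this
  have himg : s.image Prod.fst ⊆ (I ×ˢ I) ×ˢ I := fun y hy ↦ by
    obtain ⟨x, hx, rfl⟩ := Finset.mem_image.1 hy
    simp only [Finset.mem_product]
    exact ⟨⟨memI _ (hs x hx).z_mem, memI _ (hs x hx).a_mem⟩, memI _ (hs x hx).b_mem⟩
  have hfib : ∀ y ∈ s.image Prod.fst, ((s.filter fun x ↦ x.1 = y).card : ℝ) ≤ 2 * D + 1 := by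
    intro y _
    have hinj : Set.InjOn Prod.snd (s.filter fun x ↦ x.1 = y : Set Quad) := by
      intro x hx x' hx' h
      simp only [Finset.coe_filter, Set.mem_ofPred_eq] at hx hx'
      exact Prod.ext (hx.2.trans hx'.2.symm) h
    rw [← Finset.card_image_of_injOn hinj]
    refine card_le_of_pairwise_close (by positivity) fun w hw w' hw' ↦ ?_
    obtain ⟨x, hx, rfl⟩ := Finset.mem_image.1 hw
    obtain ⟨x', hx', rfl⟩ := Finset.mem_image.1 hw'
    rw [Finset.mem_filter] at hx hx'
    have n1 := (hs x hx.1).near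
    have n2 := (hs x' hx'.1).near
    rw [hx.2] at n1
    rw [hx'.2] at n2
    have h1 := mul_abs_sub_le_abs_rpow_sub hc.le hM0 (hs x hx.1).w_mem.1 (hs x' hx'.1).w_mem.1
    have h2 : |(x.2 : ℝ) ^ c - (x'.2 : ℝ) ^ c| ≤ 2 * (D * M ^ (c - 2)) := by
      have := abs_le.1 n1
      have := abs_le.1 n2
      exact abs_le.2 ⟨by linarith, by linarith⟩
    have h3 : M ^ (c - 2) ≤ M ^ (c - 1) := Real.rpow_le_rpow_of_exponent_le hM (by linarith)
    have h4 : 0 < M ^ (c - 1) := by positivity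
    have h5 : M ^ (c - 1) * |(x.2 : ℝ) - x'.2| ≤ M ^ (c - 1) * (2 * D) := by
      nlinarith [mul_le_mul_of_nonneg_left h3 hD]
    exact le_of_mul_le_mul_left h5 h4
  calc (s.card : ℝ) = ∑ y ∈ s.image Prod.fst, ((s.filter fun x ↦ x.1 = y).card : ℝ) := by
        exact_mod_cast Finset.card_eq_sum_card_image Prod.fst s
    _ ≤ ∑ y ∈ s.image Prod.fst, (2 * D + 1) := Finset.sum_le_sum hfib
    _ = (s.image Prod.fst).card * (2 * D + 1) := by rw [Finset.sum_const, nsmul_eq_mul]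
    _ ≤ ((A * M) * (A * M) * (A * M)) * (2 * D + 1) := by
        gcongr
        have := Finset.card_le_card himg
        rw [Finset.card_product, Finset.card_product] at this
        calc ((s.image Prod.fst).card : ℝ) ≤ I.card * I.card * I.card := by exact_mod_cast this
          _ ≤ _ := by gcongr
    _ = _ := by
        have : M ^ (2 + 1 : ℝ) = M ^ 3 := by rw [← Real.rpow_natCast]; norm_num
        rw [this]; ring

/-! ### The dual Gaussian sum and the lattice points that contribute to it. -/

theorem gaussBound_eq_tsum {a : ℝ} (ha : 0 < a) :
    gaussBound a = ∑' k : ℤ, Real.exp (-Real.pi * a * (k : ℝ) ^ 2) := by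
  rw [Real.tsum_exp_neg_mul_int_sq ha, gaussBound, Real.sqrt_eq_rpow, one_div]
  simp [div_eq_mul_inv]

theorem exists_gaussBound_le : ∃ C : ℝ, 1 ≤ C ∧ ∀ a : ℝ, 0 < a →
    (2⁻¹ ≤ a → gaussBound a ≤ C) ∧ (a ≤ 1 → gaussBound a ≤ C * (√a)⁻¹) := by
  have hs : ∀ a : ℝ, 0 < a → Summable fun k : ℤ ↦ Real.exp (-Real.pi * a * (k : ℝ) ^ 2) :=
    fun a ha ↦ by simpa using summable_gaussian_shift ha 0
  have hmono : ∀ a b : ℝ, 0 < a → a ≤ b → ∑' k : ℤ, Real.exp (-Real.pi * b * (k : ℝ) ^ 2) ≤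
      ∑' k : ℤ, Real.exp (-Real.pi * a * (k : ℝ) ^ 2) := fun a b ha hab ↦ by
    refine (hs b (ha.trans_le hab)).tsum_le_tsum (fun k ↦ ?_) (hs a ha)
    refine Real.exp_le_exp.2 ?_
    have := mul_le_mul_of_nonneg_right (mul_le_mul_of_nonneg_left hab Real.pi_pos.le)
      (sq_nonneg (k : ℝ))
    linarith
  set C := ∑' k : ℤ, Real.exp (-Real.pi * 2⁻¹ * (k : ℝ) ^ 2) with hC
  refine ⟨C, ?_, fun a ha ↦ ⟨fun h ↦ ?_, fun h ↦ ?_⟩⟩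
  · have := (hs 2⁻¹ (by norm_num)).le_tsum 0 fun _ _ ↦ (Real.exp_pos _).le
    rw [hC]
    simpa using this
  · rw [gaussBound_eq_tsum ha]
    exact hmono _ _ (by norm_num) h
  · rw [gaussBound, mul_comm]
    refine mul_le_mul_of_nonneg_right ?_ (by positivity)
    simp only [sub_zero]
    refine hmono 2⁻¹ a⁻¹ (by norm_num) ?_
    exact inv_anti₀ ha (by linarith)

/-- The weight `K⁻²` cancels the `2` in the exponent of the count, so the shell `K ≍ 2^s`
contributes `O(2^(sβ))`. The geometric series is dominated by its top term since `β > 0`. -/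
theorem sum_inv_sq_le_of_dyadic {ι : Type*} (L : Finset ι) (K : ι → ℕ) {C β X : ℝ} (hC : 0 ≤ C)
    (hβ : 0 < β) (hX1 : 1 ≤ X) (hX : ∀ k ∈ L, (K k : ℝ) ≤ X) (h1 : ∀ k ∈ L, 1 ≤ K k)
    (hL : ∀ s : ℕ, ((L.filter fun k ↦ Nat.log 2 (K k) = s).card : ℝ) ≤
      C * ((2 : ℝ) ^ s) ^ (2 + β)) :
    ∑ k ∈ L, ((K k : ℝ) ^ 2)⁻¹ ≤ C * (2 ^ β / (2 ^ β - 1)) * X ^ β := by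
  set S := Nat.log 2 ⌊X⌋₊ with hS
  have hmap : ∀ k ∈ L, Nat.log 2 (K k) ∈ Finset.range (S + 1) := fun k hk ↦ by
    rw [Finset.mem_range, Nat.lt_succ_iff]
    exact Nat.log_mono_right (Nat.le_floor (hX k hk))
  have hr : (1 : ℝ) < 2 ^ β := Real.one_lt_rpow (by norm_num) hβ
  have hpow : ∀ s : ℕ, ((2 : ℝ) ^ s) ^ β = ((2 : ℝ) ^ β) ^ s := fun s ↦ by
    rw [Real.rpow_pow_comm (by norm_num)]
  have hSX : ((2 : ℝ) ^ S) ^ β ≤ X ^ β := by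
    refine Real.rpow_le_rpow (by positivity) ?_ hβ.le
    have h2 : 2 ^ S ≤ ⌊X⌋₊ := Nat.pow_log_le_self 2 (Nat.floor_pos.2 hX1).ne'
    calc (2 : ℝ) ^ S = ((2 ^ S : ℕ) : ℝ) := by push_cast; rfl
      _ ≤ (⌊X⌋₊ : ℝ) := by exact_mod_cast h2
      _ ≤ X := Nat.floor_le (by linarith)
  rw [← Finset.sum_fiberwise_of_maps_to hmap]
  calc _ ≤ ∑ s ∈ Finset.range (S + 1), C * ((2 : ℝ) ^ β) ^ s := by
        refine Finset.sum_le_sum fun s _ ↦ ?_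
        have hterm : ∀ k ∈ L.filter fun k ↦ Nat.log 2 (K k) = s,
            ((K k : ℝ) ^ 2)⁻¹ ≤ (((2 : ℝ) ^ s) ^ 2)⁻¹ := fun k hk ↦ by
          rw [Finset.mem_filter] at hk
          have h2 : 2 ^ s ≤ K k := by
            rw [← hk.2]; exact Nat.pow_log_le_self 2 (by have := h1 k hk.1; omega)
          have : (2 : ℝ) ^ s ≤ K k := by exact_mod_cast h2
          gcongr
        refine (Finset.sum_le_card_nsmul _ _ _ hterm).trans ?_
        rw [nsmul_eq_mul]
        calc _ ≤ C * ((2 : ℝ) ^ s) ^ (2 + β) * (((2 : ℝ) ^ s) ^ 2)⁻¹ := by gcongr; exact hL s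
          _ = _ := by
            rw [Real.rpow_add (by positivity), hpow, Real.rpow_ofNat]
            field_simp
    _ = C * (((2 : ℝ) ^ β) ^ (S + 1) - 1) / (2 ^ β - 1) := by
        rw [← Finset.mul_sum, geom_sum_eq hr.ne', mul_div_assoc]
    _ ≤ C * (((2 : ℝ) ^ β) ^ (S + 1)) / (2 ^ β - 1) := by
        have : (0 : ℝ) ≤ 2 ^ β - 1 := by linarith
        gcongr
        linarith
    _ = C * (2 ^ β / (2 ^ β - 1)) * ((2 : ℝ) ^ S) ^ β := by rw [hpow, pow_succ]; ring
    _ ≤ _ := by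
        have : (0 : ℝ) ≤ 2 ^ β - 1 := by linarith
        gcongr

/-- A sum of a Gaussian over `ℤ⁴` is at most the number of points where the Gaussian is not
small, up to a small error. -/
theorem tsum_nestedGauss_le {a₀ a₁ a₂ a₃ δ : ℝ} (h₀ : 0 < a₀) (h₁ : 0 < a₁) (h₂ : 0 < a₂)
    (h₃ : 0 < a₃) (hδ : 0 < δ) (s₁ : ℤ → ℝ) (s₂ : ℤ × ℤ → ℝ) (s₃ : (ℤ × ℤ) × ℤ → ℝ) :
    ∃ F : Finset Quad, (∀ k ∈ F, δ < nestedGauss (a₀ / 2) (a₁ / 2) (a₂ / 2) (a₃ / 2) s₁ s₂ s₃ k) ∧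
      ∑' k, nestedGauss a₀ a₁ a₂ a₃ s₁ s₂ s₃ k ≤ F.card + δ * (gaussBound (a₃ / 2) *
        (gaussBound (a₂ / 2) * (gaussBound (a₁ / 2) * gaussBound (a₀ / 2)))) := by
  set g := nestedGauss (a₀ / 2) (a₁ / 2) (a₂ / 2) (a₃ / 2) s₁ s₂ s₃ with hg
  obtain ⟨sg, bg⟩ := summable_nestedGauss (half_pos h₀) (half_pos h₁) (half_pos h₂) (half_pos h₃)
    s₁ s₂ s₃
  have hfin : {k | δ < g k}.Finite := by
    have := sg.tendsto_cofinite_zero.eventually (gt_mem_nhds hδ)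
    rw [Filter.eventually_cofinite] at this
    exact this.subset fun k hk ↦ by simpa using hk.le
  -- Halving the parameters takes a square root. Thus `g²` is at most `1` on `F` and at most `δ * g`
  -- off it, and the sum of `g` is under control.
  have hsq : ∀ k, nestedGauss a₀ a₁ a₂ a₃ s₁ s₂ s₃ k = g k * g k := fun k ↦ by
    simp only [hg, nestedGauss, gauss, ← Real.exp_add]
    congr 1; ring
  have hg0 : ∀ k, 0 ≤ g k := fun k ↦ nestedGauss_nonneg ..
  have hone : ∀ a x : ℝ, 0 < a → gauss a x ≤ 1 := fun a x ha ↦ by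
    rw [gauss, Real.exp_le_one_iff]
    nlinarith [mul_nonneg (mul_nonneg Real.pi_pos.le ha.le) (sq_nonneg x)]
  have hg1 : ∀ k, g k ≤ 1 := fun k ↦ by
    have e0 := hone _ ((k.1.1.1 : ℝ) - 0) (half_pos h₀)
    have e1 := hone _ ((k.1.1.2 : ℝ) - s₁ k.1.1.1) (half_pos h₁)
    have e2 := hone _ ((k.1.2 : ℝ) - s₂ k.1.1) (half_pos h₂)
    have e3 := hone _ ((k.2 : ℝ) - s₃ k.1) (half_pos h₃)
    exact mul_le_one₀ (mul_le_one₀ (mul_le_one₀ e0 (gauss_nonneg _ _) e1) (gauss_nonneg _ _) e2)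
      (gauss_nonneg _ _) e3
  refine ⟨hfin.toFinset, fun k hk ↦ by simpa using hk, ?_⟩
  set F := hfin.toFinset with hF
  have hind : HasSum (fun k ↦ if k ∈ F then (1 : ℝ) else 0) F.card := by
    have : HasSum (fun k ↦ if k ∈ F then (1 : ℝ) else 0) (∑ k ∈ F, if k ∈ F then (1 : ℝ) else 0) :=
      hasSum_sum_of_ne_finset_zero fun k hk ↦ by simp [hk]
    simpa using this
  have hle : ∀ k, nestedGauss a₀ a₁ a₂ a₃ s₁ s₂ s₃ k ≤ (if k ∈ F then (1 : ℝ) else 0) + δ * g k := by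
    intro k
    rw [hsq]
    split_ifs with h
    · nlinarith [hg0 k, hg1 k]
    · have : g k ≤ δ := by simpa [hF] using h
      nlinarith [hg0 k]
  have hs := (summable_nestedGauss h₀ h₁ h₂ h₃ s₁ s₂ s₃).1
  refine (hs.tsum_le_tsum hle (hind.summable.add (sg.mul_left δ))).trans ?_
  rw [hind.summable.tsum_add (sg.mul_left δ), hind.tsum_eq, tsum_mul_left]
  gcongr

/-- All four numbers are comparable to `K`, and `(K, x, y, w)` is close to the cone
`x ^ q + y ^ q = K ^ q + w ^ q`. -/
structure NearDualCone (q B D K x y w : ℝ) : Prop where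
  x_mem : x ∈ Set.Icc (K / B) (B * K)
  y_mem : y ∈ Set.Icc (K / B) (B * K)
  w_mem : w ∈ Set.Icc (K / B) (B * K)
  near : |x ^ q + y ^ q - K ^ q - w ^ q| ≤ D * K ^ (q - 2)

/-- The points of `ℤ⁴` contributing to the dual Gaussian sum attached to a point of the surface,
for the parameters `M, J, T`. -/
structure DualPoint (c B D M J T n₁ n₂ : ℝ) (k : Quad) : Prop where
  z_ne : k.1.1.1 ≠ 0
  z_le : |(k.1.1.1 : ℝ)| ≤ J * √T
  a_near : |(k.1.1.2 : ℝ) + n₁ * k.1.1.1| ≤ √(T * J / M)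
  b_near : |(k.1.2 : ℝ) + n₂ * k.1.1.1| ≤ √(T * J / M)
  neg : k.1.1.1 < 0 → NearDualCone (c / (c - 1)) B D (-k.1.1.1) k.1.1.2 k.1.2 (-k.2)
  pos : 0 < k.1.1.1 → NearDualCone (c / (c - 1)) B D k.1.1.1 (-k.1.1.2) (-k.1.2) k.2

theorem eq_zero_of_sq_lt_one {n : ℤ} (h : (n : ℝ) ^ 2 < 1) : n = 0 := by
  have h1 : n ^ 2 < 1 := by exact_mod_cast h
  by_contra h0
  have := Int.one_le_abs h0
  nlinarith [sq_abs n]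

/-- The threshold `exp(-πT/2)` with halved parameters amounts to the full quadratic form being less
than `T`, hence so is each of its four squares. -/
theorem nestedGauss_half_bounds {a₀ a₁ a₂ a₃ T : ℝ} (h₀ : 0 < a₀) (h₁ : 0 < a₁) (h₂ : 0 < a₂)
    (h₃ : 0 < a₃) {s₁ : ℤ → ℝ} {s₂ : ℤ × ℤ → ℝ} {s₃ : (ℤ × ℤ) × ℤ → ℝ} {k : Quad}
    (h : Real.exp (-Real.pi * T / 2) <
      nestedGauss (a₀ / 2) (a₁ / 2) (a₂ / 2) (a₃ / 2) s₁ s₂ s₃ k) :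
    a₀ * (k.1.1.1 : ℝ) ^ 2 < T ∧ a₁ * (k.1.1.2 - s₁ k.1.1.1) ^ 2 < T ∧
      a₂ * (k.1.2 - s₂ k.1.1) ^ 2 < T ∧ a₃ * (k.2 - s₃ k.1) ^ 2 < T := by
  simp only [nestedGauss, gauss, ← Real.exp_add, Real.exp_lt_exp, sub_zero] at h
  have hπ := Real.pi_pos
  have p₀ := mul_nonneg h₀.le (sq_nonneg (k.1.1.1 : ℝ))
  have p₁ := mul_nonneg h₁.le (sq_nonneg (k.1.1.2 - s₁ k.1.1.1))
  have p₂ := mul_nonneg h₂.le (sq_nonneg (k.1.2 - s₂ k.1.1))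
  have p₃ := mul_nonneg h₃.le (sq_nonneg (k.2 - s₃ k.1))
  have key : a₀ * (k.1.1.1 : ℝ) ^ 2 + a₁ * (k.1.1.2 - s₁ k.1.1.1) ^ 2 +
      a₂ * (k.1.2 - s₂ k.1.1) ^ 2 + a₃ * (k.2 - s₃ k.1) ^ 2 < T := by
    refine lt_of_mul_lt_mul_left (a := Real.pi / 2) ?_ (by positivity)
    linarith
  refine ⟨?_, ?_, ?_, ?_⟩ <;> linarith

-- On the dual side of Poisson summation the zero frequency gives the `1`, the frequencies that
-- matter form `F` and lie near the dual cone, and the Gaussian tail costs `J * exp(-πT/2)`. The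
-- factor `J` comes from the only long direction of the dual plank.
set_option maxHeartbeats 1000000 in
theorem exists_dualPoints {c B : ℝ} (hc : 1 < c) (hB : 1 ≤ B) :
    ∃ B' D' ε₀ C : ℝ, 1 ≤ B' ∧ 0 ≤ D' ∧ 0 < ε₀ ∧ 0 ≤ C ∧ ∀ M J T u₁ u₂ u₃ : ℝ, 1 ≤ J → J ≤ M →
      1 ≤ T → T * J ≤ ε₀ ^ 2 * M → OnSurface c B u₁ u₂ u₃ →
      ∃ F : Finset Quad, (∀ k ∈ F,
        DualPoint c B' D' M J T ((u₁ / u₃) ^ (c - 1)) ((u₂ / u₃) ^ (c - 1)) k) ∧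
      ∑' k, nestedGauss (J ^ 2)⁻¹ (J / M)⁻¹ (J / M)⁻¹ ((M ^ 2)⁻¹)⁻¹
        (fun z ↦ -((u₁ / u₃) ^ (c - 1) * z)) (fun y ↦ -((u₂ / u₃) ^ (c - 1) * y.1))
        (fun y ↦ -(u₃ * y.1.1 + u₁ * y.1.2 + u₂ * y.2)) k ≤
      1 + F.card + C * J * Real.exp (-Real.pi * T / 2) := by
  obtain ⟨B', D', ε₁, hB', hD', hε₁, H⟩ := exists_dual_approx hc hB
  obtain ⟨G, hG1, hG⟩ := exists_gaussBound_le
  set ε₀ := min ε₁ (1 / 2) with hε₀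
  have hε0 : 0 < ε₀ := by positivity
  have hε01 : ε₀ ≤ 1 := (min_le_right _ _).trans (by norm_num)
  have hε0₁ : ε₀ ≤ ε₁ := min_le_left _ _
  refine ⟨B', D', ε₀, G ^ 4 * √2, hB', hD', hε0, by positivity, ?_⟩
  intro M J T u₁ u₂ u₃ hJ hJM hT hTJ hu
  have hJ0 : 0 < J := by linarith
  have hM1 : 1 ≤ M := by linarith
  have hM0 : 0 < M := by linarith
  have hT0 : 0 < T := by linarith
  have hε0sq : ε₀ ^ 2 < 1 := by
    have : ε₀ ≤ 1 / 2 := min_le_right _ _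
    nlinarith
  set n₁ := (u₁ / u₃) ^ (c - 1) with hn₁
  set n₂ := (u₂ / u₃) ^ (c - 1) with hn₂
  have p0 : 0 < (J ^ 2)⁻¹ := by positivity
  have p1 : 0 < (J / M)⁻¹ := by positivity
  have p3 : 0 < ((M ^ 2)⁻¹)⁻¹ := by positivity
  obtain ⟨F₀, hF₀, hsum⟩ := tsum_nestedGauss_le p0 p1 p1 p3 (Real.exp_pos (-Real.pi * T / 2))
    (fun z ↦ -(n₁ * z)) (fun y ↦ -(n₂ * y.1)) (fun y ↦ -(u₃ * y.1.1 + u₁ * y.1.2 + u₂ * y.2))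
  have hR : T * J / M ≤ ε₀ ^ 2 := by rwa [div_le_iff₀ hM0]
  refine ⟨F₀.erase 0, fun k hk ↦ ?_, ?_⟩
  · obtain ⟨hk0, hkF⟩ := Finset.mem_erase.1 hk
    obtain ⟨b0, b1, b2, b3⟩ := nestedGauss_half_bounds p0 p1 p1 p3 (hF₀ k hkF)
    simp only [sub_neg_eq_add, inv_inv] at b0 b1 b2 b3
    have b0' : (k.1.1.1 : ℝ) ^ 2 ≤ J ^ 2 * T := by
      rw [inv_mul_lt_iff₀ (by positivity)] at b0; exact b0.le
    have conv : ∀ v : ℝ, (J / M)⁻¹ * v ^ 2 < T → v ^ 2 ≤ T * J / M := fun v h ↦ by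
      rw [inv_mul_lt_iff₀ (by positivity)] at h
      calc v ^ 2 ≤ J / M * T := h.le
        _ = _ := by ring
    have b1' := conv _ b1
    have b2' := conv _ b2
    have le1 : ∀ v : ℝ, v ^ 2 ≤ T * J / M → |v| ≤ √(T * J / M) := fun v h ↦
      Real.abs_le_sqrt h
    have leε : √(T * J / M) ≤ ε₁ := by
      refine (Real.sqrt_le_sqrt hR).trans ?_
      rw [Real.sqrt_sq hε0.le]; exact hε0₁
    -- A frequency of height zero has all other coordinates smaller than `1` in absolute value, so
    -- it is the zero frequency, which was erased.
    have hz : k.1.1.1 ≠ 0 := by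
      intro hz
      simp only [hz, Int.cast_zero, mul_zero, add_zero, zero_add] at b1' b2' b3
      have ha := eq_zero_of_sq_lt_one ((b1'.trans hR).trans_lt hε0sq)
      have hb := eq_zero_of_sq_lt_one ((b2'.trans hR).trans_lt hε0sq)
      simp only [ha, hb, Int.cast_zero, mul_zero, add_zero] at b3
      have hTM : T < M ^ 2 := by nlinarith
      have hw := eq_zero_of_sq_lt_one (n := k.2)
        (lt_of_mul_lt_mul_left (by linarith) (sq_nonneg M))
      exact hk0 (Prod.ext (Prod.ext (Prod.ext hz ha) hb) hw)
    have hKT : |(k.1.1.1 : ℝ)| ≤ J * √T := by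
      refine (Real.abs_le_sqrt b0').trans (le_of_eq ?_)
      rw [Real.sqrt_mul (by positivity), Real.sqrt_sq hJ0.le]
    -- The ray component is at most `√T / M` and the height at most `J√T`. Their product is at most
    -- `TJ/M`, which supplies the precision `ε₀ / K` required by `exists_dual_approx`.
    have hthird : |(k.2 : ℝ) + (u₃ * k.1.1.1 + u₁ * k.1.1.2 + u₂ * k.1.2)| * |(k.1.1.1 : ℝ)| ≤
        ε₁ := by
      rw [← abs_mul]
      refine (Real.abs_le_sqrt (y := ε₀ ^ 2) ?_).trans (by rw [Real.sqrt_sq hε0.le]; exact hε0₁)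
      rw [mul_pow]
      set v := ((k.2 : ℝ) + (u₃ * k.1.1.1 + u₁ * k.1.1.2 + u₂ * k.1.2)) ^ 2 with hv
      have hv2 : v ≤ T / M ^ 2 := by rw [le_div_iff₀ (by positivity)]; linarith
      calc v * (k.1.1.1 : ℝ) ^ 2 ≤ T / M ^ 2 * (J ^ 2 * T) := by gcongr
        _ = (T * J / M) ^ 2 := by field_simp
        _ ≤ (ε₀ ^ 2) ^ 2 := by gcongr
        _ ≤ ε₀ ^ 2 := by nlinarith [sq_nonneg ε₀]
    refine ⟨hz, hKT, le1 _ b1', le1 _ b2', fun hneg ↦ ?_, fun hpos ↦ ?_⟩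
    · have hneg' : (k.1.1.1 : ℝ) < 0 := by exact_mod_cast hneg
      have hK1 : (1 : ℝ) ≤ -(k.1.1.1 : ℝ) := by
        have : k.1.1.1 ≤ -1 := by omega
        have : (k.1.1.1 : ℝ) ≤ -1 := by exact_mod_cast this
        linarith
      rw [abs_of_neg hneg', ← le_div_iff₀ (by linarith)] at hthird
      obtain ⟨h1, h2, h3, h4⟩ := H u₁ u₂ u₃ (-k.1.1.1) k.1.1.2 k.1.2 (-k.2) hu hK1
        ((le1 _ b1').trans leε |>.trans_eq' (by congr 1; rw [hn₁]; ring))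
        ((le1 _ b2').trans leε |>.trans_eq' (by congr 1; rw [hn₂]; ring))
        (hthird.trans_eq' (by rw [← abs_neg]; congr 1; ring))
      exact ⟨h1, h2, h3, h4⟩
    · have hpos' : (0 : ℝ) < k.1.1.1 := by exact_mod_cast hpos
      have hK1 : (1 : ℝ) ≤ k.1.1.1 := by exact_mod_cast hpos
      rw [abs_of_pos hpos', ← le_div_iff₀ (by linarith)] at hthird
      obtain ⟨h1, h2, h3, h4⟩ := H u₁ u₂ u₃ k.1.1.1 (-k.1.1.2) (-k.1.2) k.2 hu hK1
        ((le1 _ b1').trans leε |>.trans_eq' (by rw [← abs_neg]; congr 1; rw [hn₁]; ring))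
        ((le1 _ b2').trans leε |>.trans_eq' (by rw [← abs_neg]; congr 1; rw [hn₂]; ring))
        (hthird.trans_eq' (by congr 1; ring))
      exact ⟨h1, h2, h3, h4⟩
  · refine hsum.trans (add_le_add ?_ ?_)
    · have : F₀.card ≤ 1 + (F₀.erase 0).card := by
        have := Finset.pred_card_le_card_erase (s := F₀) (a := 0)
        omega
      exact_mod_cast this
    · have g0 : gaussBound ((J ^ 2)⁻¹ / 2) ≤ G * (√2 * J) := by
        refine ((hG _ (by positivity)).2 ?_).trans_eq ?_
        · have : (J ^ 2)⁻¹ ≤ 1 := inv_le_one_of_one_le₀ (one_le_pow₀ hJ)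
          linarith
        · congr 1
          rw [← Real.sqrt_inv, show ((J ^ 2)⁻¹ / 2)⁻¹ = 2 * J ^ 2 by field_simp,
            Real.sqrt_mul (by norm_num), Real.sqrt_sq hJ0.le]
      have g1 : gaussBound ((J / M)⁻¹ / 2) ≤ G := by
        refine (hG _ (by positivity)).1 ?_
        rw [inv_div]
        have : 1 ≤ M / J := (one_le_div hJ0).2 hJM
        linarith
      have g3 : gaussBound (((M ^ 2)⁻¹)⁻¹ / 2) ≤ G := by
        refine (hG _ (by positivity)).1 ?_
        rw [inv_inv]
        have : 1 ≤ M ^ 2 := one_le_pow₀ hM1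
        linarith
      have nn := gaussBound_nonneg
      calc _ ≤ Real.exp (-Real.pi * T / 2) * (G * (G * (G * (G * (√2 * J))))) := by
            have hG0 : 0 ≤ G := by linarith
            gcongr
            · exact mul_nonneg (nn _) (mul_nonneg (nn _) (nn _))
            · exact mul_nonneg (nn _) (nn _)
            · exact nn _
        _ = _ := by ring

/-- For each point of the lattice, few blocks of the surface see it as a dual point. -/
theorem exists_block_count {c B : ℝ} (hc : 1 < c) (hB : 1 ≤ B) :
    ∃ C : ℝ, 0 ≤ C ∧ ∀ (B' D' M J T h : ℝ) (k : Quad) (S : Finset (ℤ × ℤ)), 1 ≤ J → J ≤ M → 1 ≤ T →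
      0 < h → h ^ 2 = (M * J)⁻¹ →
      (∀ b ∈ S, OnSurface c B (b.1 * h) (b.2 * h) (surfaceHeight c (b.1 * h) (b.2 * h)) ∧
        DualPoint c B' D' M J T ((b.1 * h / surfaceHeight c (b.1 * h) (b.2 * h)) ^ (c - 1))
          ((b.2 * h / surfaceHeight c (b.1 * h) (b.2 * h)) ^ (c - 1)) k) →
      (S.card : ℝ) ≤ C * (T * J ^ 2) * ((k.1.1.1.natAbs : ℝ) ^ 2)⁻¹ := by
  obtain ⟨C, hC, H⟩ := exists_gauss_map_inverse_lipschitz hc hB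
  refine ⟨(2 * C + 1) ^ 2, by positivity, ?_⟩
  intro B' D' M J T h k S hJ hJM hT hh hh2 hS
  rcases S.eq_empty_or_nonempty with rfl | ⟨b₀, hb₀⟩
  · rw [Finset.card_empty, Nat.cast_zero]; positivity
  have hJ0 : 0 < J := by linarith
  have hM0 : 0 < M := by linarith
  have hz := (hS b₀ hb₀).2.z_ne
  have hzle := (hS b₀ hb₀).2.z_le
  set K : ℝ := |(k.1.1.1 : ℝ)| with hK
  have hKn : (k.1.1.1.natAbs : ℝ) = K := by rw [hK, Nat.cast_natAbs, Int.cast_abs]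
  have hK0 : 0 < K := abs_pos.2 (by exact_mod_cast hz)
  set τ := √(T * J / M) with hτ
  -- With `h² = 1/(MJ)` the transverse width of the dual plank is `√T * J` block widths. Two blocks
  -- seeing `k` thus have normals within `O(√T * J * h / K)`, and indices within `O(√T * J / K)`.
  have hτh : τ = √T * J * h := by
    have : h = √((M * J)⁻¹) := by rw [← hh2, Real.sqrt_sq hh.le]
    rw [this, hτ, ← Real.sqrt_sq hJ0.le, ← Real.sqrt_mul (by linarith), ← Real.sqrt_mul (by positivity),
      Real.sqrt_sq hJ0.le]
    congr 1; field_simp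
  have hdist : ∀ (m : ℤ) (n n' : ℝ), |(m : ℝ) + n * k.1.1.1| ≤ τ → |(m : ℝ) + n' * k.1.1.1| ≤ τ →
      |n - n'| ≤ 2 * τ / K := by
    intro m n n' h1 h2
    rw [le_div_iff₀ hK0, hK, ← abs_mul]
    have h1 := abs_le.1 h1
    have h2 := abs_le.1 h2
    refine abs_le.2 ⟨by linarith, by linarith⟩
  have hscale : ∀ i i' : ℤ, |(i : ℝ) * h - i' * h| ≤ C * (2 * τ / K) →
      |(i : ℝ) - i'| ≤ 2 * C * (√T * J / K) := by
    intro i i' hi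
    rw [← sub_mul, abs_mul, abs_of_pos hh, ← le_div_iff₀ hh] at hi
    refine hi.trans (le_of_eq ?_)
    rw [hτh]; field_simp
  -- The bound on the height of `k` allows the `+1` in the count of indices to be absorbed.
  have hone : 1 ≤ √T * J / K := (one_le_div hK0).2 (by linarith)
  have hcard := card_pair_le_of_pairwise_close (s := S) (d := 2 * C * (√T * J / K)) (by positivity)
    fun x hx y hy ↦ by
      obtain ⟨sx, dx⟩ := hS x hx
      obtain ⟨sy, dy⟩ := hS y hy
      obtain ⟨r1, r2⟩ := H _ _ _ _ _ _ _ sx sy (hdist _ _ _ dx.a_near dy.a_near)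
        (hdist _ _ _ dx.b_near dy.b_near)
      exact ⟨hscale _ _ r1, hscale _ _ r2⟩
  rw [hKn]
  calc (S.card : ℝ) ≤ (2 * C * (√T * J / K) + 1) ^ 2 := hcard
    _ ≤ ((2 * C + 1) * (√T * J / K)) ^ 2 := by
        gcongr
        linarith
    _ = (2 * C + 1) ^ 2 * ((√T) ^ 2 * J ^ 2) * (K ^ 2)⁻¹ := by ring
    _ = _ := by rw [Real.sq_sqrt (by linarith)]

/-- The number of lattice points near the dual cone in a dyadic range. -/
theorem exists_dyadic_count {q β B D : ℝ} (hE : EnergyBound q β) (hβ : 0 ≤ β) (hB : 1 ≤ B)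
    (hD : 0 ≤ D) :
    ∃ C : ℝ, 0 ≤ C ∧ ∀ (s : ℕ) (L : Finset Quad),
      (∀ x ∈ L, Nat.log 2 x.1.1.1.natAbs = s ∧ 0 < x.1.1.1 ∧
        NearDualCone q B D x.1.1.1 x.1.1.2 x.1.2 x.2) →
      (L.card : ℝ) ≤ C * ((2 : ℝ) ^ s) ^ (2 + β) := by
  obtain ⟨C, hC, H⟩ := hE (2 * B ^ 2) (D * (2 * B) ^ |q - 2|) (by nlinarith) (by positivity)
  refine ⟨C, hC, fun s L hL ↦ ?_⟩
  have hB0 : 0 < B := by linarith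
  have h2s : (1 : ℝ) ≤ 2 ^ s := one_le_pow₀ (by norm_num)
  -- The coordinates are positive integers, so they stay above `M` even when `2^s / B` drops below
  -- the admissible scale `1`.
  set M : ℝ := max 1 (2 ^ s / B) with hM
  have hM1 : 1 ≤ M := le_max_left _ _
  have hM2 : 2 ^ s / B ≤ M := le_max_right _ _
  have hMs : M ≤ 2 ^ s := max_le h2s (div_le_self (by positivity) hB)
  have hsM : 2 ^ s ≤ B * M := by rwa [div_le_iff₀ hB0, mul_comm] at hM2
  have hcard := H M hM1 L fun x hx ↦ by
    obtain ⟨hlog, hpos, hn⟩ := hL x hx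
    have hne : x.1.1.1.natAbs ≠ 0 := by omega
    have hcast : (x.1.1.1.natAbs : ℝ) = x.1.1.1 := by
      rw [Nat.cast_natAbs, abs_of_pos hpos]
    have lo : (2 : ℝ) ^ s ≤ x.1.1.1 := by
      rw [← hcast, ← hlog]; exact_mod_cast Nat.pow_log_le_self 2 hne
    have hi : (x.1.1.1 : ℝ) ≤ 2 * 2 ^ s := by
      rw [← hcast, ← hlog, ← pow_succ']
      exact_mod_cast (Nat.lt_pow_succ_log_self (by norm_num) _).le
    have hK0 : (0 : ℝ) < x.1.1.1 := by exact_mod_cast hpos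
    have hKM : (x.1.1.1 : ℝ) ≤ 2 * B * M := by linarith
    have memM : ∀ n : ℤ, (n : ℝ) ∈ Set.Icc ((x.1.1.1 : ℝ) / B) (B * x.1.1.1) →
        (n : ℝ) ∈ Set.Icc M (2 * B ^ 2 * M) := by
      intro n hn
      have hn0 : (0 : ℝ) < n := (div_pos hK0 hB0).trans_le hn.1
      have hn1 : (1 : ℝ) ≤ n := by
        have : 0 < n := by exact_mod_cast hn0
        exact_mod_cast this
      refine ⟨max_le hn1 (le_trans ?_ hn.1), hn.2.trans ?_⟩
      · gcongr
      · calc B * (x.1.1.1 : ℝ) ≤ B * (2 * B * M) := by gcongr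
          _ = _ := by ring
    refine ⟨memM _ ⟨div_le_self hK0.le hB, by nlinarith⟩, memM _ hn.x_mem, memM _ hn.y_mem,
      memM _ hn.w_mem, hn.near.trans ?_⟩
    have h2B : 1 ≤ 2 * B := by linarith
    have hratio : (x.1.1.1 : ℝ) / M ∈ Set.Icc (2 * B)⁻¹ (2 * B) := by
      constructor
      · refine (inv_le_one_of_one_le₀ h2B).trans ?_
        rw [one_le_div (by linarith)]; linarith
      · rw [div_le_iff₀ (by linarith)]; linarith
    have hMpos : 0 < M := by linarith
    calc D * (x.1.1.1 : ℝ) ^ (q - 2) = D * ((x.1.1.1 / M) ^ (q - 2) * M ^ (q - 2)) := by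
          rw [← Real.mul_rpow (by positivity) hMpos.le, div_mul_cancel₀ _ hMpos.ne']
      _ ≤ D * ((2 * B) ^ |q - 2| * M ^ (q - 2)) := by
          gcongr
          exact rpow_le_of_mem_Icc h2B hratio _
      _ = _ := by ring
  refine hcard.trans ?_
  gcongr

/-- The sum over dual points of the number of blocks seeing each one, apart from the factor `TJ²`.
Sign changes bring the points of negative and of positive height into the positive orthant, where
the bound for the dual exponent applies; this costs a factor `2`. -/
theorem exists_dual_sum {c β B D : ℝ} (hE : EnergyBound (c / (c - 1)) β) (hβ : 0 < β)
    (hB : 1 ≤ B) (hD : 0 ≤ D) :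
    ∃ C : ℝ, 0 ≤ C ∧ ∀ (X : ℝ) (L : Finset Quad), 1 ≤ X →
      (∀ k ∈ L, ∃ M J T n₁ n₂, J * √T = X ∧ DualPoint c B D M J T n₁ n₂ k) →
      ∑ k ∈ L, ((k.1.1.1.natAbs : ℝ) ^ 2)⁻¹ ≤ C * X ^ β := by
  obtain ⟨C, hC, H⟩ := exists_dyadic_count hE hβ.le hB hD
  have hr : (1 : ℝ) < 2 ^ β := Real.one_lt_rpow (by norm_num) hβ
  refine ⟨2 * C * (2 ^ β / (2 ^ β - 1)), ?_, fun X L hX hL ↦ ?_⟩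
  · have : (0 : ℝ) ≤ 2 ^ β - 1 := by linarith
    positivity
  refine sum_inv_sq_le_of_dyadic L (fun k ↦ k.1.1.1.natAbs) (by positivity) hβ hX
    (fun k hk ↦ ?_) (fun k hk ↦ ?_) (fun s ↦ ?_)
  · obtain ⟨M, J, T, n₁, n₂, rfl, h⟩ := hL k hk
    rw [Nat.cast_natAbs, Int.cast_abs]
    exact h.z_le
  · obtain ⟨M, J, T, n₁, n₂, rfl, h⟩ := hL k hk
    have := h.z_ne
    omega
  · set Ls := L.filter fun k ↦ Nat.log 2 k.1.1.1.natAbs = s with hLs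
    let f₁ : Quad → Quad := fun k ↦ (((-k.1.1.1, k.1.1.2), k.1.2), -k.2)
    let f₂ : Quad → Quad := fun k ↦ (((k.1.1.1, -k.1.1.2), -k.1.2), k.2)
    have i₁ : Function.Injective f₁ := fun x y h ↦ by
      simp only [f₁, Prod.mk.injEq, neg_inj] at h
      exact Prod.ext (Prod.ext (Prod.ext h.1.1.1 h.1.1.2) h.1.2) h.2
    have i₂ : Function.Injective f₂ := fun x y h ↦ by
      simp only [f₂, Prod.mk.injEq, neg_inj] at h
      exact Prod.ext (Prod.ext (Prod.ext h.1.1.1 h.1.1.2) h.1.2) h.2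
    have c₁ := H s ((Ls.filter fun k ↦ k.1.1.1 < 0).image f₁) fun x hx ↦ by
      obtain ⟨k, hk, rfl⟩ := Finset.mem_image.1 hx
      rw [Finset.mem_filter, hLs, Finset.mem_filter] at hk
      obtain ⟨⟨hkL, hlog⟩, hneg⟩ := hk
      obtain ⟨M, J, T, n₁, n₂, rfl, h⟩ := hL k hkL
      refine ⟨by simpa [f₁] using hlog, by simpa [f₁] using hneg, ?_⟩
      simpa [f₁] using h.neg hneg
    have c₂ := H s ((Ls.filter fun k ↦ ¬ k.1.1.1 < 0).image f₂) fun x hx ↦ by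
      obtain ⟨k, hk, rfl⟩ := Finset.mem_image.1 hx
      rw [Finset.mem_filter, hLs, Finset.mem_filter] at hk
      obtain ⟨⟨hkL, hlog⟩, hneg⟩ := hk
      obtain ⟨M, J, T, n₁, n₂, rfl, h⟩ := hL k hkL
      have hpos : 0 < k.1.1.1 := by have := h.z_ne; omega
      refine ⟨by simpa [f₂] using hlog, by simpa [f₂] using hpos, ?_⟩
      simpa [f₂] using h.pos hpos
    rw [Finset.card_image_of_injective _ i₁] at c₁
    rw [Finset.card_image_of_injective _ i₂] at c₂
    have := Finset.card_filter_add_card_filter_not (s := Ls) (fun k : Quad ↦ k.1.1.1 < 0)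
    have hsum : (Ls.card : ℝ) = ((Ls.filter fun k ↦ k.1.1.1 < 0).card : ℝ) +
      ((Ls.filter fun k ↦ ¬ k.1.1.1 < 0).card : ℝ) := by exact_mod_cast this.symm
    rw [hsum]
    linarith

/-! ### The recursion between the cone and its dual, and its iteration. -/

/-- Every lattice point near the cone contributes substantially to the Gaussian sum attached to the
block it belongs to. -/
theorem exists_primal_block {c A D : ℝ} (hc : 1 < c) (hA : 1 ≤ A) (hD : 0 ≤ D) :
    ∃ B κ ε : ℝ, 1 ≤ B ∧ 0 < κ ∧ 0 < ε ∧ ∀ M J h : ℝ, 1 ≤ J → J ≤ M → 0 < h →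
      h ^ 2 = (M * J)⁻¹ → h ≤ ε → ∀ x : Quad, NearCone c A D M x → ∀ u₁ u₂ u₃ : ℝ,
      u₁ = ⌊(x.1.1.2 : ℝ) / (x.1.1.1 * h)⌋ * h → u₂ = ⌊(x.1.2 : ℝ) / (x.1.1.1 * h)⌋ * h →
      u₃ = surfaceHeight c u₁ u₂ →
      OnSurface c B u₁ u₂ u₃ ∧
      κ ≤ nestedGauss (M ^ 2)⁻¹ (J / M) (J / M) (J ^ 2) (fun z ↦ u₁ * z) (fun y ↦ u₂ * y.1)
        (fun y ↦ u₃ * y.1.1 + (u₁ / u₃) ^ (c - 1) * (y.1.2 - u₁ * y.1.1) +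
          (u₂ / u₃) ^ (c - 1) * (y.2 - u₂ * y.1.1)) x := by
  obtain ⟨B, C, h₀, hB, hC, hh₀, H⟩ := exists_tangent_approx hc hA hD
  -- The rescaled squares in `z`, `a`, `b` are at most `A²` each. The one in `w` is at most `A²C²`,
  -- by the tangent plane error `Ch²` and `J * M * h² = 1`.
  refine ⟨B, Real.exp (-Real.pi * (3 * A ^ 2 + A ^ 2 * C ^ 2)), h₀, hB, Real.exp_pos _, hh₀, ?_⟩
  intro M J h hJ hJM hh hh2 hhε x hx u₁ u₂ u₃ hu₁ hu₂ hu₃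
  have hA0 : 0 < A := by linarith
  have hJ0 : 0 < J := by linarith
  have hM0 : 0 < M := by linarith
  set z : ℝ := ((x.1.1.1 : ℤ) : ℝ) with hz
  have zM := hx.z_mem
  rw [← hz] at zM
  have hz0 : 0 < z := hM0.trans_le zM.1
  have hdiv : ∀ n : ℝ, n ∈ Set.Icc M (A * M) → n / z ∈ Set.Icc A⁻¹ A := by
    intro n hn
    constructor
    · rw [le_div_iff₀ hz0, inv_mul_le_iff₀ hA0]
      exact zM.2.trans (mul_le_mul_of_nonneg_left hn.1 hA0.le)
    · rw [div_le_iff₀ hz0]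
      exact hn.2.trans (mul_le_mul_of_nonneg_left zM.1 hA0.le)
  have hfl : ∀ n : ℝ, 0 ≤ n / z - ⌊n / (z * h)⌋ * h ∧ n / z - ⌊n / (z * h)⌋ * h ≤ h := by
    intro n
    have e : n / z = n / (z * h) * h := by field_simp
    have h1 := Int.floor_le (n / (z * h))
    have h2 := Int.lt_floor_add_one (n / (z * h))
    rw [e]
    constructor <;> nlinarith
  have hpowz : ∀ n : ℝ, 0 ≤ n → (n / z) ^ c = n ^ c / z ^ c := fun n hn ↦
    Real.div_rpow hn hz0.le _
  have nn : ∀ n : ℝ, n ∈ Set.Icc M (A * M) → 0 ≤ n := fun n hn ↦ hM0.le.trans hn.1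
  have hnear : |((x.1.1.2 : ℝ) / z) ^ c + ((x.1.2 : ℝ) / z) ^ c - 1 - ((x.2 : ℝ) / z) ^ c| ≤
      D * h ^ 2 := by
    have hzc : 0 < z ^ c := by positivity
    rw [hpowz _ (nn _ hx.a_mem), hpowz _ (nn _ hx.b_mem), hpowz _ (nn _ hx.w_mem)]
    have e : (x.1.1.2 : ℝ) ^ c / z ^ c + (x.1.2 : ℝ) ^ c / z ^ c - 1 - (x.2 : ℝ) ^ c / z ^ c =
      ((x.1.1.2 : ℝ) ^ c + (x.1.2 : ℝ) ^ c - z ^ c - (x.2 : ℝ) ^ c) / z ^ c := by field_simp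
    rw [e, abs_div, abs_of_pos hzc, div_le_iff₀ hzc]
    refine hx.near.trans ?_
    rw [mul_assoc]
    refine mul_le_mul_of_nonneg_left ?_ hD
    have h1 : M ^ (c - 2) = (M ^ 2)⁻¹ * M ^ c := by
      rw [Real.rpow_sub hM0, div_eq_inv_mul]; norm_num
    rw [h1, hh2]
    refine mul_le_mul (inv_anti₀ (by positivity) (by nlinarith)) ?_ (by positivity) (by positivity)
    exact Real.rpow_le_rpow hM0.le zM.1 (by linarith)
  obtain ⟨hS, ht⟩ := H h hh hhε _ (hdiv _ hx.a_mem) _ (hdiv _ hx.b_mem) _ (hdiv _ hx.w_mem) hnear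
    u₁ u₂ (hu₁ ▸ (hfl _).1) (hu₁ ▸ (hfl _).2) (hu₂ ▸ (hfl _).1) (hu₂ ▸ (hfl _).2)
  rw [← hu₃] at hS ht
  refine ⟨hS, ?_⟩
  simp only [nestedGauss, gauss, ← Real.exp_add, Real.exp_le_exp, ← hz]
  set n₁ := (u₁ / u₃) ^ (c - 1)
  set n₂ := (u₂ / u₃) ^ (c - 1)
  have q0 : (M ^ 2)⁻¹ * (z - 0) ^ 2 ≤ A ^ 2 := by
    rw [sub_zero, inv_mul_le_iff₀ (by positivity), ← mul_pow, mul_comm M A]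
    exact pow_le_pow_left₀ hz0.le zM.2 2
  have q1 : ∀ n u : ℝ, 0 ≤ n / z - u → n / z - u ≤ h → J / M * (n - u * z) ^ 2 ≤ A ^ 2 := by
    intro n u h1 h2
    have e : n - u * z = z * (n / z - u) := by field_simp
    have : (n - u * z) ^ 2 ≤ (A * M * h) ^ 2 := by
      rw [e]
      refine pow_le_pow_left₀ (mul_nonneg hz0.le h1) (mul_le_mul zM.2 h2 h1 (by positivity)) 2
    calc _ ≤ J / M * (A * M * h) ^ 2 := by gcongr
      _ = A ^ 2 * (J * M * h ^ 2) := by field_simp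
      _ = A ^ 2 := by rw [hh2]; field_simp
  have qa := q1 (x.1.1.2 : ℝ) u₁ (hu₁ ▸ (hfl _).1) (hu₁ ▸ (hfl _).2)
  have qb := q1 (x.1.2 : ℝ) u₂ (hu₂ ▸ (hfl _).1) (hu₂ ▸ (hfl _).2)
  have qw : J ^ 2 * ((x.2 : ℝ) - (u₃ * z + n₁ * (x.1.1.2 - u₁ * z) + n₂ * (x.1.2 - u₂ * z))) ^ 2 ≤
      A ^ 2 * C ^ 2 := by
    have e : (x.2 : ℝ) - (u₃ * z + n₁ * (x.1.1.2 - u₁ * z) + n₂ * (x.1.2 - u₂ * z)) =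
        z * ((x.2 : ℝ) / z - u₃ - n₁ * ((x.1.1.2 : ℝ) / z - u₁) -
          n₂ * ((x.1.2 : ℝ) / z - u₂)) := by field_simp; ring
    rw [e, mul_pow z, ← sq_abs ((x.2 : ℝ) / z - u₃ - n₁ * ((x.1.1.2 : ℝ) / z - u₁) -
          n₂ * ((x.1.2 : ℝ) / z - u₂))]
    calc _ ≤ J ^ 2 * ((A * M) ^ 2 * (C * h ^ 2) ^ 2) := by
          have := zM.2
          gcongr
      _ = _ := by rw [hh2]; field_simp
  have hπ := Real.pi_pos
  have hsum := mul_le_mul_of_nonneg_left (add_le_add (add_le_add (add_le_add q0 qa) qb) qw) hπ.le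
  linarith

theorem sum_card_eq_sum_card_filter {ι κ : Type*} [DecidableEq κ] (s : Finset ι)
    (F : ι → Finset κ) :
    ∑ b ∈ s, (F b).card = ∑ k ∈ s.biUnion F, (s.filter fun b ↦ k ∈ F b).card := by
  refine Eq.trans (Finset.sum_congr rfl fun b hb ↦ ?_)
    (Finset.sum_card_bipartiteAbove_eq_sum_card_bipartiteBelow (s := s) (t := s.biUnion F)
      fun b k ↦ k ∈ F b)
  congr 1
  ext k
  rw [Finset.bipartiteAbove, Finset.mem_filter, Finset.mem_biUnion]
  exact ⟨fun hk ↦ ⟨⟨b, hb, hk⟩, hk⟩, fun hk ↦ hk.2⟩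

-- The three terms are the zero frequencies of all blocks, the pairs of a block and a dual point
-- counted from the side of the dual points, and the Gaussian tails.
set_option maxHeartbeats 1000000 in
theorem exists_energy_recursion {c β A D : ℝ} (hc : 1 < c) (hβ : 0 < β) (hβ1 : β ≤ 1)
    (hE : EnergyBound (c / (c - 1)) β) (hA : 1 ≤ A) (hD : 0 ≤ D) :
    ∃ C ε : ℝ, 0 ≤ C ∧ 0 < ε ∧ ∀ M J T : ℝ, 1 ≤ J → J ≤ M → 1 ≤ T → T * J ≤ ε * M →
      ∀ s : Finset Quad, (∀ x ∈ s, NearCone c A D M x) →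
      (s.card : ℝ) ≤ C * (M ^ 3 / J + M ^ 2 * J ^ β * T ^ 2 +
        M ^ 3 * Real.exp (-Real.pi * T / 2)) := by
  obtain ⟨B, κ, ε₁, hB, hκ, hε₁, H₁⟩ := exists_primal_block hc hA hD
  obtain ⟨B', D', ε₂, C₂, hB', hD', hε₂, hC₂, H₂⟩ := exists_dualPoints hc hB
  obtain ⟨C₃, hC₃, H₃⟩ := exists_block_count hc hB
  obtain ⟨C₄, hC₄, H₄⟩ := exists_dual_sum hE hβ hB' hD'
  set G : ℝ := (A + 1) ^ 2 with hG
  have hG0 : 0 < G := by positivity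
  refine ⟨κ⁻¹ * (G + G * C₂ + C₃ * C₄), min (ε₁ ^ 2) (ε₂ ^ 2), by positivity, by positivity, ?_⟩
  intro M J T hJ hJM hT hTJ s hs
  have hJ0 : 0 < J := by linarith
  have hM0 : 0 < M := by linarith
  have hM1 : 1 ≤ M := by linarith
  have hT0 : 0 < T := by linarith
  set h := √((M * J)⁻¹) with hh
  have hh0 : 0 < h := by positivity
  have hh2 : h ^ 2 = (M * J)⁻¹ := Real.sq_sqrt (by positivity)
  have hTJ₁ : T * J ≤ ε₁ ^ 2 * M := hTJ.trans (by gcongr; exact min_le_left _ _)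
  have hTJ₂ : T * J ≤ ε₂ ^ 2 * M := hTJ.trans (by gcongr; exact min_le_right _ _)
  have hTJ1 : 1 ≤ T * J := one_le_mul_of_one_le_of_one_le hT hJ
  have hhε : h ≤ ε₁ := by
    rw [hh, Real.sqrt_le_left hε₁.le]
    rw [inv_le_comm₀ (by positivity) (by positivity), inv_le_iff_one_le_mul₀ (by positivity)]
    have : ε₁ ^ 2 * M ≤ M * J * ε₁ ^ 2 := by nlinarith [mul_nonneg hM0.le (sq_nonneg ε₁)]
    linarith
  have hh1 : h ≤ 1 := by
    rw [hh]
    rw [Real.sqrt_le_one]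
    exact inv_le_one_of_one_le₀ (one_le_mul_of_one_le_of_one_le hM1 hJ)
  let blk : Quad → ℤ × ℤ := fun x ↦
    (⌊(x.1.1.2 : ℝ) / (x.1.1.1 * h)⌋, ⌊(x.1.2 : ℝ) / (x.1.1.1 * h)⌋)
  set 𝓑 := s.image blk with h𝓑
  let U₃ : ℤ × ℤ → ℝ := fun b ↦ surfaceHeight c (b.1 * h) (b.2 * h)
  let N₁ : ℤ × ℤ → ℝ := fun b ↦ (b.1 * h / U₃ b) ^ (c - 1)
  let N₂ : ℤ × ℤ → ℝ := fun b ↦ (b.2 * h / U₃ b) ^ (c - 1)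
  have hsurf : ∀ b ∈ 𝓑, OnSurface c B (b.1 * h) (b.2 * h) (U₃ b) := by
    intro b hb
    obtain ⟨x, hx, rfl⟩ := Finset.mem_image.1 hb
    exact (H₁ M J h hJ hJM hh0 hh2 hhε x (hs x hx) _ _ _ rfl rfl rfl).1
  have hdual : ∀ b : ℤ × ℤ, ∃ F : Finset Quad, b ∈ 𝓑 →
      (∀ k ∈ F, DualPoint c B' D' M J T (N₁ b) (N₂ b) k) ∧
      ∑' k, nestedGauss (J ^ 2)⁻¹ (J / M)⁻¹ (J / M)⁻¹ ((M ^ 2)⁻¹)⁻¹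
        (fun z ↦ -(N₁ b * z)) (fun y ↦ -(N₂ b * y.1))
        (fun y ↦ -(U₃ b * y.1.1 + b.1 * h * y.1.2 + b.2 * h * y.2)) k ≤
      1 + F.card + C₂ * J * Real.exp (-Real.pi * T / 2) := by
    intro b
    by_cases hb : b ∈ 𝓑
    · obtain ⟨F, hF⟩ := H₂ M J T _ _ _ hJ hJM hT hTJ₂ (hsurf b hb)
      exact ⟨F, fun _ ↦ hF⟩
    · exact ⟨∅, fun h ↦ absurd h hb⟩
  choose F hF using hdual
  -- the number of blocks
  have h𝓑card : (𝓑.card : ℝ) ≤ G * (M * J) := by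
    have hsub : 𝓑 ⊆ Finset.Icc 0 ⌊A / h⌋ ×ˢ Finset.Icc 0 ⌊A / h⌋ := by
      intro b hb
      obtain ⟨x, hx, rfl⟩ := Finset.mem_image.1 hb
      have hz := (hs x hx).z_mem
      have hz0 : (0 : ℝ) < x.1.1.1 := hM0.trans_le hz.1
      have key : ∀ n : ℝ, n ∈ Set.Icc M (A * M) →
          ⌊n / (x.1.1.1 * h)⌋ ∈ Finset.Icc 0 ⌊A / h⌋ := by
        intro n hn
        rw [Finset.mem_Icc]
        have hn0 : 0 ≤ n := hM0.le.trans hn.1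
        refine ⟨Int.floor_nonneg.2 (by positivity), Int.floor_mono ?_⟩
        rw [div_le_div_iff₀ (by positivity) hh0, ← mul_assoc]
        refine mul_le_mul_of_nonneg_right (hn.2.trans ?_) hh0.le
        exact mul_le_mul_of_nonneg_left hz.1 (by linarith)
      exact Finset.mem_product.2 ⟨key _ (hs x hx).a_mem, key _ (hs x hx).b_mem⟩
    have hc1 : (𝓑.card : ℝ) ≤ (⌊A / h⌋ + 1 : ℝ) * (⌊A / h⌋ + 1) := by
      have h1 := Finset.card_le_card hsub
      rw [Finset.card_product, Int.card_Icc] at h1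
      have h0 : 0 ≤ ⌊A / h⌋ := Int.floor_nonneg.2 (by positivity)
      have h2 : (((⌊A / h⌋ + 1 - 0).toNat : ℤ) : ℝ) = ⌊A / h⌋ + 1 := by
        rw [Int.toNat_of_nonneg (by linarith)]; push_cast; ring
      rw [← h2]
      exact_mod_cast h1
    have h3 : (⌊A / h⌋ + 1 : ℝ) ≤ (A + 1) / h := by
      rw [add_div]
      exact add_le_add (Int.floor_le _) ((one_le_div hh0).2 hh1)
    have h0 : (0 : ℝ) ≤ ⌊A / h⌋ + 1 := by
      have : 0 ≤ ⌊A / h⌋ := Int.floor_nonneg.2 (by positivity)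
      positivity
    calc (𝓑.card : ℝ) ≤ ((A + 1) / h) * ((A + 1) / h) := hc1.trans (by gcongr)
      _ = (A + 1) ^ 2 * (h ^ 2)⁻¹ := by field_simp
      _ = _ := by rw [hh2, inv_inv]
  -- the count within one block
  have hfib : ∀ b ∈ 𝓑, κ * ((s.filter fun x ↦ blk x = b).card : ℝ) ≤
      M ^ 2 / J ^ 2 * (1 + (F b).card + C₂ * J * Real.exp (-Real.pi * T / 2)) := by
    intro b hb
    have hthe := tsum_nestedGauss_dual (α := (M ^ 2)⁻¹) (ρ := J / M) (σ := J ^ 2)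
      (by positivity) (by positivity) (by positivity) (b.1 * h) (b.2 * h) (U₃ b) (N₁ b) (N₂ b)
    -- The volume of the plank `M × √(M/J) × √(M/J) × 1/J`.
    have hvol : (√((M ^ 2)⁻¹))⁻¹ * (J / M)⁻¹ * (√(J ^ 2))⁻¹ = M ^ 2 / J ^ 2 := by
      rw [Real.sqrt_inv, Real.sqrt_sq hM0.le, Real.sqrt_sq hJ0.le]; field_simp
    rw [hvol] at hthe
    refine le_trans ?_ (mul_le_mul_of_nonneg_left (hF b hb).2 (by positivity))
    rw [← hthe, mul_comm, ← nsmul_eq_mul]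
    refine (Finset.card_nsmul_le_sum _ _ κ fun x hx ↦ ?_).trans
      ((summable_nestedGauss (by positivity) (by positivity) (by positivity) (by positivity)
        _ _ _).1.sum_le_tsum _ fun _ _ ↦ nestedGauss_nonneg ..)
    obtain ⟨hxs, rfl⟩ := Finset.mem_filter.1 hx
    exact (H₁ M J h hJ hJM hh0 hh2 hhε x (hs x hxs) _ _ _ rfl rfl rfl).2
  -- the double count of pairs of blocks and dual points
  have hdouble : ∑ b ∈ 𝓑, ((F b).card : ℝ) ≤ C₃ * (T * J ^ 2) * (C₄ * (J * √T) ^ β) := by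
    set L := 𝓑.biUnion F with hL
    have hswap' : ∑ b ∈ 𝓑, ((F b).card : ℝ) =
        ∑ k ∈ L, ((𝓑.filter fun b ↦ k ∈ F b).card : ℝ) := by
      exact_mod_cast sum_card_eq_sum_card_filter 𝓑 F
    rw [hswap']
    refine (Finset.sum_le_sum (g := fun k : Quad ↦ C₃ * (T * J ^ 2) *
      ((k.1.1.1.natAbs : ℝ) ^ 2)⁻¹) fun k _ ↦ ?_).trans ?_
    · refine H₃ B' D' M J T h k _ hJ hJM hT hh0 hh2 fun b hb ↦ ?_
      obtain ⟨hb𝓑, hkb⟩ := Finset.mem_filter.1 hb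
      exact ⟨hsurf b hb𝓑, (hF b hb𝓑).1 k hkb⟩
    · rw [← Finset.mul_sum]
      refine mul_le_mul_of_nonneg_left (H₄ (J * √T) L ?_ fun k hk ↦ ?_) (by positivity)
      · exact one_le_mul_of_one_le_of_one_le hJ (Real.one_le_sqrt.2 hT)
      · obtain ⟨b, hb, hkb⟩ := Finset.mem_biUnion.1 hk
        exact ⟨M, J, T, _, _, rfl, (hF b hb).1 k hkb⟩
  have hJT : (J * √T) ^ β ≤ J ^ β * T := by
    rw [Real.mul_rpow hJ0.le (by positivity)]
    refine mul_le_mul_of_nonneg_left ?_ (by positivity)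
    have h1 : 1 ≤ √T := Real.one_le_sqrt.2 hT
    calc √T ^ β ≤ √T ^ (1 : ℝ) := Real.rpow_le_rpow_of_exponent_le h1 hβ1
      _ = √T := Real.rpow_one _
      _ ≤ √T * √T := by nlinarith
      _ = T := Real.mul_self_sqrt hT0.le
  set δ := Real.exp (-Real.pi * T / 2) with hδ
  have hδ0 : 0 < δ := Real.exp_pos _
  have htotal : κ * (s.card : ℝ) ≤ M ^ 2 / J ^ 2 *
      (G * (M * J) + C₃ * (T * J ^ 2) * (C₄ * (J ^ β * T)) + G * (M * J) * (C₂ * J * δ)) := by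
    have e : (s.card : ℝ) = ∑ b ∈ 𝓑, ((s.filter fun x ↦ blk x = b).card : ℝ) := by
      exact_mod_cast Finset.card_eq_sum_card_image blk s
    rw [e, Finset.mul_sum]
    refine (Finset.sum_le_sum hfib).trans ?_
    rw [← Finset.mul_sum]
    refine mul_le_mul_of_nonneg_left ?_ (by positivity)
    rw [Finset.sum_add_distrib, Finset.sum_add_distrib, Finset.sum_const, Finset.sum_const,
      nsmul_eq_mul, nsmul_eq_mul, mul_one]
    refine add_le_add (add_le_add h𝓑card (hdouble.trans ?_)) ?_
    · gcongr
    · gcongr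
  have e : M ^ 2 / J ^ 2 *
      (G * (M * J) + C₃ * (T * J ^ 2) * (C₄ * (J ^ β * T)) + G * (M * J) * (C₂ * J * δ)) =
      G * (M ^ 3 / J) + C₃ * C₄ * (M ^ 2 * J ^ β * T ^ 2) + G * C₂ * (M ^ 3 * δ) := by
    field_simp
  rw [e] at htotal
  have hX : 0 ≤ M ^ 3 / J := by positivity
  have hY : 0 ≤ M ^ 2 * J ^ β * T ^ 2 := by positivity
  have hZ : 0 ≤ M ^ 3 * δ := by positivity
  rw [mul_assoc, ← div_eq_inv_mul, le_div_iff₀ hκ, mul_comm]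
  refine htotal.trans ?_
  have g1 : 0 ≤ G * C₂ := by positivity
  have g2 : 0 ≤ C₃ * C₄ := by positivity
  nlinarith [mul_nonneg g1 hX, mul_nonneg g1 hY, mul_nonneg g2 hX, mul_nonneg g2 hZ,
    mul_nonneg hG0.le hY, mul_nonneg hG0.le hZ]

/-- The recursion with `J = M^(1 - β/2)` and `T = M^(β²/8)`: the first term becomes `M^(2 + β/2)`
and the second exactly `M^(2 + β - β²/4)`. The hypothesis covers all exponents because the recursion
passes to the dual one. -/
theorem EnergyBound.improve {β : ℝ} (hβ : 0 < β) (hβ1 : β ≤ 1)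
    (hE : ∀ c : ℝ, 1 < c → EnergyBound c β) {c : ℝ} (hc : 1 < c) :
    EnergyBound c (β - β ^ 2 / 4) := by
  intro A D hA hD
  have hq : 1 < c / (c - 1) := by rw [one_lt_div (by linarith)]; linarith
  obtain ⟨C, ε, hC, hε, H⟩ := exists_energy_recursion hc hβ hβ1 (hE _ hq) hA hD
  obtain ⟨C₁, hC₁, H₁⟩ := energyBound_one hc A D hA hD
  set τ := β ^ 2 / 8 with hτ
  have hτ0 : 0 < τ := by positivity
  have hδ0 : 0 < β / 2 - τ := by rw [hτ]; nlinarith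
  have hev : ∀ᶠ M : ℝ in Filter.atTop, M ^ (-(β / 2 - τ)) ≤ ε ∧
      M * Real.exp (-Real.pi * M ^ τ / 2) ≤ 1 := by
    refine ((tendsto_rpow_neg_atTop hδ0).eventually_le_const hε).and ?_
    have h1 := (tendsto_rpow_mul_exp_neg_mul_atTop_nhds_zero τ⁻¹ (Real.pi / 2)
      (by positivity)).comp (tendsto_rpow_atTop hτ0)
    filter_upwards [h1.eventually_le_const zero_lt_one, Filter.eventually_ge_atTop 0] with M h2 h3
    simp only [Function.comp_apply] at h2
    rw [Real.rpow_rpow_inv h3 hτ0.ne'] at h2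
    refine le_trans (le_of_eq ?_) h2
    congr 2; ring
  obtain ⟨M₀, hM₀⟩ := Filter.eventually_atTop.1 hev
  -- The trivial bound covers `M ≤ M₀`, where its extra factor `M` is a constant.
  refine ⟨3 * C + C₁ * max M₀ 1, by positivity, fun M hM s hs ↦ ?_⟩
  have hM0 : 0 < M := by linarith
  have hpow : M ^ (2 : ℝ) ≤ M ^ (2 + (β - β ^ 2 / 4)) :=
    Real.rpow_le_rpow_of_exponent_le hM (by nlinarith)
  have hpos : 0 < M ^ (2 + (β - β ^ 2 / 4)) := by positivity
  rcases le_total M₀ M with hge | hlt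
  · obtain ⟨e1, e2⟩ := hM₀ M hge
    have hJ1 : 1 ≤ M ^ (1 - β / 2) := Real.one_le_rpow hM (by linarith)
    have hJM : M ^ (1 - β / 2) ≤ M := by
      calc M ^ (1 - β / 2) ≤ M ^ (1 : ℝ) := Real.rpow_le_rpow_of_exponent_le hM (by linarith)
        _ = M := Real.rpow_one M
    have hT1 : 1 ≤ M ^ τ := Real.one_le_rpow hM hτ0.le
    have hTJ : M ^ τ * M ^ (1 - β / 2) ≤ ε * M := by
      rw [← Real.rpow_add hM0, show τ + (1 - β / 2) = -(β / 2 - τ) + 1 by ring,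
        Real.rpow_add_one hM0.ne']
      gcongr
    refine (H M _ _ hJ1 hJM hT1 hTJ s hs).trans ?_
    have t1 : M ^ 3 / M ^ (1 - β / 2) ≤ M ^ (2 + (β - β ^ 2 / 4)) := by
      rw [← Real.rpow_natCast, ← Real.rpow_sub hM0]
      exact Real.rpow_le_rpow_of_exponent_le hM (by push_cast; nlinarith)
    have t2 : M ^ 2 * (M ^ (1 - β / 2)) ^ β * (M ^ τ) ^ 2 = M ^ (2 + (β - β ^ 2 / 4)) := by
      rw [← Real.rpow_natCast, ← Real.rpow_natCast, ← Real.rpow_mul hM0.le, ← Real.rpow_mul hM0.le,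
        ← Real.rpow_add hM0, ← Real.rpow_add hM0]
      congr 1; rw [hτ]; push_cast; ring
    have t3 : M ^ 3 * Real.exp (-Real.pi * M ^ τ / 2) ≤ M ^ (2 + (β - β ^ 2 / 4)) := by
      refine le_trans ?_ hpow
      rw [Real.rpow_ofNat, show M ^ 3 = M ^ 2 * M by ring, mul_assoc]
      exact mul_le_of_le_one_right (by positivity) e2
    calc _ ≤ C * (M ^ (2 + (β - β ^ 2 / 4)) + M ^ (2 + (β - β ^ 2 / 4)) +
          M ^ (2 + (β - β ^ 2 / 4))) := by
          rw [t2]; gcongr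
      _ ≤ _ := by
          have : 0 ≤ C₁ * max M₀ 1 := by positivity
          nlinarith [mul_nonneg this hpos.le]
  · refine (H₁ M hM s hs).trans ?_
    have h3 : M ^ (2 + 1 : ℝ) ≤ M ^ (2 + (β - β ^ 2 / 4)) * max M₀ 1 := by
      rw [Real.rpow_add_one hM0.ne']
      exact mul_le_mul hpow (hlt.trans (le_max_left _ _)) hM0.le hpos.le
    nlinarith [mul_nonneg hC hpos.le, mul_le_mul_of_nonneg_left h3 hC₁]

/-- The number of integer points of size `M` near the cone is `O(M ^ (2 + β))` for all `β > 0`. -/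
theorem energyBound_of_pos {β : ℝ} (hβ : 0 < β) : ∀ c : ℝ, 1 < c → EnergyBound c β := by
  set S : Set ℝ := {x | 0 < x ∧ x ≤ 1 ∧ ∀ c : ℝ, 1 < c → EnergyBound c x} with hS
  have h1 : (1 : ℝ) ∈ S := ⟨one_pos, le_rfl, fun c hc ↦ energyBound_one hc⟩
  have hbdd : BddBelow S := ⟨0, fun x hx ↦ hx.1.le⟩
  set b := sInf S with hb
  have hb0 : 0 ≤ b := le_csInf ⟨1, h1⟩ fun x hx ↦ hx.1.le
  rcases lt_or_ge b β with hlt | hge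
  · obtain ⟨x, hx, hxβ⟩ := exists_lt_of_csInf_lt ⟨1, h1⟩ hlt
    exact fun c hc ↦ (hx.2.2 c hc).mono hxβ.le
  · exfalso
    have hbpos : 0 < b := hβ.trans_le hge
    -- Since `x ≥ b`, the improved exponent satisfies `x - x²/4 ≤ x - b²/4 < b`, contradicting the
    -- infimum.
    obtain ⟨x, hx, hxb⟩ := exists_lt_of_csInf_lt (b := b + b ^ 2 / 4) ⟨1, h1⟩ (by
      have : 0 < b ^ 2 / 4 := by positivity
      linarith)
    have hbx : b ≤ x := csInf_le hbdd hx
    have hmem : x - x ^ 2 / 4 ∈ S := by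
      refine ⟨?_, ?_, fun c hc ↦ EnergyBound.improve hx.1 hx.2.1 hx.2.2 hc⟩
      · nlinarith [hx.1, hx.2.1]
      · nlinarith [hx.1, hx.2.1]
    have := csInf_le hbdd hmem
    nlinarith

/-! ### From points near the cone to additive energy with tolerance `2`. -/

/-- The autocorrelation of the representation function `r` is largest at zero: `2 r(n) r(n+i) ≤
r(n)² + r(n+i)²`, summed over `n`. -/
theorem card_shifted_le {ι : Type*} (P : Finset ι) (f : ι → ℤ) (i : ℤ) :
    ((P ×ˢ P).filter fun x ↦ f x.2 = f x.1 + i).card ≤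
      ((P ×ˢ P).filter fun x ↦ f x.2 = f x.1).card := by
  set r : ℤ → ℕ := fun n ↦ (P.filter fun p ↦ f p = n).card with hr
  set V := P.image f with hV
  have hcount : ∀ j : ℤ, ((P ×ˢ P).filter fun x ↦ f x.2 = f x.1 + j).card =
      ∑ n ∈ V, r n * r (n + j) := by
    intro j
    rw [Finset.card_eq_sum_card_fiberwise (f := fun x ↦ f x.1) (t := V)]
    · refine Finset.sum_congr rfl fun n _ ↦ ?_
      rw [hr, ← Finset.card_product]
      congr 1
      ext x
      simp only [Finset.mem_filter, Finset.mem_product]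
      constructor
      · rintro ⟨⟨⟨h1, h2⟩, h3⟩, h4⟩
        exact ⟨⟨h1, h4⟩, h2, by rw [h3, h4]⟩
      · rintro ⟨⟨h1, h4⟩, h2, h3⟩
        exact ⟨⟨⟨h1, h2⟩, by rw [h3, h4]⟩, h4⟩
    · intro x hx
      have := (Finset.mem_product.1 (Finset.mem_filter.1 hx).1).1
      exact Finset.mem_image_of_mem f this
  have h0 := hcount 0
  simp only [add_zero] at h0
  rw [h0, hcount]
  have hshift : ∑ n ∈ V, r (n + i) * r (n + i) ≤ ∑ n ∈ V, r n * r n := by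
    have hmap : ∑ n ∈ V, r (n + i) * r (n + i) =
        ∑ n ∈ V.map (addRightEmbedding i), r n * r n := by
      rw [Finset.sum_map]; rfl
    rw [hmap]
    refine Finset.sum_le_sum_of_ne_zero fun n _ hn ↦ ?_
    have : r n ≠ 0 := fun h ↦ hn (by rw [h, mul_zero])
    obtain ⟨p, hp⟩ := Finset.card_ne_zero.1 this
    rw [Finset.mem_filter] at hp
    rw [hV, ← hp.2]
    exact Finset.mem_image_of_mem f hp.1
  have h2 : 2 * ∑ n ∈ V, r n * r (n + i) ≤ ∑ n ∈ V, r n * r n + ∑ n ∈ V, r (n + i) * r (n + i) := by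
    rw [Finset.mul_sum, ← Finset.sum_add_distrib]
    refine Finset.sum_le_sum fun n _ ↦ ?_
    have := two_mul_le_add_sq (r n) (r (n + i))
    rw [sq, sq] at this
    linarith
  omega

theorem card_close_le {ι : Type*} (P : Finset ι) (f : ι → ℤ) (k : ℕ) :
    ((P ×ˢ P).filter fun x ↦ |f x.2 - f x.1| ≤ k).card ≤
      (2 * k + 1) * ((P ×ˢ P).filter fun x ↦ f x.2 = f x.1).card := by
  set I : Finset ℤ := Finset.Icc (-k : ℤ) k with hI
  have hmaps : ∀ x ∈ (P ×ˢ P).filter fun x ↦ |f x.2 - f x.1| ≤ k, f x.2 - f x.1 ∈ I :=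
    fun x hx ↦ by
      rw [hI, Finset.mem_Icc]
      exact abs_le.1 (Finset.mem_filter.1 hx).2
  have hIcard : I.card = 2 * k + 1 := by rw [hI, Int.card_Icc]; omega
  rw [Finset.card_eq_sum_card_fiberwise hmaps, ← hIcard, ← smul_eq_mul]
  refine Finset.sum_le_card_nsmul _ _ _ fun i _ ↦ ?_
  refine le_trans (Finset.card_le_card fun x hx ↦ ?_) (card_shifted_le P f i)
  simp only [Finset.mem_filter] at hx ⊢
  exact ⟨hx.1.1, by linarith [hx.2]⟩

/-- The number of quadruples of integers in `[M, 2M]` with `|aᶜ + bᶜ - zᶜ - wᶜ| ≤ 2`. -/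
theorem exists_additive_energy_le {c β : ℝ} (hc : 1 < c) (hc2 : c < 2) (hβ : 0 < β) :
    ∃ C : ℝ, 0 ≤ C ∧ ∀ (M : ℝ) (I : Finset ℤ), 1 ≤ M → (∀ n ∈ I, (n : ℝ) ∈ Set.Icc M (2 * M)) →
      ((((I ×ˢ I) ×ˢ (I ×ˢ I)).filter fun x ↦ |((x.2.1 : ℝ) ^ c + (x.2.2 : ℝ) ^ c) -
        ((x.1.1 : ℝ) ^ c + (x.1.2 : ℝ) ^ c)| ≤ 2).card : ℝ) ≤ C * M ^ (4 - c + β) := by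
  obtain ⟨C, hC, H⟩ := energyBound_of_pos hβ c hc 2 1 (by norm_num) zero_le_one
  refine ⟨9 * C, by positivity, fun M I hM hI ↦ ?_⟩
  have hM0 : 0 < M := by linarith
  set δ := M ^ (c - 2) with hδ
  have hδ0 : 0 < δ := by positivity
  have hδ1 : δ ≤ 1 := Real.rpow_le_one_of_one_le_of_nonpos hM (by linarith)
  set v : ℤ × ℤ → ℝ := fun p ↦ (p.1 : ℝ) ^ c + (p.2 : ℝ) ^ c with hv
  set f : ℤ × ℤ → ℤ := fun p ↦ ⌊v p / δ⌋ with hf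
  -- The values are sorted into cells of width `δ`. Tolerance `2` spans `O(1/δ) = O(M^(2-c))` cells,
  -- and each cell difference occurs at most as often as difference zero; that count is bounded by
  -- `EnergyBound`.
  set k : ℕ := ⌊2 / δ⌋₊ + 1 with hk
  have hkle : (2 * k + 1 : ℝ) ≤ 9 * δ⁻¹ := by
    have h1 : (⌊2 / δ⌋₊ : ℝ) ≤ 2 * δ⁻¹ := by
      rw [← div_eq_mul_inv]; exact Nat.floor_le (by positivity)
    have h2 : 1 ≤ δ⁻¹ := (one_le_inv₀ hδ0).2 hδ1
    rw [hk]; push_cast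
    linarith
  have hsub : (((I ×ˢ I) ×ˢ (I ×ˢ I)).filter fun x ↦ |((x.2.1 : ℝ) ^ c + (x.2.2 : ℝ) ^ c) -
        ((x.1.1 : ℝ) ^ c + (x.1.2 : ℝ) ^ c)| ≤ 2) ⊆
      ((I ×ˢ I) ×ˢ (I ×ˢ I)).filter fun x ↦ |f x.2 - f x.1| ≤ k := by
    intro x hx
    rw [Finset.mem_filter] at hx ⊢
    refine ⟨hx.1, ?_⟩
    have h1 : |v x.2 / δ - v x.1 / δ| ≤ 2 / δ := by
      rw [← sub_div, abs_div, abs_of_pos hδ0]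
      exact div_le_div_of_nonneg_right hx.2 hδ0.le
    have h2 : 2 / δ < k := by rw [hk]; push_cast; exact Nat.lt_floor_add_one _
    have a1 := Int.floor_le (v x.1 / δ)
    have a2 := Int.lt_floor_add_one (v x.1 / δ)
    have b1 := Int.floor_le (v x.2 / δ)
    have b2 := Int.lt_floor_add_one (v x.2 / δ)
    have h1 := abs_le.1 h1
    have c1 : ((f x.2 - f x.1 : ℤ) : ℝ) < k + 1 := by push_cast; linarith [h1.2]
    have c2 : (-(k : ℝ) - 1) < ((f x.2 - f x.1 : ℤ) : ℝ) := by push_cast; linarith [h1.1]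
    have c1' : f x.2 - f x.1 < k + 1 := by exact_mod_cast c1
    have c2' : -(k : ℤ) - 1 < f x.2 - f x.1 := by exact_mod_cast c2
    exact abs_le.2 ⟨by linarith, by linarith⟩
  let e : (ℤ × ℤ) × (ℤ × ℤ) → Quad := fun x ↦ (((x.1.1, x.2.1), x.2.2), x.1.2)
  have he : Function.Injective e := fun x y h ↦ by
    simp only [e, Prod.mk.injEq] at h
    exact Prod.ext (Prod.ext h.1.1.1 h.2) (Prod.ext h.1.1.2 h.1.2)
  have hdiag := H M hM ((((I ×ˢ I) ×ˢ (I ×ˢ I)).filter fun x ↦ f x.2 = f x.1).image e) fun y hy ↦ by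
    obtain ⟨x, hx, rfl⟩ := Finset.mem_image.1 hy
    simp only [Finset.mem_filter, Finset.mem_product] at hx
    refine ⟨hI _ hx.1.1.1, hI _ hx.1.2.1, hI _ hx.1.2.2, hI _ hx.1.1.2, ?_⟩
    have h1 := Int.abs_sub_lt_one_of_floor_eq_floor hx.2
    rw [← sub_div, abs_div, abs_of_pos hδ0, div_lt_one hδ0] at h1
    rw [one_mul]
    refine le_trans (le_of_eq ?_) h1.le
    simp only [hv, e]
    congr 1; ring
  rw [Finset.card_image_of_injective _ he] at hdiag
  have hcl := card_close_le (I ×ˢ I) f k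
  have hcl' : ((((I ×ˢ I) ×ˢ (I ×ˢ I)).filter fun x ↦ |f x.2 - f x.1| ≤ k).card : ℝ) ≤
      (2 * k + 1) * (((I ×ˢ I) ×ˢ (I ×ˢ I)).filter fun x ↦ f x.2 = f x.1).card := by
    exact_mod_cast hcl
  calc _ ≤ ((((I ×ˢ I) ×ˢ (I ×ˢ I)).filter fun x ↦ |f x.2 - f x.1| ≤ k).card : ℝ) := by
        exact_mod_cast Finset.card_le_card hsub
    _ ≤ 9 * δ⁻¹ * (C * M ^ (2 + β)) := hcl'.trans (by gcongr)
    _ = 9 * C * M ^ (4 - c + β) := by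
        rw [hδ, ← Real.rpow_neg hM0.le, show 4 - c + β = -(c - 2) + (2 + β) by ring,
          Real.rpow_add hM0 (-(c - 2)) (2 + β)]
        ring

/-! ### Trigonometric polynomials: moments and the large value estimate. -/

theorem continuous_addChar : Continuous addChar := by unfold addChar; fun_prop

theorem conj_addChar (x : ℝ) : (starRingEnd ℂ) (addChar x) = addChar (-x) := by
  rw [addChar, addChar, ← Complex.exp_conj]
  congr 1
  simpa using Or.inl (map_ofNat _ 2)

theorem addChar_intCast (k : ℤ) : addChar k = 1 := by
  rw [addChar, Complex.exp_eq_one_iff]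
  exact ⟨k, by push_cast; ring⟩

theorem integral_addChar (k : ℤ) :
    ∫ α in Set.Icc (0 : ℝ) 1, addChar (k * α) = if k = 0 then 1 else 0 := by
  split_ifs with h
  · subst h
    simp [addChar_zero]
  · rw [integral_Icc_eq_integral_Ioc, ← intervalIntegral.integral_of_le zero_le_one]
    have hc : (2 * Real.pi * Complex.I * k : ℂ) ≠ 0 := by
      simp [Real.pi_ne_zero, h]
    have h1 := integral_exp_mul_complex (a := 0) (b := 1) hc
    have h2 : ∀ α : ℝ, addChar (k * α) = Complex.exp (2 * Real.pi * Complex.I * k * α) := fun α ↦ by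
      rw [addChar]; congr 1; push_cast; ring
    simp_rw [h2, h1]
    have h3 : Complex.exp (2 * Real.pi * Complex.I * k * (1 : ℝ)) = 1 := by
      rw [← h2, mul_one, addChar_intCast]
    rw [h3]
    simp

/-- The trigonometric polynomial with coefficients `a` on the finite set `T`. -/
noncomputable def trigPoly (T : Finset ℤ) (a : ℤ → ℂ) (α : ℝ) : ℂ :=
  ∑ n ∈ T, a n * addChar (n * α)

theorem continuous_trigPoly (T : Finset ℤ) (a : ℤ → ℂ) : Continuous (trigPoly T a) := by
  unfold trigPoly
  exact continuous_finsetSum _ fun n _ ↦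
    continuous_const.mul (continuous_addChar.comp (continuous_const.mul continuous_id))

theorem integral_norm_sq_sum_addChar {ι : Type*} (S : Finset ι) (A : ι → ℂ) (f : ι → ℤ) :
    ((∫ α in Set.Icc (0 : ℝ) 1, ‖∑ i ∈ S, A i * addChar (f i * α)‖ ^ 2 : ℝ) : ℂ) =
      ∑ x ∈ (S ×ˢ S).filter fun x ↦ f x.1 = f x.2, A x.1 * (starRingEnd ℂ) (A x.2) := by
  have hexp : ∀ α : ℝ, ((‖∑ i ∈ S, A i * addChar (f i * α)‖ ^ 2 : ℝ) : ℂ) =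
      ∑ x ∈ S ×ˢ S, A x.1 * (starRingEnd ℂ) (A x.2) * addChar (((f x.1 - f x.2 : ℤ) : ℝ) * α) := by
    intro α
    rw [Complex.ofReal_pow, ← Complex.mul_conj', map_sum, Finset.sum_mul_sum,
      ← Finset.sum_product']
    refine Finset.sum_congr rfl fun x _ ↦ ?_
    rw [map_mul, conj_addChar]
    have : ((f x.1 - f x.2 : ℤ) : ℝ) * α = f x.1 * α + -(f x.2 * α) := by push_cast; ring
    rw [this, addChar_add]
    ring
  rw [← integral_complex_ofReal]
  simp_rw [hexp]
  rw [integral_finsetSum _ fun x _ ↦ ?_]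
  · rw [Finset.sum_filter]
    refine Finset.sum_congr rfl fun x _ ↦ ?_
    rw [integral_const_mul, integral_addChar]
    simp only [sub_eq_zero]
    split_ifs <;> simp
  · exact (continuous_const.mul (continuous_addChar.comp
      (continuous_const.mul continuous_id))).integrableOn_Icc

theorem integral_norm_trigPoly_sq (T : Finset ℤ) (a : ℤ → ℂ) :
    ∫ α in Set.Icc (0 : ℝ) 1, ‖trigPoly T a α‖ ^ 2 = ∑ n ∈ T, ‖a n‖ ^ 2 := by
  have h := integral_norm_sq_sum_addChar T a id
  have hdiag : ∑ x ∈ (T ×ˢ T).filter fun x ↦ id x.1 = id x.2, a x.1 * (starRingEnd ℂ) (a x.2) =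
      ∑ n ∈ T, ((‖a n‖ ^ 2 : ℝ) : ℂ) := by
    symm
    refine Finset.sum_bij (fun n _ ↦ (n, n)) (fun n hn ↦ by simp [hn])
      (fun n _ m _ h ↦ (Prod.mk.inj h).1) (fun x hx ↦ ?_) fun n _ ↦ ?_
    · simp only [Finset.mem_filter, Finset.mem_product, id] at hx
      exact ⟨x.1, hx.1.1, Prod.ext rfl hx.2⟩
    · rw [Complex.mul_conj', Complex.ofReal_pow]
  rw [hdiag] at h
  exact_mod_cast h

/-- The fourth moment is bounded by the additive energy. -/
theorem integral_norm_trigPoly_pow_four_le (S : Finset ℤ) (a : ℤ → ℂ) {W : ℝ} (hW : 0 ≤ W)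
    (ha : ∀ n ∈ S, ‖a n‖ ≤ W) :
    ∫ α in Set.Icc (0 : ℝ) 1, ‖trigPoly S a α‖ ^ 4 ≤
      W ^ 4 * (((S ×ˢ S) ×ˢ (S ×ˢ S)).filter fun x ↦ x.1.1 + x.1.2 = x.2.1 + x.2.2).card := by
  have h := integral_norm_sq_sum_addChar (S ×ˢ S) (fun p ↦ a p.1 * a p.2) fun p ↦ p.1 + p.2
  have hsq : ∀ α : ℝ, ‖∑ p ∈ S ×ˢ S, a p.1 * a p.2 * addChar (((p.1 + p.2 : ℤ) : ℝ) * α)‖ ^ 2 =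
      ‖trigPoly S a α‖ ^ 4 := fun α ↦ by
    have : ∑ p ∈ S ×ˢ S, a p.1 * a p.2 * addChar (((p.1 + p.2 : ℤ) : ℝ) * α) =
        trigPoly S a α * trigPoly S a α := by
      rw [trigPoly, Finset.sum_mul_sum, ← Finset.sum_product']
      refine Finset.sum_congr rfl fun p _ ↦ ?_
      rw [Int.cast_add, add_mul, addChar_add]
      ring
    rw [this, norm_mul]; ring
  simp only [hsq] at h
  have hnn : 0 ≤ ∫ α in Set.Icc (0 : ℝ) 1, ‖trigPoly S a α‖ ^ 4 :=
    integral_nonneg fun _ ↦ by positivity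
  rw [← Real.norm_of_nonneg hnn, ← Complex.norm_real, h]
  refine (norm_sum_le _ _).trans ?_
  rw [mul_comm, ← nsmul_eq_mul]
  refine Finset.sum_le_card_nsmul _ _ _ fun x hx ↦ ?_
  simp only [Finset.mem_filter, Finset.mem_product] at hx
  rw [norm_mul, RCLike.norm_conj, norm_mul, norm_mul]
  have h1 := ha _ hx.1.1.1
  have h2 := ha _ hx.1.1.2
  have h3 := ha _ hx.1.2.1
  have h4 := ha _ hx.1.2.2
  calc _ ≤ (W * W) * (W * W) := by gcongr
    _ = _ := by ring

/-- The mean square of a trigonometric polynomial over the set where it is large, when its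
coefficients are majorized by a pseudorandom weight. -/
theorem setIntegral_large_sq_le {T : Finset ℤ} {ψ : ℤ → ℂ} {ν : ℤ → ℝ} {Q E lam : ℝ}
    (hψ : ∀ n ∈ T, ‖ψ n‖ ≤ ν n) (hQ : ∑ n ∈ T, ν n ≤ Q) (hQ0 : 0 < Q)
    (hE : ∀ α : ℝ, ‖trigPoly T (fun n ↦ ((ν n - 1 : ℝ) : ℂ)) α‖ ≤ E) (hlam : 0 < lam)
    (hQE : 2 * Q * E ≤ lam ^ 2) :
    ∫ α in Set.Icc (0 : ℝ) 1 ∩ {α | lam < ‖trigPoly T ψ α‖}, ‖trigPoly T ψ α‖ ^ 2 ≤ 2 * Q := by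
  set f := trigPoly T ψ with hf
  have hfc : Continuous f := continuous_trigPoly T ψ
  set G := Set.Icc (0 : ℝ) 1 ∩ {α | lam < ‖f α‖} with hG
  have hGm : MeasurableSet G :=
    measurableSet_Icc.inter (measurableSet_lt measurable_const hfc.norm.measurable)
  have hGsub : G ⊆ Set.Icc 0 1 := Set.inter_subset_left
  have hint : ∀ g : ℝ → ℂ, Continuous g → IntegrableOn g G := fun g hg ↦
    hg.integrableOn_Icc.mono_set hGsub
  have hintR : ∀ g : ℝ → ℝ, Continuous g → IntegrableOn g G := fun g hg ↦
    hg.integrableOn_Icc.mono_set hGsub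
  have hce : ∀ n : ℤ, Continuous fun α : ℝ ↦ addChar (n * α) := fun n ↦
    continuous_addChar.comp (continuous_const.mul continuous_id)
  have hcf : Continuous fun α ↦ (starRingEnd ℂ) (f α) := Complex.continuous_conj.comp hfc
  have hE0 : 0 ≤ E := (norm_nonneg _).trans (hE 0)
  have hν : ∀ n ∈ T, 0 ≤ ν n := fun n hn ↦ (norm_nonneg _).trans (hψ n hn)
  set I := ∫ α in G, ‖f α‖ ^ 2 with hI
  have hI0 : 0 ≤ I := integral_nonneg fun _ ↦ by positivity
  set P := ∫ α in G, ‖f α‖ with hP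
  have hP0 : 0 ≤ P := integral_nonneg fun _ ↦ norm_nonneg _
  have hPI : lam * P ≤ I := by
    rw [hP, ← integral_const_mul]
    refine setIntegral_mono_on (hintR _ (continuous_const.mul hfc.norm))
      (hintR _ (hfc.norm.pow 2)) hGm fun α hα ↦ ?_
    have := hα.2
    simp only [Set.mem_ofPred_eq] at this
    rw [sq]
    exact mul_le_mul_of_nonneg_right this.le (norm_nonneg _)
  set a : ℤ → ℂ := fun n ↦ ∫ α in G, (starRingEnd ℂ) (f α) * addChar (n * α) with ha
  -- testing against a trigonometric polynomial
  have htest : ∀ b : ℤ → ℂ, ∫ α in G, (starRingEnd ℂ) (f α) * trigPoly T b α =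
      ∑ n ∈ T, b n * a n := by
    intro b
    have : ∀ α, (starRingEnd ℂ) (f α) * trigPoly T b α =
        ∑ n ∈ T, b n * ((starRingEnd ℂ) (f α) * addChar (n * α)) := fun α ↦ by
      rw [trigPoly, Finset.mul_sum]
      exact Finset.sum_congr rfl fun n _ ↦ by ring
    simp_rw [this]
    rw [integral_finsetSum _ fun n _ ↦ ?_]
    · exact Finset.sum_congr rfl fun n _ ↦ by rw [integral_const_mul]
    · exact (hint _ (hcf.mul (hce n))).const_mul _
  have hIψ : (I : ℂ) = ∑ n ∈ T, ψ n * a n := by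
    rw [← htest, hI, ← integral_complex_ofReal]
    refine integral_congr_ae (Filter.Eventually.of_forall fun α ↦ ?_)
    simp only
    rw [mul_comm, ← hf, Complex.mul_conj', Complex.ofReal_pow]
  -- Cauchy–Schwarz with weight `ν` removes `ψ`. Writing `ν = 1 + (ν - 1)` then leaves a Bessel term
  -- and an error governed by the Fourier bound `E`.
  have hCS : I ^ 2 ≤ Q * ∑ n ∈ T, ν n * ‖a n‖ ^ 2 := by
    have h1 : I ≤ ∑ n ∈ T, ν n * ‖a n‖ := by
      calc I = ‖(I : ℂ)‖ := by rw [Complex.norm_real, Real.norm_of_nonneg hI0]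
        _ ≤ ∑ n ∈ T, ‖ψ n * a n‖ := by rw [hIψ]; exact norm_sum_le _ _
        _ ≤ _ := Finset.sum_le_sum fun n hn ↦ by
          rw [norm_mul]; exact mul_le_mul_of_nonneg_right (hψ n hn) (norm_nonneg _)
    have hnn : 0 ≤ ∑ n ∈ T, ν n * ‖a n‖ ^ 2 :=
      Finset.sum_nonneg fun n hn ↦ mul_nonneg (hν n hn) (sq_nonneg _)
    calc I ^ 2 ≤ (∑ n ∈ T, ν n * ‖a n‖) ^ 2 := by gcongr
      _ ≤ (∑ n ∈ T, ν n) * ∑ n ∈ T, ν n * ‖a n‖ ^ 2 :=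
        Finset.sum_sq_le_sum_mul_sum_of_sq_le_mul _ hν
          (fun n hn ↦ mul_nonneg (hν n hn) (sq_nonneg _)) fun n _ ↦ le_of_eq (by ring)
      _ ≤ _ := by gcongr
  -- Bessel's inequality
  set X := ∑ n ∈ T, ‖a n‖ ^ 2 with hX
  have hBessel : X ≤ I := by
    set b : ℤ → ℂ := fun n ↦ (starRingEnd ℂ) (a n) with hb
    have h1 : ∫ α in G, (starRingEnd ℂ) (f α) * trigPoly T b α = (X : ℂ) := by
      rw [htest, hX]
      push_cast
      exact Finset.sum_congr rfl fun n _ ↦ by rw [mul_comm, Complex.mul_conj']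
    have hc : Continuous fun α ↦ (starRingEnd ℂ) (f α) * trigPoly T b α :=
      hcf.mul (continuous_trigPoly T b)
    have h2 : X = ∫ α in G, ((starRingEnd ℂ) (f α) * trigPoly T b α).re := by
      have := integral_re (𝕜 := ℂ) (hint _ hc)
      simp only [RCLike.re_to_complex] at this
      rw [this, h1, Complex.ofReal_re]
    -- By Parseval on the whole interval the second half integrates to at most `X / 2`, which is
    -- absorbed on the left.
    have h3 : X ≤ ∫ α in G, (‖f α‖ ^ 2 + ‖trigPoly T b α‖ ^ 2) / 2 := by
      rw [h2]
      refine integral_mono (hintR _ (Complex.continuous_re.comp hc))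
        (hintR _ (((hfc.norm.pow 2).add ((continuous_trigPoly T b).norm.pow 2)).div_const 2))
        fun α ↦ ?_
      refine (Complex.re_le_norm _).trans ?_
      rw [norm_mul, RCLike.norm_conj]
      nlinarith [sq_nonneg (‖f α‖ - ‖trigPoly T b α‖)]
    rw [integral_div, integral_add (f := fun α ↦ ‖f α‖ ^ 2) (g := fun α ↦ ‖trigPoly T b α‖ ^ 2)
      (hintR _ (hfc.norm.pow 2)) (hintR _ ((continuous_trigPoly T b).norm.pow 2))] at h3
    have h4 : ∫ α in G, ‖trigPoly T b α‖ ^ 2 ≤ X := by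
      have h5 := integral_norm_trigPoly_sq T b
      have h6 : ∑ n ∈ T, ‖b n‖ ^ 2 = X := by simp [hb, hX]
      rw [← h6, ← h5]
      exact setIntegral_mono_set ((continuous_trigPoly T b).norm.pow 2).integrableOn_Icc
        (Filter.Eventually.of_forall fun α ↦ by positivity) hGsub.eventuallyLE
    linarith
  -- the error term
  set Y := ∑ n ∈ T, (ν n - 1) * ‖a n‖ ^ 2 with hY
  have hYle : Y ≤ E * P ^ 2 := by
    set b : ℤ → ℂ := fun n ↦ ((ν n - 1 : ℝ) : ℂ) * (starRingEnd ℂ) (a n) with hb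
    have h1 : ∫ α in G, (starRingEnd ℂ) (f α) * trigPoly T b α = (Y : ℂ) := by
      rw [htest, hY]
      push_cast
      refine Finset.sum_congr rfl fun n _ ↦ ?_
      rw [hb, ← Complex.mul_conj' (a n)]
      push_cast
      ring
    -- This polynomial is the convolution of `f`, restricted to `G`, with the transform of `ν - 1`:
    -- an `L¹` norm times a supremum.
    have hbb : ∀ α, ‖trigPoly T b α‖ ≤ E * P := by
      intro α
      have hconj : ∀ n : ℤ, (starRingEnd ℂ) (a n) = ∫ θ in G, f θ * addChar (-(n * θ)) := fun n ↦ by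
        rw [ha, ← integral_conj]
        simp only [map_mul, Complex.conj_conj, conj_addChar]
      have h2 : trigPoly T b α = ∫ θ in G, f θ *
          trigPoly T (fun n ↦ ((ν n - 1 : ℝ) : ℂ)) (α - θ) := by
        have h3 : ∀ θ, f θ * trigPoly T (fun n ↦ ((ν n - 1 : ℝ) : ℂ)) (α - θ) =
            ∑ n ∈ T, (((ν n - 1 : ℝ) : ℂ) * addChar (n * α)) * (f θ * addChar (-(n * θ))) :=
          fun θ ↦ by
          rw [trigPoly, Finset.mul_sum]
          refine Finset.sum_congr rfl fun n _ ↦ ?_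
          rw [show (n : ℝ) * (α - θ) = n * α + -(n * θ) by ring, addChar_add]
          ring
        simp_rw [h3]
        rw [integral_finsetSum _ fun n _ ↦ ?_]
        · rw [trigPoly]
          refine Finset.sum_congr rfl fun n _ ↦ ?_
          rw [integral_const_mul, ← hconj, hb]
          ring
        · exact (hint _ (hfc.mul (continuous_addChar.comp
            (continuous_const.mul continuous_id).neg))).const_mul _
      rw [h2]
      calc _ ≤ ∫ θ in G, ‖f θ‖ * E := by
            refine norm_integral_le_of_norm_le (hintR _ (hfc.norm.mul continuous_const))
              (Filter.Eventually.of_forall fun θ ↦ ?_)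
            rw [norm_mul]
            exact mul_le_mul_of_nonneg_left (hE _) (norm_nonneg _)
        _ = E * P := by rw [integral_mul_const, mul_comm]
    calc Y ≤ ‖(Y : ℂ)‖ := by rw [Complex.norm_real]; exact Real.le_norm_self _
      _ ≤ ∫ α in G, ‖f α‖ * (E * P) := by
          rw [← h1]
          refine norm_integral_le_of_norm_le (hintR _ (hfc.norm.mul continuous_const))
            (Filter.Eventually.of_forall fun α ↦ ?_)
          rw [norm_mul, RCLike.norm_conj]
          exact mul_le_mul_of_nonneg_left (hbb α) (norm_nonneg _)
      _ = E * P ^ 2 := by rw [integral_mul_const]; ring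
  have hsplit : ∑ n ∈ T, ν n * ‖a n‖ ^ 2 = X + Y := by
    rw [hX, hY, ← Finset.sum_add_distrib]
    exact Finset.sum_congr rfl fun n _ ↦ by ring
  rw [hsplit] at hCS
  have h1 : lam ^ 2 * P ^ 2 ≤ I ^ 2 := by
    rw [← mul_pow]; exact pow_le_pow_left₀ (by positivity) hPI 2
  -- The size of `lam` makes the error term `Q * E * P²` at most `I² / 2`, so `I² ≤ Q * I + I² / 2`.
  have h2 : 2 * Q * E * P ^ 2 ≤ I ^ 2 := le_trans (by gcongr) h1
  have h3 : I ^ 2 ≤ 2 * Q * I := by nlinarith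
  rcases hI0.eq_or_lt with h | h
  · rw [← h]; positivity
  · exact le_of_mul_le_mul_right (by linarith [sq I]) h

/-! ### The Piatetski-Shapiro weight and its fourth moment. -/

theorem one_le_of_mem_PS {c : ℝ} (hc : 0 < c) {n : ℤ} (hn : n ∈ PS c) : 1 ≤ n := by
  obtain ⟨m, hm, rfl⟩ := hn
  refine Int.le_floor.2 ?_
  push_cast
  exact Real.one_le_rpow (by exact_mod_cast hm) hc.le

theorem nu_of_mem {c : ℝ} (hc : 0 < c) {N : ℕ} {n : ℤ} (hn : n ∈ PSle c N) :
    nu c N n = c * (n : ℝ) ^ (1 - 1 / c) := by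
  have h1 : (1 : ℝ) ≤ n := by exact_mod_cast one_le_of_mem_PS hc hn.1
  have hn0 : (0 : ℝ) < n := by linarith
  have hd : deriv (phi c) (n : ℝ) = 1 / c * (n : ℝ) ^ (1 / c - 1) :=
    (Real.hasDerivAt_rpow_const (Or.inl hn0.ne')).deriv
  rw [nu, Set.indicator_of_mem hn, hd, mul_inv, ← Real.rpow_neg hn0.le, neg_sub, one_div, inv_inv]

theorem nu_of_notMem {c : ℝ} {N : ℕ} {n : ℤ} (hn : n ∉ PSle c N) : nu c N n = 0 :=
  Set.indicator_of_notMem hn _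

theorem mem_Icc_of_mem_PSle {c : ℝ} (hc : 0 < c) {N : ℕ} {n : ℤ} (hn : n ∈ PSle c N) :
    n ∈ Finset.Icc (1 : ℤ) N :=
  Finset.mem_Icc.2 ⟨one_le_of_mem_PS hc hn.1, hn.2⟩

theorem fourierZ_eq_trigPoly {T : Finset ℤ} {f : ℤ → ℂ} (hf : ∀ n ∉ T, f n = 0) (α : ℝ) :
    fourierZ f α = trigPoly T f α := by
  rw [fourierZ, tsum_eq_sum (s := T) fun n hn ↦ by rw [hf n hn, zero_mul], trigPoly]
  refine Finset.sum_congr rfl fun n _ ↦ ?_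
  rw [addChar]
  push_cast
  rfl

/-- The fourth moment of a trigonometric polynomial whose frequencies are the Piatetski-Shapiro
numbers coming from a dyadic block. -/
theorem exists_block_fourth_moment_le {c ε : ℝ} (hc : 1 < c) (hc2 : c < 2) (hε : 0 < ε) :
    ∃ C : ℝ, 0 ≤ C ∧ ∀ (N : ℕ) (ψ : ℤ → ℂ), 1 ≤ N → (∀ n, ‖ψ n‖ ≤ nu c N n) →
      ∀ (j : ℕ) (idx : ℤ → ℕ) (S : Finset ℤ),
      (∀ n ∈ S, n ∈ PSle c N ∧ 1 ≤ idx n ∧ n = ⌊(idx n : ℝ) ^ c⌋ ∧ Nat.log 2 (idx n) = j) →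
      ∫ α in Set.Icc (0 : ℝ) 1, ‖trigPoly S ψ α‖ ^ 4 ≤ C * (2 * N : ℝ) ^ (3 + ε) := by
  obtain ⟨C, hC, H⟩ := exists_additive_energy_le hc hc2 hε
  have hc0 : 0 < c := by linarith
  refine ⟨(c * 2 ^ (c - 1)) ^ 4 * C, by positivity, fun N ψ hN hψ j idx S hS ↦ ?_⟩
  have hN0 : (1 : ℝ) ≤ N := by exact_mod_cast hN
  rcases S.eq_empty_or_nonempty with rfl | ⟨n₀, hn₀⟩
  · simp [trigPoly]
    positivity
  set M : ℝ := 2 ^ j with hM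
  have hM1 : 1 ≤ M := one_le_pow₀ (by norm_num)
  have hM0 : 0 < M := by linarith
  have hidx : ∀ n ∈ S, M ≤ idx n ∧ (idx n : ℝ) ≤ 2 * M := fun n hn ↦ by
    obtain ⟨_, h1, _, h2⟩ := hS n hn
    constructor
    · rw [hM, ← h2]; exact_mod_cast Nat.pow_log_le_self 2 (by omega)
    · rw [hM, ← pow_succ', ← h2]
      exact_mod_cast (Nat.lt_pow_succ_log_self (by norm_num) _).le
  have hfl : ∀ n ∈ S, (n : ℝ) ≤ (idx n : ℝ) ^ c ∧ (idx n : ℝ) ^ c < n + 1 := fun n hn ↦ by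
    obtain ⟨_, _, h2, _⟩ := hS n hn
    have h3 := Int.floor_le ((idx n : ℝ) ^ c)
    have h4 := Int.lt_floor_add_one ((idx n : ℝ) ^ c)
    rw [← h2] at h3 h4
    exact ⟨h3, h4⟩
  -- One element of the nonempty block suffices: `M^c < n₀ + 1 ≤ N + 1 ≤ 2N`.
  have hMN : M ^ c ≤ 2 * N := by
    have h1 : M ^ c ≤ (idx n₀ : ℝ) ^ c := Real.rpow_le_rpow hM0.le (hidx n₀ hn₀).1 hc0.le
    have h2 : (n₀ : ℝ) ≤ N := by exact_mod_cast (hS n₀ hn₀).1.2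
    linarith [(hfl n₀ hn₀).2]
  set W := c * (2 * M) ^ (c - 1) with hW
  have hW0 : 0 ≤ W := by positivity
  have hψW : ∀ n ∈ S, ‖ψ n‖ ≤ W := fun n hn ↦ by
    refine (hψ n).trans ?_
    rw [nu_of_mem hc0 (hS n hn).1, hW]
    have h1 : (1 : ℝ) ≤ n := by exact_mod_cast one_le_of_mem_PS hc0 (hS n hn).1.1
    have h2 : (n : ℝ) ≤ (2 * M) ^ c :=
      (hfl n hn).1.trans (Real.rpow_le_rpow (by positivity) (hidx n hn).2 hc0.le)
    have h3 : 0 ≤ 1 - 1 / c := by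
      rw [sub_nonneg, div_le_one hc0]; exact hc.le
    calc c * (n : ℝ) ^ (1 - 1 / c) ≤ c * ((2 * M) ^ c) ^ (1 - 1 / c) := by gcongr
      _ = _ := by
        rw [← Real.rpow_mul (by positivity)]
        congr 2
        field_simp
  have hmom := integral_norm_trigPoly_pow_four_le S ψ hW0 hψW
  set I : Finset ℤ := S.image fun n ↦ (idx n : ℤ) with hI
  have hen := H M I hM1 fun m hm ↦ by
    obtain ⟨n, hn, rfl⟩ := Finset.mem_image.1 hm
    simpa using hidx n hn
  -- Each `n` lies less than `1` below the `c`-th power of its index, so equal sums of two elements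
  -- give sums of powers differing by at most `2`. Indices determine elements, so no solution is
  -- lost.
  have hcount : ((((S ×ˢ S) ×ˢ (S ×ˢ S)).filter fun x ↦ x.1.1 + x.1.2 = x.2.1 + x.2.2).card : ℝ) ≤
      C * M ^ (4 - c + ε) := by
    refine le_trans ?_ hen
    have hinj : ∀ n ∈ S, ∀ n' ∈ S, (idx n : ℤ) = idx n' → n = n' := fun n hn n' hn' h ↦ by
      have h' : idx n = idx n' := by exact_mod_cast h
      rw [(hS n hn).2.2.1, (hS n' hn').2.2.1, h']
    refine Nat.cast_le.2 (Finset.card_le_card_of_injOn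
      (fun x ↦ (((idx x.1.1 : ℤ), (idx x.1.2 : ℤ)), ((idx x.2.1 : ℤ), (idx x.2.2 : ℤ)))) ?_ ?_)
    · intro x hx
      simp only [Finset.mem_coe, Finset.mem_filter, Finset.mem_product] at hx ⊢
      obtain ⟨⟨⟨h1, h2⟩, h3, h4⟩, h5⟩ := hx
      refine ⟨⟨⟨Finset.mem_image_of_mem _ h1, Finset.mem_image_of_mem _ h2⟩,
        Finset.mem_image_of_mem _ h3, Finset.mem_image_of_mem _ h4⟩, ?_⟩
      have h6 : (x.1.1 : ℝ) + x.1.2 = x.2.1 + x.2.2 := by exact_mod_cast h5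
      have f1 := hfl _ h1
      have f2 := hfl _ h2
      have f3 := hfl _ h3
      have f4 := hfl _ h4
      push_cast
      exact abs_le.2 ⟨by linarith [f1.2, f2.2, f3.1, f4.1], by linarith [f1.1, f2.1, f3.2, f4.2]⟩
    · intro x hx y hy h
      simp only [Finset.coe_filter, Finset.mem_product, Set.mem_ofPred_eq] at hx hy
      simp only [Prod.mk.injEq] at h
      exact Prod.ext (Prod.ext (hinj _ hx.1.1.1 _ hy.1.1.1 h.1.1) (hinj _ hx.1.1.2 _ hy.1.1.2 h.1.2))
        (Prod.ext (hinj _ hx.1.2.1 _ hy.1.2.1 h.2.1) (hinj _ hx.1.2.2 _ hy.1.2.2 h.2.2))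
  -- The weights contribute `4(c - 1)` to the exponent, so the total is `3c + ε ≤ c(3 + ε)`.
  have hpow : (M ^ (c - 1)) ^ 4 * M ^ (4 - c + ε) ≤ (2 * N : ℝ) ^ (3 + ε) := by
    calc (M ^ (c - 1)) ^ 4 * M ^ (4 - c + ε) = M ^ (3 * c + ε) := by
          rw [← Real.rpow_natCast, ← Real.rpow_mul hM0.le, ← Real.rpow_add hM0]
          congr 1; push_cast; ring
      _ ≤ M ^ (c * (3 + ε)) := Real.rpow_le_rpow_of_exponent_le hM1 (by nlinarith)
      _ = (M ^ c) ^ (3 + ε) := Real.rpow_mul hM0.le _ _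
      _ ≤ _ := Real.rpow_le_rpow (by positivity) hMN (by positivity)
  calc _ ≤ W ^ 4 * (C * M ^ (4 - c + ε)) := hmom.trans (by gcongr)
    _ = (c * 2 ^ (c - 1)) ^ 4 * C * ((M ^ (c - 1)) ^ 4 * M ^ (4 - c + ε)) := by
        rw [hW, Real.mul_rpow (by norm_num) hM0.le]; ring
    _ ≤ _ := by gcongr

theorem exists_natLog_le {δ : ℝ} (hδ : 0 < δ) :
    ∃ C : ℝ, 0 ≤ C ∧ ∀ n : ℕ, 1 ≤ n → (Nat.log 2 n + 1 : ℝ) ≤ C * (n : ℝ) ^ δ := by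
  have hl := Real.log_pos (x := 2) (by norm_num)
  refine ⟨(δ * Real.log 2)⁻¹ + 1, by positivity, fun n hn ↦ ?_⟩
  have hn1 : (1 : ℝ) ≤ n := by exact_mod_cast hn
  have h1 : (Nat.log 2 n : ℝ) ≤ Real.logb 2 n := by exact_mod_cast Real.natLog_le_logb n 2
  have h2 := Real.log_le_rpow_div (x := n) (by linarith) hδ
  have h3 : Real.logb 2 n ≤ (δ * Real.log 2)⁻¹ * (n : ℝ) ^ δ := by
    rw [Real.logb, div_le_iff₀ hl]
    refine h2.trans (le_of_eq ?_)
    field_simp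
  have h4 : 1 ≤ (n : ℝ) ^ δ := Real.one_le_rpow hn1 hδ.le
  linarith

/-- The fourth moment estimate with an `ε`-loss. -/
theorem exists_fourth_moment_le {c ε : ℝ} (hc : 1 < c) (hc2 : c < 2) (hε : 0 < ε) :
    ∃ C : ℝ, 0 ≤ C ∧ ∀ (N : ℕ) (ψ : ℤ → ℂ), 1 ≤ N → (∀ n, ‖ψ n‖ ≤ nu c N n) →
      ∫ α in Set.Icc (0 : ℝ) 1, ‖trigPoly (Finset.Icc 1 (N : ℤ)) ψ α‖ ^ 4 ≤
        C * (N : ℝ) ^ (3 + ε) := by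
  classical
  obtain ⟨C₁, hC₁, H₁⟩ := exists_block_fourth_moment_le hc hc2 (half_pos hε)
  obtain ⟨C₂, hC₂, H₂⟩ := exists_natLog_le (δ := ε / 8) (by positivity)
  have hc0 : 0 < c := by linarith
  refine ⟨C₂ ^ 4 * C₁ * 2 ^ (3 + ε), by positivity, fun N ψ hN hψ ↦ ?_⟩
  have hN1 : (1 : ℝ) ≤ N := by exact_mod_cast hN
  have hPS : ∀ n : ℤ, ∃ m : ℕ, n ∈ PS c → 1 ≤ m ∧ n = ⌊(m : ℝ) ^ c⌋ := fun n ↦ by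
    by_cases h : n ∈ PS c
    · obtain ⟨m, hm⟩ := h
      exact ⟨m, fun _ ↦ hm⟩
    · exact ⟨0, fun h' ↦ absurd h' h⟩
  choose idx hidx using hPS
  set S := (Finset.Icc 1 (N : ℤ)).filter fun n ↦ n ∈ PSle c N with hS
  set J := Nat.log 2 (2 * N) + 1 with hJ
  let Sj : ℕ → Finset ℤ := fun j ↦ S.filter fun n ↦ Nat.log 2 (idx n) = j
  have hmaps : ∀ n ∈ S, Nat.log 2 (idx n) ∈ Finset.range J := fun n hn ↦ by
    have hmem := (Finset.mem_filter.1 hn).2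
    obtain ⟨h1, h2⟩ := hidx n hmem.1
    rw [Finset.mem_range, hJ, Nat.lt_succ_iff]
    refine Nat.log_mono_right ?_
    have h3 := Int.lt_floor_add_one ((idx n : ℝ) ^ c)
    rw [← h2] at h3
    have h4 : (n : ℝ) ≤ N := by exact_mod_cast hmem.2
    have h5 : (idx n : ℝ) ≤ (idx n : ℝ) ^ c :=
      Real.self_le_rpow_of_one_le (by exact_mod_cast h1) hc.le
    have h6 : (idx n : ℝ) ≤ 2 * N := by linarith
    exact_mod_cast h6
  have hdecomp : ∀ α, trigPoly (Finset.Icc 1 (N : ℤ)) ψ α =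
      ∑ j ∈ Finset.range J, trigPoly (Sj j) ψ α := fun α ↦ by
    simp only [trigPoly, Sj]
    rw [Finset.sum_fiberwise_of_maps_to hmaps, hS, Finset.sum_filter]
    refine Finset.sum_congr rfl fun n _ ↦ ?_
    split_ifs with h
    · rfl
    · have : ψ n = 0 := norm_le_zero_iff.1 ((hψ n).trans (nu_of_notMem h).le)
      rw [this, zero_mul]
  have hJ0 : (0 : ℝ) < J := by rw [hJ]; positivity
  -- The power mean inequality over the `J = O(log N)` blocks; with the sum over blocks the total
  -- loss is `J⁴`, absorbed by `N^ε`.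
  have hpt : ∀ α, ‖trigPoly (Finset.Icc 1 (N : ℤ)) ψ α‖ ^ 4 ≤
      (J : ℝ) ^ 3 * ∑ j ∈ Finset.range J, ‖trigPoly (Sj j) ψ α‖ ^ 4 := fun α ↦ by
    have h1 := pow_sum_div_card_le_sum_pow (s := Finset.range J)
      (f := fun j ↦ ‖trigPoly (Sj j) ψ α‖) (fun j _ ↦ norm_nonneg _) 3
    rw [Finset.card_range, div_le_iff₀ (by positivity), mul_comm] at h1
    refine le_trans ?_ h1
    rw [hdecomp]
    exact pow_le_pow_left₀ (norm_nonneg _) (norm_sum_le _ _) 4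
  have hci : ∀ T : Finset ℤ, IntegrableOn (fun α ↦ ‖trigPoly T ψ α‖ ^ 4) (Set.Icc (0 : ℝ) 1) :=
    fun T ↦ ((continuous_trigPoly T ψ).norm.pow 4).integrableOn_Icc
  have hJle : (J : ℝ) ≤ C₂ * (2 * N : ℝ) ^ (ε / 8) := by
    have := H₂ (2 * N) (by omega)
    rw [hJ]; push_cast at this ⊢; exact this
  calc _ ≤ ∫ α in Set.Icc (0 : ℝ) 1,
        (J : ℝ) ^ 3 * ∑ j ∈ Finset.range J, ‖trigPoly (Sj j) ψ α‖ ^ 4 :=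
        integral_mono (hci _)
          (Integrable.const_mul (integrable_finsetSum _ fun j _ ↦ hci _) _) hpt
    _ = (J : ℝ) ^ 3 * ∑ j ∈ Finset.range J,
        ∫ α in Set.Icc (0 : ℝ) 1, ‖trigPoly (Sj j) ψ α‖ ^ 4 := by
        rw [integral_const_mul, integral_finsetSum _ fun j _ ↦ hci _]
    _ ≤ (J : ℝ) ^ 3 * ∑ j ∈ Finset.range J, C₁ * (2 * N : ℝ) ^ (3 + ε / 2) := by
        gcongr with j hj
        refine H₁ N ψ hN hψ j idx (Sj j) fun n hn ↦ ?_
        obtain ⟨hnS, hlog⟩ := Finset.mem_filter.1 hn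
        have hmem := (Finset.mem_filter.1 hnS).2
        exact ⟨hmem, (hidx n hmem.1).1, (hidx n hmem.1).2, hlog⟩
    _ = (J : ℝ) ^ 4 * (C₁ * (2 * N : ℝ) ^ (3 + ε / 2)) := by
        rw [Finset.sum_const, Finset.card_range, nsmul_eq_mul]; ring
    _ ≤ (C₂ * (2 * N : ℝ) ^ (ε / 8)) ^ 4 * (C₁ * (2 * N : ℝ) ^ (3 + ε / 2)) := by gcongr
    _ = C₂ ^ 4 * C₁ * (2 * N : ℝ) ^ (3 + ε) := by
        have h2N : (0 : ℝ) < 2 * N := by positivity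
        have : ((2 * N : ℝ) ^ (ε / 8)) ^ 4 * (2 * N : ℝ) ^ (3 + ε / 2) = (2 * N : ℝ) ^ (3 + ε) := by
          rw [← Real.rpow_natCast, ← Real.rpow_mul h2N.le, ← Real.rpow_add h2N]
          congr 1; push_cast; ring
        rw [← this]; ring
    _ = _ := by rw [Real.mul_rpow (by norm_num) (by positivity)]; ring

end PiatetskiShapiro

/-! ### The restriction estimate: combining large and small values. -/

open PiatetskiShapiro MeasureTheory in
theorem proposition3p2 (c t χ : ℝ) (hc1 : 1 < c) (hc2 : c < 2) (ht : 4 < t)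
    (hχ0 : 0 < χ) (hχ1 : χ < 1) (hdecay : PiatetskiShapiro.FourierDecay c χ) :
    ∃ K : ℝ, ∀ N : ℕ, 1 ≤ N → ∀ ψ : ℤ → ℂ,
      (∀ n : ℤ, ‖ψ n‖ ≤ PiatetskiShapiro.nu c N n) →
        ∫ α in Set.Icc (0 : ℝ) 1, ‖PiatetskiShapiro.fourierZ ψ α‖ ^ t
          ≤ K * (N : ℝ) ^ (t - 1) := by
  obtain ⟨C₀, hC₀⟩ := hdecay
  have hc0 : 0 < c := by linarith
  -- This loss is exactly what the height saves: `(1 - χ/2)(t - 4) + 3 + χ(t - 4)/2 = t - 1`.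
  have hε : 0 < χ * (t - 4) / 2 := by
    have : 0 < t - 4 := by linarith
    positivity
  obtain ⟨C₄, hC₄, H₄⟩ := exists_fourth_moment_le hc1 hc2 hε
  set C := max C₀ 1 with hC
  have hC1 : 1 ≤ C := le_max_right _ _
  set Λ := 2 * (1 + C) * C with hΛ
  have hΛ0 : 0 < Λ := by positivity
  refine ⟨(1 + C) ^ (t - 2) * (2 * (1 + C)) + (√Λ) ^ (t - 4) * C₄, fun N hN ψ hψ ↦ ?_⟩
  have hN1 : (1 : ℝ) ≤ N := by exact_mod_cast hN
  have hN0 : (0 : ℝ) < N := by linarith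
  set T := Finset.Icc (1 : ℤ) N with hT
  have hνT : ∀ n ∉ T, nu c N n = 0 := fun n hn ↦
    nu_of_notMem fun h ↦ hn (mem_Icc_of_mem_PSle hc0 h)
  have hψT : ∀ n ∉ T, ψ n = 0 := fun n hn ↦ norm_le_zero_iff.1 ((hψ n).trans (hνT n hn).le)
  simp only [fourierZ_eq_trigPoly hψT]
  set f := trigPoly T ψ with hf
  have hfc : Continuous f := continuous_trigPoly T ψ
  set E := C * (N : ℝ) ^ (1 - χ) with hE
  set Q := (1 + C) * N with hQ
  have hQ0 : 0 < Q := by positivity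
  have hbase : ∀ α ∈ Set.Icc (0 : ℝ) 1, ‖trigPoly T (fun n ↦ ((nu c N n - 1 : ℝ) : ℂ)) α‖ ≤ E := by
    intro α hα
    have h1 := hC₀ N hN α hα
    rw [fourierZ_eq_trigPoly (T := T) (fun n hn ↦ by rw [hνT n hn, Complex.ofReal_zero]),
      fourierZ_eq_trigPoly (T := T) (f := oneN N) fun n hn ↦
        Set.indicator_of_notMem (s := Set.Icc 1 (N : ℤ)) (fun h ↦ hn (Finset.mem_Icc.2 h)) _,
      trigPoly, trigPoly, ← Finset.sum_sub_distrib] at h1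
    have h2 : trigPoly T (fun n ↦ ((nu c N n - 1 : ℝ) : ℂ)) α = ∑ n ∈ T,
        ((nu c N n : ℂ) * addChar (n * α) - oneN N n * addChar (n * α)) := by
      refine Finset.sum_congr rfl fun n hn ↦ ?_
      have : oneN N n = 1 := Set.indicator_of_mem (s := Set.Icc 1 (N : ℤ)) (Finset.mem_Icc.1 hn) _
      rw [this]; push_cast; ring
    rw [h2]
    refine h1.trans ?_
    rw [hE]
    gcongr
    exact le_max_left _ _
  -- The large value estimate evaluates this polynomial at differences `α - θ`, which leave `[0,
  -- 1]`; periodicity extends the bound.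
  have hall : ∀ α : ℝ, ‖trigPoly T (fun n ↦ ((nu c N n - 1 : ℝ) : ℂ)) α‖ ≤ E := by
    intro α
    have h1 := hbase (Int.fract α) ⟨Int.fract_nonneg α, (Int.fract_lt_one α).le⟩
    have h2 : trigPoly T (fun n ↦ ((nu c N n - 1 : ℝ) : ℂ)) (Int.fract α) =
        trigPoly T (fun n ↦ ((nu c N n - 1 : ℝ) : ℂ)) α := by
      refine Finset.sum_congr rfl fun n _ ↦ ?_
      have : (n : ℝ) * α = n * Int.fract α + ((n * ⌊α⌋ : ℤ) : ℝ) := by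
        nth_rw 1 [← Int.fract_add_floor α]
        push_cast; ring
      rw [this, addChar_add, addChar_intCast, mul_one]
    rwa [h2] at h1
  have hcardT : ∑ _n ∈ T, (1 : ℝ) = N := by
    rw [Finset.sum_const, hT, Int.card_Icc]; simp
  have hNχ : (N : ℝ) ^ (1 - χ) ≤ N := by
    calc (N : ℝ) ^ (1 - χ) ≤ (N : ℝ) ^ (1 : ℝ) :=
          Real.rpow_le_rpow_of_exponent_le hN1 (by linarith)
      _ = N := Real.rpow_one _
  -- The decay estimate at frequency `0` controls the total mass of `ν`.
  have hsumν : ∑ n ∈ T, nu c N n ≤ Q := by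
    have h1 := hall 0
    have h2 : trigPoly T (fun n ↦ ((nu c N n - 1 : ℝ) : ℂ)) 0 =
        ((∑ n ∈ T, nu c N n - N : ℝ) : ℂ) := by
      rw [← hcardT, ← Finset.sum_sub_distrib, trigPoly]
      push_cast
      refine Finset.sum_congr rfl fun n _ ↦ ?_
      rw [mul_zero, addChar_zero, mul_one]
    rw [h2, Complex.norm_real] at h1
    have h3 := (le_abs_self _).trans h1
    have h4 : E ≤ C * N := by rw [hE]; gcongr
    rw [hQ]; linarith
  -- The smallest height admitted by `setIntegral_large_sq_le`: `lam² = 2QE`.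
  set lam := √Λ * (N : ℝ) ^ (1 - χ / 2) with hlam
  have hlam0 : 0 < lam := by positivity
  have hlamsq : 2 * Q * E ≤ lam ^ 2 := by
    have h1 : ((N : ℝ) ^ (1 - χ / 2)) ^ 2 = N * (N : ℝ) ^ (1 - χ) := by
      rw [← Real.rpow_natCast, ← Real.rpow_mul hN0.le, mul_comm (N : ℝ), ← Real.rpow_add_one hN0.ne']
      congr 1; push_cast; ring
    rw [hlam, mul_pow, Real.sq_sqrt hΛ0.le, h1, hQ, hE, hΛ]
    exact le_of_eq (by ring)
  have hlarge := setIntegral_large_sq_le (T := T) (fun n _ ↦ hψ n) hsumν hQ0 hall hlam0 hlamsq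
  have hfour := H₄ N ψ hN hψ
  rw [← hf] at hlarge hfour
  have hfQ : ∀ α, ‖f α‖ ≤ Q := fun α ↦ by
    refine ((norm_sum_le _ _).trans (Finset.sum_le_sum fun n _ ↦ ?_)).trans hsumν
    rw [norm_mul, norm_addChar, mul_one]
    exact hψ n
  set G := {α | lam < ‖f α‖} with hG
  have hGm : MeasurableSet G := measurableSet_lt measurable_const hfc.norm.measurable
  have hpt : ∀ α, ‖f α‖ ^ t ≤ Q ^ (t - 2) * G.indicator (fun α ↦ ‖f α‖ ^ 2) α +
      lam ^ (t - 4) * ‖f α‖ ^ 4 := by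
    intro α
    by_cases hα : α ∈ G
    · rw [Set.indicator_of_mem hα]
      have hpos : 0 < ‖f α‖ := hlam0.trans hα
      have h1 : ‖f α‖ ^ t = ‖f α‖ ^ (t - 2) * ‖f α‖ ^ 2 := by
        rw [← Real.rpow_natCast, ← Real.rpow_add hpos]; congr 1; push_cast; ring
      have h2 : ‖f α‖ ^ (t - 2) ≤ Q ^ (t - 2) :=
        Real.rpow_le_rpow hpos.le (hfQ α) (by linarith)
      have h3 : 0 ≤ lam ^ (t - 4) * ‖f α‖ ^ 4 := by positivity
      rw [h1]
      nlinarith [mul_le_mul_of_nonneg_right h2 (sq_nonneg ‖f α‖)]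
    · rw [Set.indicator_of_notMem hα, mul_zero, zero_add]
      have hle : ‖f α‖ ≤ lam := not_lt.1 hα
      have h1 : ‖f α‖ ^ t = ‖f α‖ ^ (t - 4) * ‖f α‖ ^ 4 := by
        rw [← Real.rpow_natCast, ← Real.rpow_add_of_nonneg (norm_nonneg _) (by linarith)
          (by positivity)]
        congr 1; push_cast; ring
      rw [h1]
      have : ‖f α‖ ^ (t - 4) ≤ lam ^ (t - 4) :=
        Real.rpow_le_rpow (norm_nonneg _) hle (by linarith)
      gcongr
  have i1 : IntegrableOn (G.indicator fun α ↦ ‖f α‖ ^ 2) (Set.Icc (0 : ℝ) 1) :=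
    ((hfc.norm.pow 2).integrableOn_Icc).indicator hGm
  have i2 : IntegrableOn (fun α ↦ ‖f α‖ ^ 4) (Set.Icc (0 : ℝ) 1) :=
    (hfc.norm.pow 4).integrableOn_Icc
  have i3 : IntegrableOn (fun α ↦ ‖f α‖ ^ t) (Set.Icc (0 : ℝ) 1) :=
    (hfc.norm.rpow_const fun _ ↦ Or.inr (by linarith)).integrableOn_Icc
  have hQpow : Q ^ (t - 2) * (2 * Q) = (1 + C) ^ (t - 2) * (2 * (1 + C)) * (N : ℝ) ^ (t - 1) := by
    rw [hQ, Real.mul_rpow (by positivity) hN0.le, show t - 1 = t - 2 + 1 by ring,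
      Real.rpow_add_one hN0.ne']
    ring
  have hlpow : lam ^ (t - 4) * (C₄ * (N : ℝ) ^ (3 + χ * (t - 4) / 2)) =
      (√Λ) ^ (t - 4) * C₄ * (N : ℝ) ^ (t - 1) := by
    have : (N : ℝ) ^ (t - 1) = (N : ℝ) ^ ((1 - χ / 2) * (t - 4)) *
        (N : ℝ) ^ (3 + χ * (t - 4) / 2) := by
      rw [← Real.rpow_add hN0]; congr 1; ring
    rw [hlam, Real.mul_rpow (by positivity) (by positivity), ← Real.rpow_mul hN0.le, this]
    ring
  calc ∫ α in Set.Icc (0 : ℝ) 1, ‖f α‖ ^ t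
      ≤ ∫ α in Set.Icc (0 : ℝ) 1, (Q ^ (t - 2) * G.indicator (fun α ↦ ‖f α‖ ^ 2) α +
        lam ^ (t - 4) * ‖f α‖ ^ 4) :=
        integral_mono i3 ((i1.const_mul _).add (i2.const_mul _)) hpt
    _ = Q ^ (t - 2) * (∫ α in Set.Icc (0 : ℝ) 1 ∩ G, ‖f α‖ ^ 2) +
        lam ^ (t - 4) * ∫ α in Set.Icc (0 : ℝ) 1, ‖f α‖ ^ 4 := by
        rw [integral_add (i1.const_mul _) (i2.const_mul _), integral_const_mul, integral_const_mul,
          setIntegral_indicator hGm]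
    _ ≤ Q ^ (t - 2) * (2 * Q) + lam ^ (t - 4) * (C₄ * (N : ℝ) ^ (3 + χ * (t - 4) / 2)) := by
        gcongr
    _ = _ := by rw [hQpow, hlpow]; ring
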